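/- Let $X$ be a complex manifold of dimension $n$ (Hausdorff and second countable; for instance a smooth complex projective variety), let $D\subset X$ be a smooth divisor, and let $E_*$ be a parabolic vector bundle on $X$ with parabolic divisor $D$: a holomorphic vector bundle $E$ of rank $r\ge 1$ with a flag $E|_D=F_1\supsetneq F_2\supsetneq\cdots\supsetneq F_m\supsetneq F_{m+1}=0$ of holomorphic subbundles of $E|_D$ and rational weights $0\le\alpha_1\le\cdots\le\alpha_m<1$, where $\alpha_j$ is attached to $F_j/F_{j+1}$. Let $N$ be the least common denominator of the weights. Let $H$ be an admissible Hermitian metric on $E_*$: a smooth Hermitian metric on $E|_{X\setminus D}$ which near every point of $D$ descends from a smooth Hermitian metric on the equivariant bundle that induces $E_*$ on the minimal local branched cover. Explicitly, near every point of $D$ there are holomorphic coordinates $z$ with $D=\{z_1=0\}$ and a holomorphic frame $e_1,\dots,e_r$ of $E$, adapted to the flag, such that, with $a_i$ the weight of $e_i$ and $z=(w_1^N,w_2,\dots,w_n)$, the functions $\overline{w_1}^{\,-Na_i}\,\langle e_i,e_j\rangle_H\,w_1^{-Na_j}$ extend across $w_1=0$ to a smooth positive definite Hermitian matrix in the coordinates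 $w$. Over $X\setminus D$ the projectivization $\mathbb P(E_*)$ is the bundle $\pi:\mathbb P(E)|_{X\setminus D}\to X\setminus D$ of hyperplanes in the fibres of $E$, and $L_*=\mathcal O_{\mathbb P(E_*)}(1)_*$ is the tautological quotient line bundle of $\pi^*E$; let $h$ be the quotient metric induced on it by $H$. For a holomorphic bundle with Hermitian metric whose Chern connection has curvature $\Theta$, let $c=\det\bigl(1+\tfrac{\sqrt{-1}}{2\pi}\Theta\bigr)$ be the total Chern form and $s=1/c$ the total Segre form; write $s(E_*,H)$ and $s(L_*,h)$ for the Segre forms of $(E,H)$ on $X\setminus D$ and of $(L_*,h)$ on $\pi^{-1}(X\setminus D)$. Then, as smooth forms on $X\setminus D$, $$\pi_*\,s(L_*,h)=(-1)^{r-1}\,s(E_*,H),$$ where $\pi_*$ is the fibre integral. Moreover, for every smooth differential form $f$ with compact support on $X$, the forms $f\wedge s(E_*,H)$ and $\pi^*f\wedge s(L_*,h)$ are absolutely integrable over $X\setminus D$ and over $\pi^{-1}(X\setminus D)$ respectively (so the Segre forms define currents on pulled-back test forms, the preimages of $D$ being null sets), and $$\int_{\mathbb P(E_*)}\pi^*f\wedge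 s(L_*,h)=(-1)^{r-1}\int_X f\wedge s(E_*,H).$$ -/

import Mathlib

open Bundle Set MeasureTheory Topology
open scoped Manifold ContDiff ComplexOrder

noncomputable section

namespace ParabolicSegre

/-! ### Exterior forms at a point of `ℂ^ι`

Complex-valued exterior forms at a point of a complex manifold with coordinates indexed by `ι` are
elements of the exterior algebra over `ℂ` of the complexified real cotangent space, i.e. of the
complex vector space of `ℝ`-linear maps `ℂ^ι → ℂ`. Its product is the wedge product, and forms of
mixed degree (such as total Chern and Segre forms) are ordinary elements of it. -/

/-- The complexified real cotangent space of `ℂ^ι`. -/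
abbrev Covec (ι : Type) [Fintype ι] : Type := (ι → ℂ) →L[ℝ] ℂ

/-- Complex-valued exterior forms (of mixed degree) at a point of `ℂ^ι`. -/
abbrev Form (ι : Type) [Fintype ι] : Type := ExteriorAlgebra ℂ (Covec ι)

section forms

variable {ι κ : Type} [Fintype ι] [Fintype κ]

/-- The covector `dz_a`. -/
def dz (a : ι) : Covec ι := (ContinuousLinearMap.proj (R := ℝ) (φ := fun _ : ι => ℂ) a)

/-- The covector `d\bar z_a`. -/
def dzbar (a : ι) : Covec ι :=
  (Complex.conjCLE : ℂ →L[ℝ] ℂ).comp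
    (ContinuousLinearMap.proj (R := ℝ) (φ := fun _ : ι => ℂ) a)

/-- Pull-back of covectors along a real-linear map. -/
def pullCovec (A : (ι → ℂ) →L[ℝ] (κ → ℂ)) : Covec κ →ₗ[ℂ] Covec ι where
  toFun φ := φ.comp A
  map_add' _ _ := rfl
  map_smul' _ _ := rfl

/-- Pull-back of exterior forms along a real-linear map. -/
def pullForm (A : (ι → ℂ) →L[ℝ] (κ → ℂ)) : Form κ →ₐ[ℂ] Form ι :=
  ExteriorAlgebra.map (pullCovec A)

/-- The value `ω(v_1, …, v_k)` of the degree-`k` component of the form `ω` on `k` real tangent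
vectors, so that `(φ_1 ∧ ⋯ ∧ φ_k)(v_1, …, v_k) = det (φ_i (v_j))`. -/
def evalVec {k : ℕ} (v : Fin k → ι → ℂ) : Form ι →ₗ[ℂ] ℂ :=
  ExteriorAlgebra.liftAlternating
    (Pi.single k
      ((Matrix.detRowAlternating (R := ℂ) (n := Fin k)).compLinearMap
        { toFun := fun (φ : Covec ι) (j : Fin k) => φ (v j)
          map_add' := fun _ _ => rfl
          map_smul' := fun _ _ => rfl }))

/-- The real frame `e_0, i e_0, e_1, i e_1, …` of `ℂ^m`, positive for the complex orientation. -/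
def realFrame (m : ℕ) (j : Fin (m * 2)) : Fin m → ℂ :=
  Pi.single (finProdFinEquiv.symm j).1
    (if (finProdFinEquiv.symm j).2 = 0 then 1 else Complex.I)

/-- The coefficient of a form on `ℂ^n` with respect to the volume form
`dx_0 ∧ dy_0 ∧ dx_1 ∧ dy_1 ∧ ⋯`. -/
def topCoeff (n : ℕ) : Form (Fin n) →ₗ[ℂ] ℂ := evalVec (realFrame n)

/-- Given `k` tangent vectors of `ℂ^n`, the family of tangent vectors of `ℂ^n × ℂ^s`
consisting of these vectors (tangent to the first factor) followed by the real frame of the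
second factor. -/
def liftFrame {n : ℕ} (s : ℕ) {k : ℕ} (v : Fin k → Fin n → ℂ) :
    Fin (k + s * 2) → Fin n ⊕ Fin s → ℂ :=
  Fin.append (fun j => Sum.elim (v j) 0) (fun j => Sum.elim 0 (realFrame s j))

/-- The coefficient of a form on `ℂ^n × ℂ^s` with respect to the volume form given by the complex
orientation. -/
def topCoeffProd (n s : ℕ) : Form (Fin n ⊕ Fin s) →ₗ[ℂ] ℂ := evalVec (liftFrame s (realFrame n))

/-- The projection `ℂ^n × ℂ^s → ℂ^n`. -/
def baseProj (n s : ℕ) : (Fin n ⊕ Fin s → ℂ) →L[ℝ] (Fin n → ℂ) :=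
  ContinuousLinearMap.pi fun a =>
    ContinuousLinearMap.proj (R := ℝ) (φ := fun _ : Fin n ⊕ Fin s => ℂ) (Sum.inl a)

/-! ### Chern and Segre forms from a Gram matrix -/

variable [DecidableEq ι]

/-- The Wirtinger derivative `∂f/∂z_a`. -/
def dDz (a : ι) (f : (ι → ℂ) → ℂ) (u : ι → ℂ) : ℂ :=
  (1 / 2) * (fderiv ℝ f u (Pi.single a 1) - Complex.I * fderiv ℝ f u (Pi.single a Complex.I))

/-- The Wirtinger derivative `∂f/∂\bar z_a`. -/
def dDzbar (a : ι) (f : (ι → ℂ) → ℂ) (u : ι → ℂ) : ℂ :=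
  (1 / 2) * (fderiv ℝ f u (Pi.single a 1) + Complex.I * fderiv ℝ f u (Pi.single a Complex.I))

variable {r : ℕ}

/-- The coefficient of `dz_a` in the matrix `G⁻¹ ∂G` of the Chern connection, where
`G i j = ⟨e_i, e_j⟩` is the Gram matrix (conjugate-linear in the first slot) of a holomorphic
frame. -/
def connCoeff (G : (ι → ℂ) → Matrix (Fin r) (Fin r) ℂ) (a : ι) (u : ι → ℂ) :
    Matrix (Fin r) (Fin r) ℂ :=
  (G u)⁻¹ * Matrix.of fun i j => dDz a (fun v => G v i j) u

/-- The curvature matrix `Θ = \bar∂ (G⁻¹ ∂G)` of the Chern connection. -/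
def curvature (G : (ι → ℂ) → Matrix (Fin r) (Fin r) ℂ) (u : ι → ℂ) :
    Matrix (Fin r) (Fin r) (Form ι) :=
  Matrix.of fun i j => ∑ b, ∑ a,
    dDzbar b (fun v => connCoeff G a v i j) u •
      (ExteriorAlgebra.ι ℂ (dzbar b) * ExteriorAlgebra.ι ℂ (dz a))

/-- The total Chern form `c = det (1 + (i / 2π) Θ)`. The entries of the matrix are of even degree,
hence commute, so that the order of the factors in the Leibniz formula is irrelevant. -/
def chernForm (G : (ι → ℂ) → Matrix (Fin r) (Fin r) ℂ) (u : ι → ℂ) : Form ι :=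
  let M : Matrix (Fin r) (Fin r) (Form ι) :=
    1 + (Complex.I / (2 * (Real.pi : ℂ))) • curvature G u
  ∑ σ : Equiv.Perm (Fin r),
    ((Equiv.Perm.sign σ : ℤ)) • (List.ofFn fun i => M (σ i) i).prod

/-- The total Segre form `s = 1 / c`, the inverse of the total Chern form in the algebra of
exterior forms. -/
def segreForm (G : (ι → ℂ) → Matrix (Fin r) (Fin r) ℂ) (u : ι → ℂ) : Form ι :=
  Ring.inverse (chernForm G u)

end forms

/-! ### Complex manifolds, smooth divisors, local coordinates and frames -/

section geometry

variable (n s : ℕ) {X : Type*} [TopologicalSpace X] [ChartedSpace (Fin n → ℂ) X]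

/-- `φ` is a holomorphic coordinate chart of the complex manifold `X`. -/
def IsHolChart (φ : OpenPartialHomeomorph X (Fin n → ℂ)) : Prop :=
  φ ∈ IsManifold.maximalAtlas 𝓘(ℂ, Fin n → ℂ) ω X

/-- `φ` is a holomorphic chart in which the set `D` is the coordinate hyperplane `z_a = 0`. -/
def IsDivisorChart (D : Set X) (φ : OpenPartialHomeomorph X (Fin n → ℂ)) (a : Fin n) : Prop :=
  IsHolChart n φ ∧ ∀ x ∈ φ.source, x ∈ D ↔ φ x a = 0

/-- `D` is (the support of) a smooth reduced effective divisor of `X`. -/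
structure IsSmoothDivisor (D : Set X) : Prop where
  isClosed : IsClosed D
  exists_chart : ∀ p ∈ D, ∃ (φ : OpenPartialHomeomorph X (Fin n → ℂ)) (a : Fin n),
    p ∈ φ.source ∧ IsDivisorChart n D φ a

variable {n}

/-- A differential form on `X` is a function `f : X → Form (Fin n)`, whose value at `x` is an
exterior form on the tangent space `T_x X` (which Mathlib realizes on the model space).
This is its expression in a chart, i.e. its pull-back under `φ⁻¹`. -/
def localForm (f : X → Form (Fin n)) (φ : OpenPartialHomeomorph X (Fin n → ℂ))
    (u : Fin n → ℂ) : Form (Fin n) :=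
  pullForm (mfderiv 𝓘(ℝ, Fin n → ℂ) 𝓘(ℝ, Fin n → ℂ) φ.symm u :
    (Fin n → ℂ) →L[ℝ] (Fin n → ℂ)) (f (φ.symm u))

/-- A differential form is smooth if all its coefficients in all holomorphic charts are
`C^∞` functions (of the underlying real coordinates). -/
def IsSmoothForm (f : X → Form (Fin n)) : Prop :=
  ∀ φ : OpenPartialHomeomorph X (Fin n → ℂ), IsHolChart n φ →
    ∀ l : Form (Fin n) →ₗ[ℂ] ℂ, ContDiffOn ℝ ∞ (fun u => l (localForm f φ u)) φ.target

variable (E : X → Type*) [TopologicalSpace (TotalSpace (Fin (s + 1) → ℂ) E)]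
  [∀ x, AddCommGroup (E x)] [∀ x, Module ℂ (E x)] [∀ x, TopologicalSpace (E x)]
  [FiberBundle (Fin (s + 1) → ℂ) E]

variable (n) in
/-- A holomorphic chart of `X` together with a holomorphic frame of `E` over its domain. -/
structure FrameChart where
  chart : OpenPartialHomeomorph X (Fin n → ℂ)
  isHolChart : IsHolChart n chart
  frame : Fin (s + 1) → (x : X) → E x
  isFrame : IsLocalFrameOn 𝓘(ℂ, Fin n → ℂ) (Fin (s + 1) → ℂ) ω frame chart.source

variable {s E}

/-! ### Parabolic bundles and admissible metrics -/

/-- The Gram matrix of a family of sesquilinear forms in a frame, in local coordinates. -/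
def gram (H : ∀ x, E x →ₗ⋆[ℂ] E x →ₗ[ℂ] ℂ) (c : FrameChart n s E) (u : Fin n → ℂ) :
    Matrix (Fin (s + 1)) (Fin (s + 1)) ℂ :=
  Matrix.of fun i j => H (c.chart.symm u) (c.frame i (c.chart.symm u)) (c.frame j (c.chart.symm u))

/-- `H` is a smooth Hermitian metric on the restriction of `E` to `U`
(conjugate-linear in the first slot; the values outside `U` are irrelevant). -/
structure IsHermitianMetricOn (H : ∀ x, E x →ₗ⋆[ℂ] E x →ₗ[ℂ] ℂ) (U : Set X) : Prop where
  conj_symm : ∀ x ∈ U, ∀ v w, (starRingEnd ℂ) (H x v w) = H x w v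
  pos : ∀ x ∈ U, ∀ v, v ≠ 0 → 0 < (H x v v).re
  smooth : ∀ (c : FrameChart n s E) (i j), ContDiffOn ℝ ∞ (fun u => gram H c u i j)
    (c.chart.target ∩ c.chart.symm ⁻¹' U)

variable (n s E) in
/-- A parabolic structure on `E` along the smooth divisor `D`: a flag
`E|_D = F_0 ⊋ F_1 ⊋ ⋯ ⊋ F_{m-1} ⊋ F_m = 0` of holomorphic subbundles of `E|_D`, with rational
weights `0 ≤ α_0 ≤ ⋯ ≤ α_{m-1} < 1` attached to the successive quotients `F_j / F_{j+1}`.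
That the `F_j` are subbundles, of the ranks prescribed by `level`, is expressed by local
holomorphic frames of `E` that are adapted to the flag. -/
structure ParabolicStructure (D : Set X) where
  /-- the number of steps of the flag -/
  steps : ℕ
  /-- `flag j x ⊆ E_x` is the fibre of `F_j`; it is relevant only for `x ∈ D` -/
  flag : Fin steps → (x : X) → Submodule ℂ (E x)
  weight : Fin steps → ℚ
  weight_mono : Monotone weight
  weight_nonneg : ∀ j, 0 ≤ weight j
  weight_lt_one : ∀ j, weight j < 1
  /-- the `i`-th vector of an adapted frame lies in `F_{level i}` but not in `F_{level i + 1}` -/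
  level : Fin (s + 1) → Fin steps
  level_mono : Monotone level
  level_surjective : Function.Surjective level
  /-- near each point of `D` there is a holomorphic frame of `E` such that over `D` each `F_j` is
  spanned by the frame vectors of level at least `j` -/
  exists_adapted : ∀ p ∈ D, ∃ c : FrameChart n s E, p ∈ c.chart.source ∧
    ∀ x ∈ c.chart.source, x ∈ D → ∀ j,
      flag j x = Submodule.span ℂ ((fun i => c.frame i x) '' {i | j ≤ level i})

namespace ParabolicStructure

variable {D : Set X} (P : ParabolicStructure n s E D)

/-- The frame of `c` is adapted to the flag: over `D`, the bundle `F_j` is spanned by the frame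
vectors of level at least `j`. -/
def IsAdapted (c : FrameChart n s E) : Prop :=
  ∀ x ∈ c.chart.source, x ∈ D → ∀ j,
    P.flag j x = Submodule.span ℂ ((fun i => c.frame i x) '' {i | j ≤ P.level i})

/-- The least common denominator of the weights: the minimal ramification order along `D` of
the branched covers on which the parabolic bundle is induced by an equivariant bundle. -/
def denom : ℕ := Finset.univ.lcm fun j => (P.weight j).den

/-- The integer `N α_i`, where `α_i` is the weight of the `i`-th vector of an adapted frame. -/
def exponent (i : Fin (s + 1)) : ℤ := ((P.denom : ℚ) * P.weight (P.level i)).num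

end ParabolicStructure

/-- The branched cover `(w_1, …, w_n) ↦ (w_1, …, w_a ^ N, …, w_n)` of `ℂ^n`. -/
def cover (N : ℕ) (a : Fin n) (w : Fin n → ℂ) : Fin n → ℂ := Function.update w a (w a ^ N)

/-- `H` is an admissible Hermitian metric on the parabolic bundle `(E, P)`: it is a smooth
Hermitian metric on `E` over the complement of `D`, and near every point of `D` it is the descent
of a smooth Hermitian metric of the equivariant bundle over the minimal local branched cover
`z_a = w_a ^ N`. That equivariant bundle has the holomorphic frame `ẽ_i = w_a ^ (- N α_i) e_i`,
where `e` is an adapted frame of `E`; so the requirement is that the functions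
`⟨ẽ_i, ẽ_j⟩ = \bar{w_a} ^ (- N α_i) ⟨e_i, e_j⟩ w_a ^ (- N α_j)`, defined for `w_a ≠ 0`, extend to a
smooth positive definite matrix across `w_a = 0`. -/
structure IsAdmissible {D : Set X} (P : ParabolicStructure n s E D)
    (H : ∀ x, E x →ₗ⋆[ℂ] E x →ₗ[ℂ] ℂ) : Prop where
  isHermitianMetricOn : IsHermitianMetricOn (n := n) (s := s) H Dᶜ
  exists_extension : ∀ p ∈ D, ∃ (c : FrameChart n s E) (a : Fin n)
    (Ht : (Fin n → ℂ) → Matrix (Fin (s + 1)) (Fin (s + 1)) ℂ),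
    p ∈ c.chart.source ∧ IsDivisorChart n D c.chart a ∧ P.IsAdapted c ∧
    (∀ i j, ContDiffOn ℝ ∞ (fun w => Ht w i j) (cover P.denom a ⁻¹' c.chart.target)) ∧
    ∀ w ∈ cover P.denom a ⁻¹' c.chart.target, (Ht w).PosDef ∧
      (w a ≠ 0 → ∀ i j, Ht w i j =
        (starRingEnd ℂ) (w a) ^ (-P.exponent i) * gram H c (cover P.denom a w) i j *
          w a ^ (-P.exponent j))

/-! ### The projectivization and its tautological quotient line bundle -/

variable (E) in
/-- The projectivization `ℙ(E)` (Grothendieck's convention): its points over `x` are the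
hyperplanes of `E_x`, i.e. the lines of the dual space. Over the complement of the parabolic
divisor it is the projectivization of the parabolic bundle. -/
structure ProjBundle where
  base : X
  hyp : Submodule ℂ (E base)
  isCoatom : IsCoatom hyp

/-- The fibre of `𝒪(1)` at a point of `ℙ(E)`: the tautological quotient of `E_x`. -/
abbrev OOne (p : ProjBundle E) : Type _ := E p.base ⧸ p.hyp

/-- The (squared) quotient norm on `𝒪(1)` induced by `H`. -/
def quotNormSq (H : ∀ x, E x →ₗ⋆[ℂ] E x →ₗ[ℂ] ℂ) (p : ProjBundle E) (q : OOne p) : ℝ :=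
  sInf {t : ℝ | ∃ v : E p.base, p.hyp.mkQ v = q ∧ t = (H p.base v v).re}

theorem isCoatom_span_affine {V : Type*} [AddCommGroup V] [Module ℂ V]
    (b : Module.Basis (Fin (s + 1)) ℂ V) (w : Fin s → ℂ) :
    IsCoatom (Submodule.span ℂ (Set.range fun i : Fin s => b i.succ - w i • b 0)) := by
  classical
  set K := Submodule.span ℂ (Set.range fun i : Fin s => b i.succ - w i • b 0) with hK
  set ξ : V →ₗ[ℂ] ℂ := b.constr ℂ (Fin.cons 1 w : Fin (s + 1) → ℂ) with hξ
  have h0 : ξ (b 0) = 1 := by simp [hξ]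
  have hsucc : ∀ i : Fin s, ξ (b i.succ) = w i := by intro i; simp [hξ]
  have hle : K ≤ LinearMap.ker ξ := by
    rw [hK, Submodule.span_le]
    rintro _ ⟨i, rfl⟩
    simp [h0, hsucc]
  have hge : LinearMap.ker ξ ≤ K := by
    have hlin : K.mkQ = (K.mkQ.comp (LinearMap.toSpanSingleton ℂ V (b 0))).comp ξ := by
      refine b.ext fun i => ?_
      refine Fin.cases ?_ (fun i => ?_) i
      · simp [h0]
      · have hmem : b i.succ - w i • b 0 ∈ K := Submodule.subset_span ⟨i, rfl⟩
        have := (Submodule.Quotient.eq K).2 hmem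
        simpa [hsucc] using this
    have key : ∀ v : V, v - ξ v • b 0 ∈ K := by
      intro v
      refine (Submodule.Quotient.eq K).1 ?_
      simpa using LinearMap.congr_fun hlin v
    intro v hv
    have := key v
    rw [LinearMap.mem_ker.1 hv] at this
    simpa using this
  have hKer : K = LinearMap.ker ξ := le_antisymm hle hge
  rw [hKer]
  refine LinearMap.isCoatom_ker_of_surjective fun t => ⟨t • b 0, by simp [h0]⟩

/-- The affine coordinates of `ℙ(E)` attached to a chart and a frame: the point with coordinates
`(u, w)` is the hyperplane of `E_x`, where `x` has coordinates `u`, spanned by the vectors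
`e_{i+1} - w_i e_0`, i.e. the kernel of the functional `ξ` with `ξ(e_0) = 1`, `ξ(e_{i+1}) = w_i`. -/
def affinePoint (c : FrameChart n s E) (u : Fin n → ℂ) (hu : u ∈ c.chart.target) (w : Fin s → ℂ) :
    ProjBundle E where
  base := c.chart.symm u
  hyp := Submodule.span ℂ (Set.range fun i : Fin s =>
    c.frame i.succ (c.chart.symm u) - w i • c.frame 0 (c.chart.symm u))
  isCoatom := by
    have h := isCoatom_span_affine (c.isFrame.toBasisAt (c.chart.map_target hu)) w
    simpa only [IsLocalFrameOn.toBasisAt_coe] using h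

open Classical in
/-- The Gram matrix (of size one) of the induced metric of `𝒪(1)` in the affine coordinates
`(u, w)` of `ℙ(E)`, for the holomorphic frame of `𝒪(1)` given by the class of `e_0`. -/
def lineGram (H : ∀ x, E x →ₗ⋆[ℂ] E x →ₗ[ℂ] ℂ) (c : FrameChart n s E) (y : Fin n ⊕ Fin s → ℂ) :
    Matrix (Fin 1) (Fin 1) ℂ :=
  Matrix.of fun _ _ =>
    if hu : baseProj n s y ∈ c.chart.target then
      ((quotNormSq H (affinePoint c (baseProj n s y) hu fun i => y (Sum.inr i))
        (Submodule.Quotient.mk (c.frame 0 (c.chart.symm (baseProj n s y)))) : ℝ) : ℂ)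
    else 1

/-! ### Fibre integrals and integrals -/

/-- `θ` is the value at the point with coordinates `u` of the fibre integral `π_* η` of a form `η`
on `ℙ(E)`, given in affine coordinates:
`θ(v_1, …, v_k) = ∫ η(v_1, …, v_k, ·)`, the integral being over the fibre `ℙ(E_x)`, computed in
its affine chart, the complement of which is a null set. The integrability is part of the claim. -/
def IsFiberIntegral (η : (Fin n ⊕ Fin s → ℂ) → Form (Fin n ⊕ Fin s)) (u : Fin n → ℂ)
    (θ : Form (Fin n)) : Prop :=
  ∀ (k : ℕ) (v : Fin k → Fin n → ℂ),
    Integrable (fun w : Fin s → ℂ => evalVec (liftFrame s v) (η (Sum.elim u w))) ∧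
    ∫ w : Fin s → ℂ, evalVec (liftFrame s v) (η (Sum.elim u w)) = evalVec v θ

variable (n s E) in
/-- A decomposition of `U` into countably many disjoint Borel pieces, each contained in the domain
of a chart and a frame. The integral over `U` (over the part of `ℙ(E)` above `U`) of a form of top
degree is the sum of the integrals over the pieces. -/
structure Dissection (U : Set X) where
  frameChart : ℕ → FrameChart n s E
  piece : ℕ → Set X
  measurableSet_piece : ∀ i, MeasurableSet[borel X] (piece i)
  piece_subset : ∀ i, piece i ⊆ (frameChart i).chart.source
  disjoint : Pairwise (Function.onFun Disjoint piece)
  iUnion_piece : ⋃ i, piece i = U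

namespace Dissection

variable {U : Set X} (A : Dissection n s E U)

/-- The `i`-th piece in coordinates. -/
def coordPiece (i : ℕ) : Set (Fin n → ℂ) := (A.frameChart i).chart '' A.piece i

/-- The part of `ℙ(E)` above the `i`-th piece, in affine coordinates (up to a null set). -/
def projPiece (i : ℕ) : Set (Fin n ⊕ Fin s → ℂ) := baseProj n s ⁻¹' A.coordPiece i

end Dissection

/-- The family of densities `β i` on the coordinate domains `S i` is absolutely integrable. -/
def DensityIntegrable {V : Type*} [MeasureSpace V] (S : ℕ → Set V) (β : ℕ → V → ℂ) : Prop :=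
  (∀ i, IntegrableOn (β i) (S i)) ∧ Summable fun i => ∫ y in S i, ‖β i y‖

/-- The integral of a family of densities. -/
def densityIntegral {V : Type*} [MeasureSpace V] (S : ℕ → Set V) (β : ℕ → V → ℂ) : ℂ :=
  ∑' i, ∫ y in S i, β i y

/-- The density of `f ∧ s(E, H)` in the coordinates of `c`. -/
def baseDensity (H : ∀ x, E x →ₗ⋆[ℂ] E x →ₗ[ℂ] ℂ) (f : X → Form (Fin n)) (c : FrameChart n s E)
    (u : Fin n → ℂ) : ℂ :=
  topCoeff n (localForm f c.chart u * segreForm (gram H c) u)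

/-- The density of `π^* f ∧ s(𝒪(1), h)` in the affine coordinates of `ℙ(E)` attached to `c`. -/
def projDensity (H : ∀ x, E x →ₗ⋆[ℂ] E x →ₗ[ℂ] ℂ) (f : X → Form (Fin n)) (c : FrameChart n s E)
    (y : Fin n ⊕ Fin s → ℂ) : ℂ :=
  topCoeffProd n s
    (pullForm (baseProj n s) (localForm f c.chart (baseProj n s y)) * segreForm (lineGram H c) y)

end geometry

/-! ### Existence of frames and dissections -/

/-- Charts with holomorphic frames exist around every point. -/
theorem exists_frameChart {n s : ℕ} {X : Type*} [TopologicalSpace X]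
    [ChartedSpace (Fin n → ℂ) X] [IsManifold 𝓘(ℂ, Fin n → ℂ) ω X]
    (E : X → Type*) [TopologicalSpace (TotalSpace (Fin (s + 1) → ℂ) E)]
    [∀ x, AddCommGroup (E x)] [∀ x, Module ℂ (E x)] [∀ x, TopologicalSpace (E x)]
    [FiberBundle (Fin (s + 1) → ℂ) E] [VectorBundle ℂ (Fin (s + 1) → ℂ) E]
    [ContMDiffVectorBundle ω (Fin (s + 1) → ℂ) E 𝓘(ℂ, Fin n → ℂ)]
    (x : X) :
    ∃ c : FrameChart n s E, x ∈ c.chart.source := by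
  let t := trivializationAt (Fin (s + 1) → ℂ) E x
  have ht : IsOpen t.baseSet := t.open_baseSet
  let b := Pi.basisFun ℂ (Fin (s + 1))
  refine ⟨⟨(chartAt (Fin n → ℂ) x).restr t.baseSet, ?_, t.localFrame b, ?_⟩, ?_⟩
  · exact restr_mem_maximalAtlas _ (IsManifold.chart_mem_maximalAtlas x) ht
  · refine (t.isLocalFrameOn_localFrame_baseSet 𝓘(ℂ, Fin n → ℂ) ω b).mono ?_
    intro y hy
    rw [OpenPartialHomeomorph.restr_source, ht.interior_eq] at hy
    exact hy.2
  · show x ∈ ((chartAt (Fin n → ℂ) x).restr t.baseSet).source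
    rw [OpenPartialHomeomorph.restr_source, ht.interior_eq]
    exact ⟨mem_chart_source _ x, FiberBundle.mem_baseSet_trivializationAt' x⟩

/-- Every Borel subset of a (nonempty, second countable) complex manifold has a dissection. -/
theorem exists_dissection {n s : ℕ} {X : Type*} [TopologicalSpace X]
    [SecondCountableTopology X] [ChartedSpace (Fin n → ℂ) X] [IsManifold 𝓘(ℂ, Fin n → ℂ) ω X]
    (E : X → Type*) [TopologicalSpace (TotalSpace (Fin (s + 1) → ℂ) E)]
    [∀ x, AddCommGroup (E x)] [∀ x, Module ℂ (E x)] [∀ x, TopologicalSpace (E x)]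
    [FiberBundle (Fin (s + 1) → ℂ) E] [VectorBundle ℂ (Fin (s + 1) → ℂ) E]
    [ContMDiffVectorBundle ω (Fin (s + 1) → ℂ) E 𝓘(ℂ, Fin n → ℂ)]
    [Nonempty X] (U : Set X)
    (hU : MeasurableSet[borel X] U) :
    Nonempty (Dissection n s E U) := by
  choose c hc using exists_frameChart (n := n) (s := s) E
  obtain ⟨T, hT, hcov⟩ := TopologicalSpace.countable_cover_nhds (f := fun x => (c x).chart.source)
    fun x => (c x).chart.open_source.mem_nhds (hc x)
  have hne : T.Nonempty := by
    by_contra h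
    rw [Set.not_nonempty_iff_eq_empty] at h
    subst h
    simp at hcov
    exact (hcov.symm ▸ Set.mem_univ (Classical.arbitrary X) : _ ∈ (∅ : Set X))
  obtain ⟨g, hg⟩ := hT.exists_eq_range hne
  let _ : MeasurableSpace X := borel X
  have : BorelSpace X := ⟨rfl⟩
  refine ⟨⟨fun i => c (g i), fun i => disjointed (fun i => (c (g i)).chart.source) i ∩ U, ?_, ?_, ?_, ?_⟩⟩
  · intro i
    exact (MeasurableSet.disjointed (fun i => (c (g i)).chart.open_source.measurableSet) i).inter hU
  · intro i
    exact inter_subset_left.trans (disjointed_subset _ i)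
  · intro i j hij
    exact (disjoint_disjointed _ hij).mono inter_subset_left inter_subset_left
  · rw [← iUnion_inter, iUnion_disjointed]
    have : ⋃ i, (c (g i)).chart.source = univ := by
      rw [← hcov, hg, biUnion_range]
    rw [this, univ_inter]

end ParabolicSegre

end

open ParabolicSegre

noncomputable section

namespace ParabolicSegre

open scoped Matrix

/-! ### Covectors -/

section covectors

variable {ι κ : Type} [Fintype ι] [Fintype κ]

/-! Fix a frame with Gram matrix `G`, put `K = G⁻¹` and let `ξ = (1, w)` be the affine fibre
coordinate. The quotient norm of the class of `e_0` is `1 / (ξ K ξ^*)` (`quotNormSq_affinePoint`).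
Its normalized curvature is `ρ + ω` (`chernCurv_line`). Here `ρ = ξ Y K ξ^* / ξ K ξ^*` contracts the
normalized curvature `Y = (i/2π)Θ` of `E`, and `ω` is the Fubini–Study form pulled back along the
vertical projection of the Chern connection. Expand `s(L) = ∑ (-1)^m (ρ + ω)^m`. Fibre integration
keeps exactly the terms containing `ω^s`, which leaves `(-1)^s ∑_k (-1)^k C(k+s, s) ρ^k ω^s`
(`evalVec_segreForm_line`), that is, `(-1)^s (1 + ρ)^{-(s+1)}` against a probability density on the
fibre.

What remains is the identity that the fibre average of `(1 + ρ)^{-(s+1)}` equals `1 / det (1 + Y)`.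
For a complex matrix `Y` with `Y K` Hermitian and small, `(ξ K ξ^*)(1 + ρ) = ξ (K + Y K) ξ^*`, and
the integral of `(ξ M ξ^*)^{-(s+1)}` is `π^s / (s! det M)` (`integral_hval_pow`). The average is
therefore `det K / det (K + Y K)`. Comparing power series in a scaling parameter
(`hasSum_segrePart`) turns this into identities between polynomials in the entries of `Y`. They hold
on the real form where `Y K` is Hermitian, hence identically (`mvPolynomial_eq_zero_of_hermitian`),
hence over every commutative `ℂ`-algebra (`detPoly_mul_segreSeries`), in particular over the
commutative algebra of even forms, where two-forms are nilpotent and the series are finite.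

For integrability, compare every density with its supremum over the fibre, `supDensity`. Taken over
all `ξ ≠ 0`, this supremum is insensitive to the frame and changes under holomorphic maps only by
the real Jacobian (`supDensity_transform`). Away from `D` it is locally bounded. Near `D`, pull back
by the branched cover: admissibility says that the pulled-back metric, in the frame twisted by
powers of the branching coordinate, extends smoothly, so Jacobian times supremum is bounded
upstairs. A change of variables on a fundamental sector of the cover bounds the integral downstairs
(`exists_lintegral_lt_top_of_mem_divisor`). Compact support leaves finitely many such
neighbourhoods. Since the fibre density has mass one, the same bound controls the total space and
the base, and Fubini gives the integral formula. -/

@[simp] theorem dz_apply (a : ι) (v : ι → ℂ) : dz a v = v a := rfl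

@[simp] theorem dzbar_apply (a : ι) (v : ι → ℂ) : dzbar a v = (starRingEnd ℂ) (v a) := rfl

@[simp] theorem pullCovec_apply (A : (ι → ℂ) →L[ℝ] (κ → ℂ)) (φ : Covec κ) (v : ι → ℂ) :
    pullCovec A φ v = φ (A v) := rfl

variable [DecidableEq ι]

/-- The coefficient of `dz_a` of a covector. -/
def coeffDz (a : ι) : Covec ι →ₗ[ℂ] ℂ where
  toFun φ := (1 / 2) * (φ (Pi.single a 1) - Complex.I * φ (Pi.single a Complex.I))
  map_add' φ ψ := by simp only [add_apply]; ring
  map_smul' c φ := by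
    simp only [smul_apply, smul_eq_mul, RingHom.id_apply]; ring

/-- The coefficient of `d\bar z_a` of a covector. -/
def coeffDzbar (a : ι) : Covec ι →ₗ[ℂ] ℂ where
  toFun φ := (1 / 2) * (φ (Pi.single a 1) + Complex.I * φ (Pi.single a Complex.I))
  map_add' φ ψ := by simp only [add_apply]; ring
  map_smul' c φ := by
    simp only [smul_apply, smul_eq_mul, RingHom.id_apply]; ring

theorem coeffDz_apply (a : ι) (φ : Covec ι) :
    coeffDz a φ = (1 / 2) * (φ (Pi.single a 1) - Complex.I * φ (Pi.single a Complex.I)) := rfl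

theorem coeffDzbar_apply (a : ι) (φ : Covec ι) :
    coeffDzbar a φ = (1 / 2) * (φ (Pi.single a 1) + Complex.I * φ (Pi.single a Complex.I)) := rfl

/-- A real-linear functional is determined by its values on the vectors `e_a` and `i e_a`; splitting
them into complex-linear and conjugate-linear parts gives the two coefficients. -/
theorem covec_apply_eq (φ : Covec ι) (v : ι → ℂ) :
    φ v = ∑ a, (coeffDz a φ * v a + coeffDzbar a φ * (starRingEnd ℂ) (v a)) := by
  have hv : v = ∑ a, ((v a).re • (Pi.single a 1 : ι → ℂ) + (v a).im • (Pi.single a Complex.I : ι → ℂ)) := by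
    ext b
    simp only [Finset.sum_apply, Pi.add_apply, Pi.smul_apply]
    rw [Finset.sum_eq_single b]
    · simp [Complex.re_add_im]
    · intro a _ hab; simp [Pi.single_eq_of_ne hab.symm]
    · simp
  conv_lhs => rw [hv]
  rw [map_sum]
  refine Finset.sum_congr rfl fun a _ => ?_
  rw [map_add, map_smul, map_smul, coeffDz_apply, coeffDzbar_apply]
  simp only [Complex.real_smul]
  have h1 : v a = (v a).re + (v a).im * Complex.I := (Complex.re_add_im _).symm
  have h2 : (starRingEnd ℂ) (v a) = (v a).re - (v a).im * Complex.I := by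
    rw [Complex.ext_iff]; simp
  rw [h2]
  conv_rhs => rw [h1]
  simp only [Complex.add_re, Complex.ofReal_re, Complex.mul_re, Complex.I_re, Complex.ofReal_im,
    Complex.I_im, Complex.add_im, Complex.mul_im]
  push_cast
  linear_combination (φ (Pi.single a Complex.I) * (v a).im) * Complex.I_sq

theorem covec_eq_sum (φ : Covec ι) :
    φ = ∑ a, (coeffDz a φ • dz a + coeffDzbar a φ • dzbar a) := by
  ext v
  rw [covec_apply_eq φ v]
  simp

omit [DecidableEq ι] in
theorem span_dz_dzbar :
    Submodule.span ℂ (Set.range (Sum.elim (dz (ι := ι)) (dzbar (ι := ι)))) = ⊤ := by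
  classical
  rw [Submodule.eq_top_iff']
  intro φ
  rw [covec_eq_sum φ]
  refine Submodule.sum_mem _ fun a _ => Submodule.add_mem _ ?_ ?_
  · exact Submodule.smul_mem _ _ (Submodule.subset_span ⟨Sum.inl a, rfl⟩)
  · exact Submodule.smul_mem _ _ (Submodule.subset_span ⟨Sum.inr a, rfl⟩)

omit [DecidableEq ι] in
theorem finite_covec : Module.Finite ℂ (Covec ι) :=
  ⟨⟨(Set.finite_range (Sum.elim (dz (ι := ι)) dzbar)).toFinset, by simpa using span_dz_dzbar⟩⟩

omit [DecidableEq ι] in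
-- The upper bound given by the spanning family `dz_a`, `d\bar z_a` is all that is needed: it forces
-- long products of covectors to vanish, so that geometric series of curvatures terminate.
theorem finrank_covec_le : Module.finrank ℂ (Covec ι) ≤ Fintype.card ι * 2 := by
  have h := finrank_range_le_card (R := ℂ) (Sum.elim (dz (ι := ι)) (dzbar (ι := ι)))
  rw [Set.finrank, span_dz_dzbar, finrank_top, Fintype.card_sum] at h
  omega

omit [DecidableEq ι] in
theorem finite_form : Module.Finite ℂ (Form ι) := by
  have := finite_covec (ι := ι)
  exact Module.Finite.of_basis (Module.finBasis ℂ (Covec ι)).ExteriorAlgebra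

omit [DecidableEq ι] in
theorem ιMulti_eq_zero_of_card_lt {m : ℕ} (h : Fintype.card ι * 2 < m) (x : Fin m → Covec ι) :
    ExteriorAlgebra.ιMulti ℂ m x = 0 := by
  have := finite_covec (ι := ι)
  refine AlternatingMap.map_linearDependent _ _ fun hx => ?_
  have := hx.fintype_card_le_finrank
  rw [Fintype.card_fin] at this
  exact absurd (this.trans finrank_covec_le) (by omega)

omit [DecidableEq ι] in
theorem exteriorPower_eq_bot {m : ℕ} (h : Fintype.card ι * 2 < m) :
    (LinearMap.range (ExteriorAlgebra.ι ℂ : Covec ι →ₗ[ℂ] _)) ^ m = ⊥ := by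
  have := ExteriorAlgebra.ιMulti_span_fixedDegree (R := ℂ) (M := Covec ι) m
  refine this.symm.trans ?_
  rw [Submodule.span_eq_bot]
  rintro _ ⟨x, rfl⟩
  exact ιMulti_eq_zero_of_card_lt h x

end covectors

/-! ### The commutative algebra of even forms -/

section even

variable {ι κ : Type} [Fintype ι] [Fintype κ]

/-- Products of two covectors. -/
def twoProducts (ι : Type) [Fintype ι] : Set (Form ι) :=
  {x | ∃ a b : Covec ι, x = ExteriorAlgebra.ι ℂ a * ExteriorAlgebra.ι ℂ b}

/-- Moving two covectors past two others takes four transpositions, so the signs cancel. -/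
theorem twoProducts_comm : ∀ x ∈ twoProducts ι, ∀ y ∈ twoProducts ι, x * y = y * x := by
  rintro _ ⟨a, b, rfl⟩ _ ⟨c, d, rfl⟩
  have sw : ∀ x y : Covec ι, ExteriorAlgebra.ι ℂ x * ExteriorAlgebra.ι ℂ y =
      -(ExteriorAlgebra.ι ℂ y * ExteriorAlgebra.ι ℂ x) := fun x y =>
    eq_neg_of_add_eq_zero_left (ExteriorAlgebra.ι_add_mul_swap x y)
  set e := (ExteriorAlgebra.ι ℂ : Covec ι →ₗ[ℂ] _)
  calc e a * e b * (e c * e d) = e a * (e b * e c) * e d := by noncomm_ring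
    _ = -(e a * e c * (e b * e d)) := by rw [sw b c]; noncomm_ring
    _ = (e a * e c) * (e d * e b) := by rw [sw b d]; noncomm_ring
    _ = -(e c * (e a * e d) * e b) := by rw [sw a c]; noncomm_ring
    _ = e c * e d * (e a * e b) := by rw [sw a d]; noncomm_ring

/-- The commutative algebra of forms of even degree. -/
abbrev EvenForm (ι : Type) [Fintype ι] : Type := Algebra.adjoin ℂ (twoProducts ι)

/-- Commuting generators generate a commutative algebra. This makes determinants and polynomial
identities over commutative rings available for curvature matrices. -/
instance : CommRing (EvenForm ι) :=
  { Subalgebra.toRing (Algebra.adjoin ℂ (twoProducts ι)) with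
    mul_comm := (Algebra.isMulCommutative_adjoin ℂ (twoProducts_comm (ι := ι))).is_comm.comm }

/-- The product of two covectors as an even form. -/
def wedge (a b : Covec ι) : EvenForm ι :=
  ⟨ExteriorAlgebra.ι ℂ a * ExteriorAlgebra.ι ℂ b, Algebra.subset_adjoin ⟨a, b, rfl⟩⟩

@[simp] theorem coe_wedge (a b : Covec ι) :
    (wedge a b : Form ι) = ExteriorAlgebra.ι ℂ a * ExteriorAlgebra.ι ℂ b := rfl

/-- Pull-back of even forms. -/
def pullEven (A : (ι → ℂ) →L[ℝ] (κ → ℂ)) : EvenForm κ →ₐ[ℂ] EvenForm ι :=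
  ((pullForm A).comp (Subalgebra.val _)).codRestrict _ (by
    intro x
    have h : (Algebra.adjoin ℂ (twoProducts κ)).map (pullForm A) ≤
        Algebra.adjoin ℂ (twoProducts ι) := by
      rw [AlgHom.map_adjoin, Algebra.adjoin_le_iff]
      rintro _ ⟨_, ⟨a, b, rfl⟩, rfl⟩
      refine Algebra.subset_adjoin ⟨pullCovec A a, pullCovec A b, ?_⟩
      simp [pullForm]
    exact h ⟨x, x.2, rfl⟩)

@[simp] theorem coe_pullEven (A : (ι → ℂ) →L[ℝ] (κ → ℂ)) (x : EvenForm κ) :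
    (pullEven A x : Form ι) = pullForm A x := rfl

@[simp] theorem pullForm_ι (A : (ι → ℂ) →L[ℝ] (κ → ℂ)) (φ : Covec κ) :
    pullForm A (ExteriorAlgebra.ι ℂ φ) = ExteriorAlgebra.ι ℂ (pullCovec A φ) := by
  simp [pullForm]

theorem pullEven_wedge (A : (ι → ℂ) →L[ℝ] (κ → ℂ)) (a b : Covec κ) :
    pullEven A (wedge a b) = wedge (pullCovec A a) (pullCovec A b) := by
  ext; simp

/-- The space of even forms of degree two. -/
def evenTwo (ι : Type) [Fintype ι] : Submodule ℂ (EvenForm ι) :=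
  Submodule.span ℂ (Set.range fun p : Covec ι × Covec ι => wedge p.1 p.2)

theorem wedge_mem_evenTwo (a b : Covec ι) : wedge a b ∈ evenTwo ι :=
  Submodule.subset_span ⟨(a, b), rfl⟩

theorem coe_mem_of_mem_evenTwo {x : EvenForm ι} (hx : x ∈ evenTwo ι) :
    (x : Form ι) ∈ (LinearMap.range (ExteriorAlgebra.ι ℂ : Covec ι →ₗ[ℂ] _)) ^ 2 := by
  induction hx using Submodule.span_induction with
  | mem x hx =>
    obtain ⟨p, rfl⟩ := hx
    rw [pow_two]
    exact Submodule.mul_mem_mul ⟨_, rfl⟩ ⟨_, rfl⟩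
  | zero => exact Submodule.zero_mem _
  | add x y _ _ hx hy => exact Submodule.add_mem _ hx hy
  | smul c x _ hx => exact Submodule.smul_mem _ _ hx

/-- A product of more two-forms than the dimension vanishes. -/
theorem prod_evenTwo_eq_zero {m : ℕ} (h : Fintype.card ι < m) (x : Fin m → EvenForm ι)
    (hx : ∀ i, x i ∈ evenTwo ι) : ∏ i, x i = 0 := by
  have key : ∀ (l : List (EvenForm ι)), (∀ y ∈ l, y ∈ evenTwo ι) →
      (l.prod : Form ι) ∈
        (LinearMap.range (ExteriorAlgebra.ι ℂ : Covec ι →ₗ[ℂ] _)) ^ (2 * l.length) := by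
    intro l
    induction l with
    | nil => intro _; simp
    | cons y l ih =>
      intro hl
      rw [List.prod_cons, List.length_cons, mul_add, mul_one, add_comm, pow_add]
      exact Submodule.mul_mem_mul (coe_mem_of_mem_evenTwo (hl y (by simp)))
        (ih fun z hz => hl z (by simp [hz]))
  have := key (List.ofFn x) (by simpa [List.mem_ofFn] using hx)
  rw [List.length_ofFn, exteriorPower_eq_bot (by omega), Submodule.mem_bot] at this
  rw [← List.prod_ofFn]
  exact Subtype.ext this

theorem pow_evenTwo_eq_zero {m : ℕ} (h : Fintype.card ι < m) {x : EvenForm ι}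
    (hx : x ∈ evenTwo ι) : x ^ m = 0 := by
  simpa using prod_evenTwo_eq_zero h (fun _ : Fin m => x) fun _ => hx

/-- In the expansion over maps `Fin s → Fin s`, a map that is not injective repeats a factor of
square zero. Only the `s!` bijections survive, each contributing the full product. -/
theorem sum_pow_of_sq_zero {R : Type*} [CommRing R] {s : ℕ} (x : Fin s → R)
    (hx : ∀ i, x i * x i = 0) : (∑ i, x i) ^ s = (s.factorial : R) * ∏ i, x i := by
  classical
  rw [Fintype.sum_pow]
  have h : ∀ p : Fin s → Fin s, ∏ i, x (p i) =
      if Function.Bijective p then ∏ i, x i else 0 := by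
    intro p
    split_ifs with hp
    · exact Function.Bijective.prod_comp hp x
    · rw [← Finite.injective_iff_bijective, Function.Injective] at hp
      push Not at hp
      obtain ⟨i, j, hij, hne⟩ := hp
      rw [← Finset.mul_prod_erase _ _ (Finset.mem_univ i),
        ← Finset.mul_prod_erase _ _ (Finset.mem_erase.2 ⟨hne.symm, Finset.mem_univ j⟩),
        ← mul_assoc, hij, hx, zero_mul]
  rw [Finset.sum_congr rfl fun p _ => h p]
  rw [← Finset.sum_filter, Finset.sum_const, nsmul_eq_mul]
  congr 2
  rw [← Fintype.card_subtype, ← Fintype.card_congr (Equiv.ofBijective (f := fun σ : Equiv.Perm (Fin s) => (⟨σ, σ.bijective⟩ : {p : Fin s → Fin s // Function.Bijective p})) ⟨fun a b hab => Equiv.ext fun i => congrFun (congrArg Subtype.val hab) i, fun p => ⟨Equiv.ofBijective p.1 p.2, rfl⟩⟩), Fintype.card_perm, Fintype.card_fin]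

end even

/-! ### Evaluation of forms on tangent vectors -/

section evaluation

variable {ι κ : Type} [Fintype ι] [Fintype κ]

theorem evalVec_ιMulti {k : ℕ} (v : Fin k → ι → ℂ) (x : Fin k → Covec ι) :
    evalVec v (ExteriorAlgebra.ιMulti ℂ k x) = (Matrix.of fun i j => x i (v j)).det := by
  rw [evalVec, ExteriorAlgebra.liftAlternating_apply_ιMulti, Pi.single_eq_same]
  rfl

theorem evalVec_ιMulti_of_ne {k m : ℕ} (h : m ≠ k) (v : Fin k → ι → ℂ) (x : Fin m → Covec ι) :
    evalVec v (ExteriorAlgebra.ιMulti ℂ m x) = 0 := by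
  rw [evalVec, ExteriorAlgebra.liftAlternating_apply_ιMulti, Pi.single_eq_of_ne h]
  rfl

theorem evalVec_ιMulti_cast {k m : ℕ} (h : k = m) (v : Fin k → ι → ℂ) (x : Fin m → Covec ι) :
    evalVec v (ExteriorAlgebra.ιMulti ℂ m x) =
      (Matrix.of fun i j => x (Fin.cast h i) (v j)).det := by
  subst h
  exact evalVec_ιMulti v x

/-- Two linear functionals on forms agree if they agree on products of covectors. -/
theorem form_linear_ext {N : Type*} [AddCommGroup N] [Module ℂ N] {f g : Form ι →ₗ[ℂ] N}
    (h : ∀ (m : ℕ) (x : Fin m → Covec ι),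
      f (ExteriorAlgebra.ιMulti ℂ m x) = g (ExteriorAlgebra.ιMulti ℂ m x)) : f = g := by
  refine LinearMap.ext_on_range (v := fun x : Σ m, (Fin m → Covec ι) =>
    ExteriorAlgebra.ιMulti ℂ x.1 x.2) (ExteriorAlgebra.ιMulti_span ℂ _) ?_
  rintro ⟨m, x⟩
  exact h m x

theorem pullForm_ιMulti (A : (ι → ℂ) →L[ℝ] (κ → ℂ)) {m : ℕ} (x : Fin m → Covec κ) :
    pullForm A (ExteriorAlgebra.ιMulti ℂ m x) =
      ExteriorAlgebra.ιMulti ℂ m fun i => pullCovec A (x i) := by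
  rw [pullForm, ExteriorAlgebra.map_apply_ιMulti]; rfl

/-- Pigeonhole in the Leibniz formula: a permutation cannot send all `l` columns of the block into
the `b < l` rows outside it, so every term has a zero factor. -/
theorem det_eq_zero_of_zero_block {a b k l : ℕ} (hm : k + l = a + b) (hb : b < l)
    (M : Matrix (Fin (k + l)) (Fin (k + l)) ℂ)
    (hM : ∀ (i : Fin a) (j : Fin l),
      M (Fin.cast hm.symm (Fin.castAdd b i)) (Fin.natAdd k j) = 0) : M.det = 0 := by
  rw [Matrix.det_apply]
  refine Finset.sum_eq_zero fun σ _ => ?_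
  obtain ⟨j, hj⟩ : ∃ j : Fin l, (σ (Fin.natAdd k j) : ℕ) < a := by
    by_contra hcon
    push Not at hcon
    have : Function.Injective fun j : Fin l =>
        (⟨(σ (Fin.natAdd k j) : ℕ) - a, by
          have := (σ (Fin.natAdd k j)).2; have := hcon j; omega⟩ : Fin b) := by
      intro j j' hjj
      simp only [Fin.mk.injEq] at hjj
      have h1 := hcon j
      have h2 := hcon j'
      have h3 : σ (Fin.natAdd k j) = σ (Fin.natAdd k j') := Fin.ext (by omega)
      simpa [Fin.ext_iff] using σ.injective h3
    have := Fintype.card_le_of_injective _ this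
    simp at this
    omega
  have hz : M (σ (Fin.natAdd k j)) (Fin.natAdd k j) = 0 := by
    rw [← hM ⟨_, hj⟩ j]
    congr 1
  have h0 : ∏ i, M (σ i) i = 0 := Finset.prod_eq_zero (Finset.mem_univ (Fin.natAdd k j)) hz
  rw [h0, smul_zero]

/-- Fibre evaluation of a product of a form pulled back from the base and a form pulled back from
the fibre along a linear retraction. -/
theorem evalVec_liftFrame_mul {n s : ℕ} (P : (Fin n ⊕ Fin s → ℂ) →L[ℝ] (Fin s → ℂ))
    (hP : ∀ w, P (Sum.elim 0 w) = w) {k : ℕ} (v : Fin k → Fin n → ℂ) (α : Form (Fin n))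
    (β : Form (Fin s)) :
    evalVec (liftFrame s v) (pullForm (baseProj n s) α * pullForm P β) =
      evalVec v α * topCoeff s β := by
  have key : ((LinearMap.mul ℂ (Form (Fin n ⊕ Fin s))).compl₁₂
      (pullForm (baseProj n s)).toLinearMap (pullForm P).toLinearMap).compr₂
        (evalVec (liftFrame s v)) =
      (LinearMap.mul ℂ ℂ).compl₁₂ (evalVec v) (topCoeff s) := by
    refine form_linear_ext fun a x => form_linear_ext fun b y => ?_
    simp only [LinearMap.compr₂_apply, LinearMap.compl₁₂_apply, AlgHom.toLinearMap_apply,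
      LinearMap.mul_apply', pullForm_ιMulti, ExteriorAlgebra.ιMulti_mul_ιMulti, topCoeff]
    have hbase : ∀ w, baseProj n s (Sum.elim 0 w) = 0 := fun w => rfl
    by_cases hm : k + s * 2 = a + b
    -- Compare the number `b` of fibre covectors with the real fibre dimension. With too few, the
    -- base covectors, which vanish on the vertical frame, form an oversized zero block. With
    -- exactly `2s`, the matrix is block triangular, and the values of `P` on horizontal vectors lie
    -- in the irrelevant corner. With too many, the fibre form is zero.
    · rcases lt_trichotomy b (s * 2) with hb | hb | hb
      · rw [evalVec_ιMulti_of_ne hb.ne, mul_zero, evalVec_ιMulti_cast hm]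
        refine det_eq_zero_of_zero_block hm hb _ fun i j => ?_
        simp [liftFrame, hbase]
      · obtain rfl : a = k := by omega
        subst hb
        rw [evalVec_ιMulti, evalVec_ιMulti, evalVec_ιMulti,
          ← Matrix.det_submatrix_equiv_self finSumFinEquiv,
          ← Matrix.det_fromBlocks_zero₁₂ _ (Matrix.of fun i j =>
            y i (P (Sum.elim (v j) 0)))]
        congr 1
        ext i j
        rcases i with i | i <;> rcases j with j | j
        · simp [liftFrame]; rfl
        · simp [liftFrame, hbase]
        · simp [liftFrame]
        · simp [liftFrame, hP]
      · rw [ιMulti_eq_zero_of_card_lt (by simpa using hb) y, map_zero, mul_zero,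
          ← ExteriorAlgebra.ιMulti_mul_ιMulti, ← pullForm_ιMulti P y,
          ιMulti_eq_zero_of_card_lt (by simpa using hb) y, map_zero, mul_zero, map_zero]
    · rw [evalVec_ιMulti_of_ne (Ne.symm hm)]
      by_cases ha : a = k
      · rw [evalVec_ιMulti_of_ne (by omega : b ≠ s * 2), mul_zero]
      · rw [evalVec_ιMulti_of_ne ha, zero_mul]
  exact LinearMap.congr_fun₂ key α β

/-- The basis underlying `realFrame`. -/
def realBasis (n : ℕ) : Module.Basis (Fin (n * 2)) ℝ (Fin n → ℂ) :=
  (Pi.basis fun _ : Fin n => Complex.basisOneI).reindex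
    ((Equiv.sigmaEquivProd _ _).trans finProdFinEquiv)

theorem realBasis_apply (n : ℕ) (j : Fin (n * 2)) : realBasis n j = realFrame n j := by
  rw [realBasis, Module.Basis.reindex_apply, Pi.basis_apply, realFrame]
  simp only [Equiv.symm_trans_apply, Equiv.sigmaEquivProd_symm_apply, Complex.coe_basisOneI]
  congr 1
  generalize (finProdFinEquiv.symm j).2 = e
  fin_cases e <;> rfl

/-- On a product of `2n` covectors, the matrix of values on the transformed frame is the original
matrix times the real matrix of `A`. In other degrees both sides vanish. -/
theorem topCoeff_pullForm {n : ℕ} (A : (Fin n → ℂ) →L[ℝ] (Fin n → ℂ)) (θ : Form (Fin n)) :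
    topCoeff n (pullForm A θ) = (A.det : ℝ) * topCoeff n θ := by
  refine LinearMap.congr_fun (f := (topCoeff n).comp (pullForm A).toLinearMap)
    (g := ((A.det : ℝ) : ℂ) • topCoeff n) (form_linear_ext fun m x => ?_) θ
  simp only [LinearMap.comp_apply, AlgHom.toLinearMap_apply, pullForm_ιMulti, LinearMap.smul_apply,
    topCoeff, smul_eq_mul]
  by_cases h : m = n * 2
  · subst h
    rw [evalVec_ιMulti, evalVec_ιMulti]
    have hA : ((A.det : ℝ) : ℂ) = ((LinearMap.toMatrix (realBasis n) (realBasis n) A.toLinearMap).map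
        (algebraMap ℝ ℂ)).det := by
      rw [ContinuousLinearMap.det, ← LinearMap.det_toMatrix (realBasis n), ← RingHom.mapMatrix_apply,
        ← RingHom.map_det]
      rfl
    rw [hA, mul_comm (Matrix.det _) (Matrix.det _), ← Matrix.det_mul]
    congr 1
    ext i j
    simp only [Matrix.of_apply, Matrix.mul_apply, Matrix.map_apply, pullCovec_apply]
    conv_lhs => rw [← realBasis_apply, ← (realBasis n).sum_repr (A (realBasis n j))]
    rw [map_sum]
    refine Finset.sum_congr rfl fun k _ => ?_
    rw [map_smul, LinearMap.toMatrix_apply, Complex.real_smul, mul_comm, realBasis_apply]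
    rfl
  · rw [evalVec_ιMulti_of_ne h, evalVec_ιMulti_of_ne h, mul_zero]

/-- The interleaved order `p_0, q_0, p_1, q_1, …` is chosen to match `realFrame`: both place the
pair `(i, j)` at position `2i + j`. -/
theorem coe_prod_wedge {s : ℕ} (p q : Fin s → Covec ι) :
    ((∏ i, wedge (p i) (q i) : EvenForm ι) : Form ι) = ExteriorAlgebra.ιMulti ℂ (s * 2)
      fun j => if (finProdFinEquiv.symm j).2 = 0 then p (finProdFinEquiv.symm j).1
        else q (finProdFinEquiv.symm j).1 := by
  rw [ExteriorAlgebra.ιMulti_apply, List.ofFn_mul, List.prod_flatten, ← List.prod_ofFn]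
  have : ∀ l : List (EvenForm ι), ((l.prod : EvenForm ι) : Form ι) =
      (l.map fun x : EvenForm ι => (x : Form ι)).prod := fun l =>
    map_list_prod (Subalgebra.val (Algebra.adjoin ℂ (twoProducts ι))) l
  rw [this, List.map_ofFn, List.map_ofFn]
  congr 2
  funext i
  have e : ∀ (j : Fin 2) (h : (i : ℕ) * 2 + j < s * 2),
      finProdFinEquiv.symm (⟨(i : ℕ) * 2 + j, h⟩ : Fin (s * 2)) = (i, j) := by
    intro j h
    rw [Equiv.symm_apply_eq]
    ext
    simp [mul_comm, add_comm]
  simp only [Function.comp_apply, e]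
  simp [List.ofFn_succ]

/-- The top degree part of the `s`-th power of a form of type `(1,1)` on `ℂ^s`. -/
theorem topCoeff_pow {s : ℕ} (c : ℂ) (g : Matrix (Fin s) (Fin s) ℂ) :
    topCoeff s ((c • ∑ i, ∑ j, g i j • wedge (dz i) (dzbar j) : EvenForm (Fin s)) ^ s :
      EvenForm (Fin s)) = (s.factorial : ℂ) * (-2 * Complex.I * c) ^ s * g.det := by
  -- Absorbing the sum over `j` into one covector makes each summand decomposable, hence of square
  -- zero.
  have h1 : ∀ i, ∑ j, g i j • wedge (dz i) (dzbar j) =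
      wedge (dz i) (∑ j, g i j • dzbar j : Covec (Fin s)) := by
    intro i
    ext
    simp [Finset.mul_sum, map_sum, AddSubmonoidClass.coe_finsetSum]
  simp_rw [h1]
  rw [smul_pow, sum_pow_of_sq_zero]
  · have h2 : ((s.factorial : EvenForm (Fin s)) * ∏ i, wedge (dz i) (∑ j, g i j • dzbar j)) =
      (s.factorial : ℂ) • ∏ i, wedge (dz i) (∑ j, g i j • dzbar j : Covec (Fin s)) := by
      rw [Algebra.smul_def, map_natCast]
    rw [h2, Subalgebra.coe_smul, Subalgebra.coe_smul, map_smul, map_smul, coe_prod_wedge, topCoeff,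
      evalVec_ιMulti]
    -- Reindexing rows and columns simultaneously costs no sign. With the `dz` rows and the real
    -- vectors first, the matrix has blocks `1`, `i`, `g`, `-i g`; its Schur complement `-i g - g i
    -- = -2i g` explains the factor `-2i`.
    let e : Fin s ⊕ Fin s ≃ Fin (s * 2) :=
      ((Equiv.boolProdEquivSum (Fin s)).symm.trans
        ((Equiv.prodCongr finTwoEquiv.symm (Equiv.refl _)).trans (Equiv.prodComm _ _))).trans
        finProdFinEquiv
    have he1 : ∀ i, finProdFinEquiv.symm (e (Sum.inl i)) = (i, 0) := fun i => by
      rw [Equiv.symm_apply_eq]; rfl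
    have he2 : ∀ i, finProdFinEquiv.symm (e (Sum.inr i)) = (i, 1) := fun i => by
      rw [Equiv.symm_apply_eq]; rfl
    rw [← Matrix.det_submatrix_equiv_self e]
    have hM : ((Matrix.of fun i j =>
        (if (finProdFinEquiv.symm i).2 = 0 then dz (finProdFinEquiv.symm i).1
          else ∑ j, g (finProdFinEquiv.symm i).1 j • dzbar j : Covec (Fin s)) (realFrame s j)).submatrix
          e e) = Matrix.fromBlocks 1 (Complex.I • (1 : Matrix (Fin s) (Fin s) ℂ)) g
            ((-Complex.I) • g) := by
      ext i j
      rw [Matrix.submatrix_apply, Matrix.of_apply, realFrame]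
      rcases i with i | i <;> rcases j with j | j <;> 
        simp only [he1, he2, if_true, one_ne_zero, if_false]
      · simp [Matrix.one_apply, Pi.single_apply]
      · simp [Matrix.one_apply, Pi.single_apply]
      · simp [Pi.single_apply, apply_ite]
      · simp [Pi.single_apply, apply_ite, mul_comm]
    rw [hM, Matrix.det_fromBlocks_one₁₁]
    have : (-Complex.I) • g - g * (Complex.I • (1 : Matrix (Fin s) (Fin s) ℂ)) =
        (-2 * Complex.I) • g := by
      rw [Matrix.mul_smul, mul_one, ← sub_smul]; congr 1; ring
    rw [this, Matrix.det_smul, Fintype.card_fin, mul_pow (-2 * Complex.I) c]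
    simp only [smul_eq_mul]
    ring
  · intro i
    ext
    simp only [Subalgebra.coe_mul, coe_wedge, Subalgebra.coe_zero]
    have sw : ∀ x y : Covec (Fin s), ExteriorAlgebra.ι ℂ x * ExteriorAlgebra.ι ℂ y =
        -(ExteriorAlgebra.ι ℂ y * ExteriorAlgebra.ι ℂ x) := fun x y =>
      eq_neg_of_add_eq_zero_left (ExteriorAlgebra.ι_add_mul_swap x y)
    generalize (∑ j, g i j • dzbar j : Covec (Fin s)) = q
    rw [mul_assoc, ← mul_assoc (ExteriorAlgebra.ι ℂ q), sw q (dz i), neg_mul, mul_neg,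
      ← mul_assoc, ← mul_assoc, ExteriorAlgebra.ι_sq_zero, zero_mul, zero_mul, neg_zero]

end evaluation

/-! ### The integral over an affine chart of projective space -/

section scalar

/-- In polar coordinates the radial integrand `y (a + y²)^{-(m+2)}` has an elementary primitive
vanishing at infinity; the angle contributes `2π`. -/
theorem lintegral_complex_radial {a : ℝ} (ha : 0 < a) (m : ℕ) :
    ∫⁻ z : ℂ, ENNReal.ofReal (((a + ‖z‖ ^ 2) ^ (m + 2))⁻¹) =
      ENNReal.ofReal (Real.pi / ((m + 1) * a ^ (m + 1))) := by
  set f : ℝ → ℝ := fun y => ((a + y ^ 2) ^ (m + 2))⁻¹ with hf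
  set g : ℝ → ℝ := fun y => -(2 * (m + 1) * (a + y ^ 2) ^ (m + 1))⁻¹ with hg
  have hpos : ∀ y : ℝ, 0 < a + y ^ 2 := fun y => by positivity
  have hm : (0 : ℝ) < m + 1 := by positivity
  have hderiv : ∀ y ∈ Ioi (0 : ℝ), HasDerivAt g (y * f y) y := by
    intro y _
    have h1 : HasDerivAt (fun y : ℝ => 2 * (m + 1) * (a + y ^ 2) ^ (m + 1))
        (2 * (m + 1) * (((m + 1 : ℕ) : ℝ) * (a + y ^ 2) ^ m * (2 * y))) y := by
      have := (((hasDerivAt_pow 2 y).const_add a).pow (m + 1)).const_mul (2 * ((m : ℝ) + 1))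
      simpa using this
    have h2 := (h1.inv (by have := hpos y; positivity)).neg
    convert! h2 using 1
    simp only [hf]
    have := (hpos y).ne'
    push_cast
    field_simp
    ring
  have hcont : ContinuousWithinAt g (Ici 0) 0 := by
    refine Continuous.continuousWithinAt ?_
    refine (Continuous.inv₀ (by fun_prop) fun y => ?_).neg
    have := hpos y
    positivity
  have hlim : Filter.Tendsto g Filter.atTop (𝓝 0) := by
    have h1 : Filter.Tendsto (fun y : ℝ => 2 * (m + 1) * (a + y ^ 2) ^ (m + 1))
        Filter.atTop Filter.atTop := by
      refine Filter.Tendsto.const_mul_atTop (by positivity) ?_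
      refine (Filter.tendsto_pow_atTop (by omega)).comp ?_
      exact Filter.tendsto_atTop_add_const_left _ _ (Filter.tendsto_pow_atTop (by omega))
    have h2 := h1.inv_tendsto_atTop.neg
    rw [neg_zero] at h2
    exact h2
  have hnn : ∀ y ∈ Ioi (0 : ℝ), 0 ≤ y * f y := fun y hy => by
    have := hpos y
    have : (0 : ℝ) < y := hy
    positivity
  have hint := integrableOn_Ioi_deriv_of_nonneg hcont hderiv hnn hlim
  have hval := integral_Ioi_of_hasDerivAt_of_nonneg hcont hderiv hnn hlim
  have hI : Integrable (fun z : ℂ => f ‖z‖) := by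
    rw [integrable_fun_norm_addHaar]
    simpa using hint
  change ∫⁻ z : ℂ, ENNReal.ofReal (f ‖z‖) = _
  rw [← ofReal_integral_eq_lintegral_ofReal hI
    (Filter.Eventually.of_forall fun z => by have := hpos ‖z‖; positivity),
    integral_fun_norm_addHaar]
  congr 1
  have hb : (volume : Measure ℂ).real (Metric.ball 0 1) = Real.pi := by
    simp [Measure.real, Complex.volume_ball]
  simp only [Complex.finrank_real_complex, hb, smul_eq_mul, nsmul_eq_mul, Nat.add_one_sub_one,
    pow_one]
  norm_num only [pow_one]
  rw [hval]
  simp only [hg]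
  have := ha.ne'
  field_simp
  ring

/-- Integrate out one coordinate with the others absorbed in the constant: this lowers the exponent
by one and produces the factor `π / (s + 1)`. Working with nonnegative integrals makes Tonelli
unconditional. -/
theorem lintegral_fubini_study (s : ℕ) : ∀ {a : ℝ}, 0 < a →
    ∫⁻ w : Fin s → ℂ, ENNReal.ofReal (((a + ∑ i, ‖w i‖ ^ 2) ^ (s + 1))⁻¹) =
      ENNReal.ofReal (Real.pi ^ s / (s.factorial * a)) := by
  induction s with
  | zero =>
    intro a ha
    rw [lintegral_unique]
    simp [volume_pi]
  | succ s ih =>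
    intro a ha
    rw [← (volume_preserving_piFinSuccAbove (fun _ : Fin (s + 1) => ℂ) 0).symm.lintegral_comp_emb
      (MeasurableEquiv.measurableEmbedding _), Measure.volume_eq_prod, lintegral_prod_symm]
    · have h1 : ∀ y : Fin s → ℂ, ∫⁻ x : ℂ, ENNReal.ofReal (((a + ∑ i, ‖(MeasurableEquiv.piFinSuccAbove
          (fun _ : Fin (s + 1) => ℂ) 0).symm (x, y) i‖ ^ 2) ^ (s + 1 + 1))⁻¹) =
          ENNReal.ofReal (Real.pi / (s + 1)) *
            ENNReal.ofReal (((a + ∑ i, ‖y i‖ ^ 2) ^ (s + 1))⁻¹) := by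
        intro y
        have hp : 0 < a + ∑ i, ‖y i‖ ^ 2 := by positivity
        rw [← ENNReal.ofReal_mul (by positivity)]
        have := lintegral_complex_radial hp s
        rw [show Real.pi / (s + 1) * ((a + ∑ i, ‖y i‖ ^ 2) ^ (s + 1))⁻¹ =
          Real.pi / ((s + 1) * (a + ∑ i, ‖y i‖ ^ 2) ^ (s + 1)) by field_simp, ← this]
        refine lintegral_congr fun x => ?_
        simp [MeasurableEquiv.piFinSuccAbove, Fin.sum_univ_succ, add_comm, add_left_comm]
      simp_rw [h1]
      rw [lintegral_const_mul _ (by fun_prop), ih ha, ← ENNReal.ofReal_mul (by positivity)]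
      congr 1
      rw [Nat.factorial_succ]
      push_cast
      field_simp
      ring
    · refine Measurable.aemeasurable ?_
      refine Measurable.comp (g := fun w : Fin (s + 1) → ℂ =>
        ENNReal.ofReal (((a + ∑ i, ‖w i‖ ^ 2) ^ (s + 1 + 1))⁻¹)) ?_ (MeasurableEquiv.measurable _)
      fun_prop

theorem fubini_study_integrable (s : ℕ) {a : ℝ} (ha : 0 < a) :
    Integrable fun w : Fin s → ℂ => ((a + ∑ i, ‖w i‖ ^ 2) ^ (s + 1))⁻¹ := by
  refine ⟨Measurable.aestronglyMeasurable (by fun_prop), ?_⟩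
  rw [hasFiniteIntegral_iff_ofReal (Filter.Eventually.of_forall fun w => by positivity),
    lintegral_fubini_study s ha]
  exact ENNReal.ofReal_lt_top

theorem fubini_study_integral (s : ℕ) {a : ℝ} (ha : 0 < a) :
    ∫ w : Fin s → ℂ, ((a + ∑ i, ‖w i‖ ^ 2) ^ (s + 1))⁻¹ = Real.pi ^ s / (s.factorial * a) := by
  rw [integral_eq_lintegral_of_nonneg_ae (Filter.Eventually.of_forall fun w => by positivity)
    (fubini_study_integrable s ha).aestronglyMeasurable, lintegral_fubini_study s ha,
    ENNReal.toReal_ofReal (by positivity)]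

/-- The sesquilinear value `ξ M ξ^*`. -/
def hval {m : ℕ} (M : Matrix (Fin m) (Fin m) ℂ) (ξ : Fin m → ℂ) : ℂ := ξ ⬝ᵥ M.mulVec (star ξ)

theorem det_restrictScalars_complex {n : ℕ} (A : (Fin n → ℂ) →ₗ[ℂ] (Fin n → ℂ)) :
    (A.restrictScalars ℝ).det = ‖A.det‖ ^ 2 := by
  rw [LinearMap.det_restrictScalars, Algebra.norm_complex_apply, Complex.normSq_eq_norm_sq]

theorem integral_comp_complexLinear {n : ℕ} (A : (Fin n → ℂ) →ₗ[ℂ] (Fin n → ℂ)) (hA : A.det ≠ 0)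
    (f : (Fin n → ℂ) → ℝ) :
    ∫ w, f (A w) = (‖A.det‖ ^ 2)⁻¹ * ∫ w, f w := by
  have hd : LinearMap.det (A.restrictScalars ℝ) ≠ 0 := by
    rw [det_restrictScalars_complex]; simpa using hA
  have h := Measure.map_linearMap_addHaar_eq_smul_addHaar (volume : Measure (Fin n → ℂ)) hd
  let e := LinearEquiv.toContinuousLinearEquiv (LinearEquiv.ofIsUnitDet
    (f := A.restrictScalars ℝ) (v := Module.finBasis ℝ _) (v' := Module.finBasis ℝ _) (by
      rw [LinearMap.det_toMatrix]; exact hd.isUnit))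
  have he : MeasurableEmbedding (A.restrictScalars ℝ) :=
    e.toHomeomorph.measurableEmbedding
  have h2 := he.integral_map (μ := volume) f
  rw [h, integral_smul_measure] at h2
  change _ = ∫ w, f (A w) at h2
  rw [← h2, det_restrictScalars_complex, ENNReal.toReal_ofReal (abs_nonneg _),
    abs_of_nonneg (by positivity), smul_eq_mul]

theorem integrable_comp_complexLinear {n : ℕ} (A : (Fin n → ℂ) →ₗ[ℂ] (Fin n → ℂ)) (hA : A.det ≠ 0)
    {f : (Fin n → ℂ) → ℝ} (hf : Integrable f) : Integrable fun w => f (A w) := by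
  have hd : LinearMap.det (A.restrictScalars ℝ) ≠ 0 := by
    rw [det_restrictScalars_complex]; simpa using hA
  have h := Measure.map_linearMap_addHaar_eq_smul_addHaar (volume : Measure (Fin n → ℂ)) hd
  have hm : Measurable (A.restrictScalars ℝ) :=
    (A.restrictScalars ℝ).continuous_of_finiteDimensional.measurable
  have := hf.smul_measure (c := ENNReal.ofReal |(LinearMap.det (A.restrictScalars ℝ))⁻¹|)
    ENNReal.ofReal_ne_top
  rw [← h] at this
  exact this.comp_measurable hm

theorem posDef_hval_pos {m : ℕ} {M : Matrix (Fin m) (Fin m) ℂ} (hM : M.PosDef) {ξ : Fin m → ℂ}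
    (hξ : ξ ≠ 0) : 0 < hval M ξ := by
  have := hM.dotProduct_mulVec_pos (x := star ξ) (by simpa using hξ)
  simpa [hval] using this

/-- Completing the square: the value of a positive form at `(1, w)`. -/
theorem exists_complete_square {s : ℕ} {M : Matrix (Fin (s + 1)) (Fin (s + 1)) ℂ}
    (hM : M.PosDef) : ∃ (c : ℝ) (v : Fin s → ℂ) (A : (Fin s → ℂ) →ₗ[ℂ] (Fin s → ℂ)), 0 < c ∧
      A.det ≠ 0 ∧ (∀ w, hval M (Fin.cons 1 w) = ((c + ∑ i, ‖A (w + v) i‖ ^ 2 : ℝ) : ℂ)) ∧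
      M.det = ((c * ‖A.det‖ ^ 2 : ℝ) : ℂ) := by
  set B : Matrix (Fin s) (Fin s) ℂ := M.submatrix Fin.succ Fin.succ with hB
  have hBp : B.PosDef := hM.submatrix (Fin.succ_injective s)
  obtain ⟨S, hS⟩ : ∃ S : Matrix (Fin s) (Fin s) ℂ, B = Sᴴ * S := by
    open scoped MatrixOrder in
    exact CStarAlgebra.nonneg_iff_eq_star_mul_self.mp hBp.posSemidef.nonneg
  have hBdet : IsUnit B.det := hBp.det_pos.ne'.isUnit
  have hSdet : S.det ≠ 0 := by
    intro h
    rw [hS, Matrix.det_mul, h, mul_zero] at hBdet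
    exact not_isUnit_zero hBdet
  set b : Fin s → ℂ := fun j => M 0 j.succ with hb
  -- The quadratic part of `w ↦ ξ M ξ^*` is given by `B`, and its linear part is absorbed by the
  -- translation `v` solving `v B = b`.
  set v : Fin s → ℂ := b ᵥ* B⁻¹ with hv
  have hvB : v ᵥ* B = b := by
    rw [hv, Matrix.vecMul_vecMul, Matrix.nonsing_inv_mul _ hBdet, Matrix.vecMul_one]
  have hBv : B *ᵥ star v = star b := by
    calc B *ᵥ star v = Bᴴ *ᵥ star v := by rw [hBp.1.eq]
      _ = star (v ᵥ* B) := (Matrix.star_vecMul B v).symm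
      _ = star b := by rw [hvB]
  have hM0 : ∀ i : Fin s, M i.succ 0 = star (b i) := fun i => (hM.1.apply i.succ 0).symm
  set A : (Fin s → ℂ) →ₗ[ℂ] (Fin s → ℂ) := Matrix.vecMulLinear Sᴴ with hA
  have hAdet : A.det = Sᴴ.det := by
    rw [hA, ← Matrix.det_transpose, ← LinearMap.det_toLin']
    congr 1
    ext i j
    simp [Matrix.toLin'_apply]
  have hAnorm : ∀ w, w ⬝ᵥ B *ᵥ star w = ((∑ i, ‖A w i‖ ^ 2 : ℝ) : ℂ) := by
    intro w
    have h1 : S *ᵥ star w = star (A w) := by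
      rw [hA, Matrix.vecMulLinear_apply, Matrix.star_vecMul, Matrix.conjTranspose_conjTranspose]
    rw [hS, ← Matrix.mulVec_mulVec, h1, Matrix.dotProduct_mulVec]
    change A w ⬝ᵥ star (A w) = _
    simp [dotProduct, Complex.mul_conj, Complex.normSq_eq_norm_sq]
  set c : ℂ := M 0 0 - b ⬝ᵥ star v with hc
  have hval_eq : ∀ w, hval M (Fin.cons 1 w) = c + (w + v) ⬝ᵥ B *ᵥ star (w + v) := by
    intro w
    have e1 : hval M (Fin.cons 1 w) = M 0 0 + b ⬝ᵥ star w + w ⬝ᵥ star b + w ⬝ᵥ B *ᵥ star w := by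
      simp only [hval, dotProduct, Matrix.mulVec, Fin.sum_univ_succ, Fin.cons_zero, Fin.cons_succ,
        Pi.star_apply, star_one, mul_one, one_mul, hM0, hB, hb, Matrix.submatrix_apply, mul_add,
        Finset.sum_add_distrib]
      ring
    rw [e1, star_add, Matrix.mulVec_add, hBv, add_dotProduct, dotProduct_add, dotProduct_add,
      Matrix.dotProduct_mulVec v, hvB, hc]
    have : v ⬝ᵥ star b = b ⬝ᵥ star v := by
      rw [← hBv, Matrix.dotProduct_mulVec, hvB]
    rw [this]
    ring
  -- The remaining constant `c` is the Schur complement of `B`. It is the value of the form at `w =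
  -- -v`, hence positive.
  have hcpos : 0 < c := by
    have h := posDef_hval_pos hM (ξ := Fin.cons 1 (-v)) fun h => by simpa using congrFun h 0
    rw [hval_eq] at h
    simpa using h
  obtain ⟨hc1, hc2⟩ := Complex.lt_def.1 hcpos
  have hcre : c = (c.re : ℂ) := Complex.ext rfl (by simpa using hc2.symm)
  refine ⟨c.re, v, A, by simpa using hc1, ?_, ?_, ?_⟩
  · rw [hAdet, Matrix.det_conjTranspose]
    exact star_ne_zero.2 hSdet
  · intro w
    rw [hval_eq, hAnorm]
    push_cast
    rw [← hcre]
  -- Separating the index `0` gives the block formula `det M = det B · c`, and `det B = |det A|²`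
  -- because `B = S^* S`.
  · let e : Unit ⊕ Fin s ≃ Fin (s + 1) :=
      ((Equiv.sumComm _ _).trans (Equiv.optionEquivSumPUnit _).symm).trans (finSuccEquiv s).symm
    have he1 : e (Sum.inl ()) = 0 := rfl
    have he2 : ∀ i, e (Sum.inr i) = Fin.succ i := fun i => rfl
    let _ : Invertible B := Matrix.invertibleOfIsUnitDet B hBdet
    have h1 : M.submatrix e e = Matrix.fromBlocks (Matrix.of fun _ _ => M 0 0)
        (Matrix.of fun _ j => b j) (Matrix.of fun i _ => star (b i)) B := by
      ext i j
      rcases i with i | i <;> rcases j with j | j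
      · rfl
      · rfl
      · simp [he1, he2, hM0]
      · rfl
    rw [← Matrix.det_submatrix_equiv_self e, h1, Matrix.det_fromBlocks₂₂,
      Matrix.invOf_eq_nonsing_inv, Matrix.det_unique (n := Unit)]
    have h2 : ((Matrix.of fun (_ : Unit) (_ : Unit) => M 0 0) - (Matrix.of fun (_ : Unit) j => b j) *
        B⁻¹ * (Matrix.of fun i (_ : Unit) => star (b i))) default default = c := by
      rw [hc, Matrix.sub_apply, Matrix.of_apply]
      congr 1
      have : star v = B⁻¹ *ᵥ star b := by
        rw [← hBv, Matrix.mulVec_mulVec, Matrix.nonsing_inv_mul _ hBdet, Matrix.one_mulVec]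
      rw [this, Matrix.dotProduct_mulVec]
      rfl
    have h3 : B.det = ((‖A.det‖ ^ 2 : ℝ) : ℂ) := by
      rw [hS, Matrix.det_mul, hAdet, Matrix.det_conjTranspose, mul_comm, ← starRingEnd_apply,
        Complex.mul_conj, Complex.normSq_eq_norm_sq]
      simp
    rw [h2, h3]
    push_cast
    rw [← hcre]
    ring

/-- The integral of `(ξ M ξ^*)^{-(s+1)}` over the affine chart `ξ = (1, w)`. -/
theorem integral_hval_pow {s : ℕ} {M : Matrix (Fin (s + 1)) (Fin (s + 1)) ℂ} (hM : M.PosDef) :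
    Integrable (fun w : Fin s → ℂ => ((hval M (Fin.cons 1 w)).re ^ (s + 1))⁻¹) ∧
    ∫ w : Fin s → ℂ, ((hval M (Fin.cons 1 w)).re ^ (s + 1))⁻¹ =
      Real.pi ^ s / (s.factorial * M.det.re) := by
  obtain ⟨c, v, A, hc, hA, h1, h2⟩ := exists_complete_square hM
  have e1 : (fun w : Fin s → ℂ => ((hval M (Fin.cons 1 w)).re ^ (s + 1))⁻¹) = fun w =>
      (fun u => (fun t : Fin s → ℂ => ((c + ∑ i, ‖t i‖ ^ 2) ^ (s + 1))⁻¹) (A u)) (w + v) := by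
    funext w
    rw [h1, Complex.ofReal_re]
  rw [e1, h2, Complex.ofReal_re]
  refine ⟨(integrable_comp_complexLinear A hA (fubini_study_integrable s hc)).comp_add_right v, ?_⟩
  rw [integral_add_right_eq_self
    (fun u => (fun t : Fin s → ℂ => ((c + ∑ i, ‖t i‖ ^ 2) ^ (s + 1))⁻¹) (A u))]
  refine (integral_comp_complexLinear A hA
    (fun t : Fin s → ℂ => ((c + ∑ i, ‖t i‖ ^ 2) ^ (s + 1))⁻¹)).trans ?_
  rw [fubini_study_integral s hc]
  have : ‖A.det‖ ≠ 0 := norm_ne_zero_iff.2 hA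
  field_simp

end scalar

/-! ### Moments of the Fubini–Study density and the total Segre class -/

section moments

variable {s : ℕ}

/-- The matrix `ξ_i (K ξ^*)_j / ξ K ξ^*` of the orthogonal projection defined by `ξ`. -/
def ratio {m : ℕ} (K : Matrix (Fin m) (Fin m) ℂ) (ξ : Fin m → ℂ) (i j : Fin m) : ℂ :=
  ξ i * (K *ᵥ star ξ) j / hval K ξ

theorem hval_smul {m : ℕ} (K : Matrix (Fin m) (Fin m) ℂ) (c : ℂ) (ξ : Fin m → ℂ) :
    hval K (c • ξ) = (c * star c) * hval K ξ := by
  rw [hval, hval, star_smul, Matrix.mulVec_smul, smul_dotProduct, dotProduct_smul]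
  simp only [smul_eq_mul]; ring

theorem ratio_smul {m : ℕ} (K : Matrix (Fin m) (Fin m) ℂ) {c : ℂ} (hc : c ≠ 0) (ξ : Fin m → ℂ)
    (i j : Fin m) : ratio K (c • ξ) i j = ratio K ξ i j := by
  rw [ratio, hval_smul, star_smul, Matrix.mulVec_smul, ratio]
  simp only [Pi.smul_apply, smul_eq_mul]
  have : c * star c ≠ 0 := mul_ne_zero hc (star_ne_zero.2 hc)
  rw [← mul_div_mul_left (ξ i * (K *ᵥ star ξ) j) _ this]
  ring

theorem continuous_hval {m : ℕ} (K : Matrix (Fin m) (Fin m) ℂ) : Continuous (hval K) := by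
  unfold hval
  fun_prop

theorem continuousAt_ratio {m : ℕ} {K : Matrix (Fin m) (Fin m) ℂ} (hK : K.PosDef) {ξ : Fin m → ℂ}
    (hξ : ξ ≠ 0) (i j : Fin m) : ContinuousAt (fun ξ => ratio K ξ i j) ξ := by
  unfold ratio
  refine ContinuousAt.div (Continuous.continuousAt ?_) (continuous_hval K).continuousAt
    (posDef_hval_pos hK hξ).ne'
  refine (continuous_apply i).mul ?_
  have : Continuous fun ξ : Fin m → ℂ => K *ᵥ star ξ := by fun_prop
  exact (continuous_apply j).comp this

/-- `ratio` is homogeneous of degree zero, so a bound on the compact unit sphere is a global one.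
This makes all moments converge in the noncompact affine chart. -/
theorem exists_ratio_bound {m : ℕ} {K : Matrix (Fin m) (Fin m) ℂ} (hK : K.PosDef) :
    ∃ C : ℝ, 0 < C ∧ ∀ ξ : Fin m → ℂ, ξ ≠ 0 → ∀ i j, ‖ratio K ξ i j‖ ≤ C := by
  have hcpt : IsCompact (Metric.sphere (0 : Fin m → ℂ) 1) := isCompact_sphere 0 1
  have hb : ∀ p : Fin m × Fin m, ∃ C : ℝ, ∀ ξ ∈ Metric.sphere (0 : Fin m → ℂ) 1,
      ‖ratio K ξ p.1 p.2‖ ≤ C := fun p => hcpt.exists_bound_of_continuousOn fun ξ hξ =>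
    (continuousAt_ratio hK (by rintro rfl; simp at hξ) p.1 p.2).continuousWithinAt
  choose C hC using hb
  refine ⟨1 + ∑ p, |C p|, by positivity, fun ξ hξ i j => ?_⟩
  have hn : ‖ξ‖ ≠ 0 := norm_ne_zero_iff.2 hξ
  have h1 := hC (i, j) (((‖ξ‖⁻¹ : ℝ) : ℂ) • ξ) (by simp [norm_smul, hn])
  rw [ratio_smul K (by simpa using hξ)] at h1
  refine h1.trans ((le_abs_self _).trans ?_)
  refine (Finset.single_le_sum (f := fun p => |C p|) (fun _ _ => abs_nonneg _)
    (Finset.mem_univ (i, j))).trans ?_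
  linarith

/-- The density of the Fubini–Study volume form of the metric `K` in the affine chart
`ξ = (1, w)`. -/
def fsDensity (K : Matrix (Fin (s + 1)) (Fin (s + 1)) ℂ) (w : Fin s → ℂ) : ℝ :=
  s.factorial / Real.pi ^ s * K.det.re * ((hval K (Fin.cons 1 w)).re ^ (s + 1))⁻¹

theorem cons_one_ne_zero (w : Fin s → ℂ) : (Fin.cons 1 w : Fin (s + 1) → ℂ) ≠ 0 := fun h => by
  simpa using congrFun h 0

theorem fsDensity_nonneg {K : Matrix (Fin (s + 1)) (Fin (s + 1)) ℂ} (hK : K.PosDef)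
    (w : Fin s → ℂ) : 0 ≤ fsDensity K w := by
  have h1 := (Complex.lt_def.1 (posDef_hval_pos hK (cons_one_ne_zero w))).1
  have h2 := (Complex.lt_def.1 hK.det_pos).1
  simp only [Complex.zero_re] at h1 h2
  unfold fsDensity
  positivity

theorem continuous_fsDensity {K : Matrix (Fin (s + 1)) (Fin (s + 1)) ℂ} (hK : K.PosDef) :
    Continuous (fsDensity K) := by
  unfold fsDensity
  refine Continuous.mul continuous_const (Continuous.inv₀ ?_ fun w => ?_)
  · refine (Complex.continuous_re.comp ((continuous_hval K).comp ?_)).pow _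
    fun_prop
  · have h1 := (Complex.lt_def.1 (posDef_hval_pos hK (cons_one_ne_zero w))).1
    exact pow_ne_zero _ h1.ne'

theorem integrable_fsDensity {K : Matrix (Fin (s + 1)) (Fin (s + 1)) ℂ} (hK : K.PosDef) :
    Integrable (fsDensity K) := (integral_hval_pow hK).1.const_mul _

theorem integral_fsDensity {K : Matrix (Fin (s + 1)) (Fin (s + 1)) ℂ} (hK : K.PosDef) :
    ∫ w, fsDensity K w = 1 := by
  unfold fsDensity
  rw [integral_const_mul, (integral_hval_pow hK).2]
  have h2 := (Complex.lt_def.1 hK.det_pos).1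
  simp only [Complex.zero_re] at h2
  have := Real.pi_pos
  field_simp

/-- The `k`-th moments of `ratio`, normalized as in the expansion of `(1 + x)^{-(s+1)}`. -/
def moment (K : Matrix (Fin (s + 1)) (Fin (s + 1)) ℂ) (k : ℕ)
    (f : Fin k → Fin (s + 1) × Fin (s + 1)) : ℂ :=
  (-1) ^ k * ((k + s).choose s : ℂ) *
    ∫ w, (fsDensity K w : ℂ) * ∏ i, ratio K (Fin.cons 1 w) (f i).1 (f i).2

/-- The homogeneous polynomial in the entries of a matrix with coefficients the moments. -/
def segrePart {R : Type*} [CommRing R] [Algebra ℂ R] (K : Matrix (Fin (s + 1)) (Fin (s + 1)) ℂ)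
    (k : ℕ) (Y : Matrix (Fin (s + 1)) (Fin (s + 1)) R) : R :=
  ∑ f : Fin k → Fin (s + 1) × Fin (s + 1), moment K k f • ∏ i, Y (f i).1 (f i).2

theorem map_segrePart {R S : Type*} [CommRing R] [Algebra ℂ R] [CommRing S] [Algebra ℂ S]
    (g : R →ₐ[ℂ] S) (K : Matrix (Fin (s + 1)) (Fin (s + 1)) ℂ)
    (k : ℕ) (Y : Matrix (Fin (s + 1)) (Fin (s + 1)) R) :
    g (segrePart K k Y) = segrePart K k (Y.map g) := by
  simp [segrePart]

theorem integrable_fsDensity_mul {K : Matrix (Fin (s + 1)) (Fin (s + 1)) ℂ} (hK : K.PosDef)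
    {g : (Fin s → ℂ) → ℂ} (hg : Continuous g) {C : ℝ} (hC : ∀ w, ‖g w‖ ≤ C) :
    Integrable fun w => (fsDensity K w : ℂ) * g w :=
  (integrable_fsDensity hK).ofReal.mul_bdd (c := C) hg.aestronglyMeasurable
    (Filter.Eventually.of_forall hC)

theorem continuous_ratio_cons {K : Matrix (Fin (s + 1)) (Fin (s + 1)) ℂ} (hK : K.PosDef)
    (i j : Fin (s + 1)) : Continuous fun w : Fin s → ℂ => ratio K (Fin.cons 1 w) i j :=
  continuous_iff_continuousAt.2 fun w =>
    (continuousAt_ratio hK (cons_one_ne_zero w) i j).comp (f := fun w : Fin s → ℂ =>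
      (Fin.cons 1 w : Fin (s + 1) → ℂ)) (by fun_prop)

theorem integrable_moment {K : Matrix (Fin (s + 1)) (Fin (s + 1)) ℂ} (hK : K.PosDef) {k : ℕ}
    (f : Fin k → Fin (s + 1) × Fin (s + 1)) :
    Integrable fun w => (fsDensity K w : ℂ) * ∏ i, ratio K (Fin.cons 1 w) (f i).1 (f i).2 := by
  obtain ⟨C, hC, hb⟩ := exists_ratio_bound hK
  refine integrable_fsDensity_mul hK (C := C ^ k)
    (continuous_finsetProd _ fun i _ => continuous_ratio_cons hK _ _) fun w => ?_
  rw [norm_prod]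
  refine (Finset.prod_le_prod (fun _ _ => norm_nonneg _)
    fun i _ => hb _ (cons_one_ne_zero w) (f i).1 (f i).2).trans ?_
  simp

/-- The contraction `∑ Y_ij ξ_i (K ξ^*)_j / ξ K ξ^*`. -/
def contract {R : Type*} [CommRing R] [Algebra ℂ R] {m : ℕ} (K : Matrix (Fin m) (Fin m) ℂ)
    (ξ : Fin m → ℂ) (Y : Matrix (Fin m) (Fin m) R) : R :=
  ∑ p : Fin m × Fin m, ratio K ξ p.1 p.2 • Y p.1 p.2

theorem contract_pow {R : Type*} [CommRing R] [Algebra ℂ R] {m : ℕ} (K : Matrix (Fin m) (Fin m) ℂ)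
    (ξ : Fin m → ℂ) (Y : Matrix (Fin m) (Fin m) R) (k : ℕ) :
    contract K ξ Y ^ k = ∑ f : Fin k → Fin m × Fin m,
      (∏ i, ratio K ξ (f i).1 (f i).2) • ∏ i, Y (f i).1 (f i).2 := by
  rw [contract, Fintype.sum_pow]
  refine Finset.sum_congr rfl fun f _ => ?_
  rw [Finset.prod_smul]

/-- `segrePart` as an integral, tested against a linear functional. -/
theorem segrePart_eq_integral {R : Type*} [CommRing R] [Algebra ℂ R]
    {K : Matrix (Fin (s + 1)) (Fin (s + 1)) ℂ} (hK : K.PosDef) (k : ℕ)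
    (Y : Matrix (Fin (s + 1)) (Fin (s + 1)) R) (l : R →ₗ[ℂ] ℂ) :
    Integrable (fun w => (fsDensity K w : ℂ) * l (contract K (Fin.cons 1 w) Y ^ k)) ∧
    (-1) ^ k * ((k + s).choose s : ℂ) *
      ∫ w, (fsDensity K w : ℂ) * l (contract K (Fin.cons 1 w) Y ^ k) = l (segrePart K k Y) := by
  have e : ∀ w, (fsDensity K w : ℂ) * l (contract K (Fin.cons 1 w) Y ^ k) =
      ∑ f : Fin k → Fin (s + 1) × Fin (s + 1),
        ((fsDensity K w : ℂ) * ∏ i, ratio K (Fin.cons 1 w) (f i).1 (f i).2) *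
          l (∏ i, Y (f i).1 (f i).2) := by
    intro w
    rw [contract_pow, map_sum, Finset.mul_sum]
    refine Finset.sum_congr rfl fun f _ => ?_
    rw [map_smul, smul_eq_mul, mul_assoc]
  simp_rw [e]
  refine ⟨integrable_finsetSum _ fun f _ => (integrable_moment hK f).mul_const _, ?_⟩
  rw [integral_finsetSum _ fun f _ => (integrable_moment hK f).mul_const _, segrePart, map_sum,
    Finset.mul_sum]
  refine Finset.sum_congr rfl fun f _ => ?_
  rw [integral_mul_const, map_smul, smul_eq_mul, moment]
  ring

theorem contract_complex {m : ℕ} (K : Matrix (Fin m) (Fin m) ℂ) (ξ : Fin m → ℂ)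
    (Y : Matrix (Fin m) (Fin m) ℂ) : contract K ξ Y = hval (Y * K) ξ / hval K ξ := by
  rw [contract, hval, ← Matrix.mulVec_mulVec, dotProduct, Finset.sum_div, Fintype.sum_prod_type]
  refine Finset.sum_congr rfl fun i _ => ?_
  rw [Matrix.mulVec, dotProduct, Finset.mul_sum, Finset.sum_div]
  refine Finset.sum_congr rfl fun j _ => ?_
  rw [ratio, smul_eq_mul]
  ring

theorem hval_re {m : ℕ} {M : Matrix (Fin m) (Fin m) ℂ} (hM : M.IsHermitian) (ξ : Fin m → ℂ) :
    hval M ξ = ((hval M ξ).re : ℂ) := by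
  have : (starRingEnd ℂ) (hval M ξ) = hval M ξ := by
    rw [hval, starRingEnd_apply, ← Matrix.star_dotProduct_star, Matrix.star_mulVec, star_star,
      hM.eq, ← Matrix.dotProduct_mulVec]
  exact (Complex.conj_eq_iff_re.1 this).symm

/-- The analytic heart. For small real `t` the matrix `M = K + t Y K` is positive definite and `ξ M
ξ^* = (ξ K ξ^*)(1 + tρ)`. Integrating `(1 + tρ)^{-(s+1)}` against the Fubini–Study density gives
`det K / det M` in closed form, and the series of moments when expanded term by term. -/
theorem hasSum_segrePart {K : Matrix (Fin (s + 1)) (Fin (s + 1)) ℂ} (hK : K.PosDef)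
    {Y : Matrix (Fin (s + 1)) (Fin (s + 1)) ℂ} (hY : (Y * K).IsHermitian) :
    ∀ᶠ t : ℝ in 𝓝 0, HasSum (fun k => (t : ℂ) ^ k * segrePart K k Y)
      ((1 + (t : ℂ) • Y).det)⁻¹ := by
  obtain ⟨C, hC, hb⟩ := exists_ratio_bound hK
  -- A bound for `|ρ|` uniform on the fibre; the extra `1` makes it positive even when `Y = 0`.
  set B : ℝ := C * ∑ p : Fin (s + 1) × Fin (s + 1), ‖Y p.1 p.2‖ + 1 with hB
  have hBpos : 0 < B := by positivity
  have hq : ∀ ξ : Fin (s + 1) → ℂ, ξ ≠ 0 → ‖contract K ξ Y‖ ≤ B := by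
    intro ξ hξ
    rw [contract, hB, Finset.mul_sum]
    refine (norm_sum_le _ _).trans ((Finset.sum_le_sum fun p _ => ?_).trans (le_add_of_nonneg_right
      zero_le_one))
    rw [norm_smul]
    exact mul_le_mul_of_nonneg_right (hb ξ hξ _ _) (norm_nonneg _)
  have hev : ∀ᶠ t : ℝ in 𝓝 0, |t| * B < 1 := by
    have : Filter.Tendsto (fun t : ℝ => |t| * B) (𝓝 0) (𝓝 (|0| * B)) :=
      ((continuous_abs.mul continuous_const).tendsto 0)
    rw [abs_zero, zero_mul] at this
    exact this.eventually (gt_mem_nhds one_pos)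
  filter_upwards [hev] with t ht
  have htq : ∀ ξ : Fin (s + 1) → ℂ, ξ ≠ 0 → ‖(-(t : ℂ) * contract K ξ Y)‖ ≤ |t| * B := by
    intro ξ hξ
    rw [norm_mul, norm_neg, Complex.norm_real, Real.norm_eq_abs]
    exact mul_le_mul_of_nonneg_left (hq ξ hξ) (abs_nonneg _)
  set M : Matrix (Fin (s + 1)) (Fin (s + 1)) ℂ := K + (t : ℂ) • (Y * K) with hM
  have hMval : ∀ ξ : Fin (s + 1) → ℂ, ξ ≠ 0 →
      hval M ξ = hval K ξ * (1 - -(t : ℂ) * contract K ξ Y) := by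
    intro ξ hξ
    have h0 := (posDef_hval_pos hK hξ).ne'
    rw [contract_complex, hM, hval, Matrix.add_mulVec, Matrix.smul_mulVec, dotProduct_add,
      dotProduct_smul]
    change hval K ξ + (t : ℂ) * hval (Y * K) ξ = _
    field_simp
    ring
  have hMh : M.IsHermitian := by
    refine hK.1.add ?_
    rw [Matrix.IsHermitian, Matrix.conjTranspose_smul, hY.eq]
    simp
  -- Since `|tρ| < 1`, the factor `1 + tρ` has positive real part; as `M` is Hermitian, this is
  -- enough.
  have hMp : M.PosDef := by
    refine Matrix.PosDef.of_dotProduct_mulVec_pos hMh fun x hx => ?_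
    have hx' : star x ≠ 0 := star_ne_zero.2 hx
    have e1 : star x ⬝ᵥ M *ᵥ x = hval M (star x) := by rw [hval, star_star]
    have hr := hval_re hMh (star x)
    have hkr := hval_re hK.1 (star x)
    have hkp := (Complex.lt_def.1 (posDef_hval_pos hK hx')).1
    have h2 := hMval _ hx'
    rw [e1, hr]
    refine Complex.zero_lt_real.2 ?_
    rw [h2, hkr, Complex.re_ofReal_mul]
    refine mul_pos (by simpa using hkp) ?_
    have := (Complex.abs_re_le_norm _).trans (htq _ hx')
    rw [Complex.sub_re, Complex.one_re]
    have := (abs_le.1 this).2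
    linarith
  -- The `k`-th term of the binomial series of `(1 + tρ)^{-(s+1)}`, weighted by the density.
  set F : ℕ → (Fin s → ℂ) → ℂ := fun k w =>
    (t : ℂ) ^ k * (-1) ^ k * ((k + s).choose s : ℂ) *
      ((fsDensity K w : ℂ) * contract K (Fin.cons 1 w) Y ^ k) with hF
  have hFr : ∀ k w, F k w = (fsDensity K w : ℂ) * (((k + s).choose s : ℂ) *
      (-(t : ℂ) * contract K (Fin.cons 1 w) Y) ^ k) := by
    intro k w
    simp only [hF, mul_pow, neg_pow (t : ℂ) k]
    ring
  have hFint : ∀ k, Integrable (F k) := fun k =>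
    ((segrePart_eq_integral hK k Y LinearMap.id).1).const_mul _
  have hFval : ∀ k, ∫ w, F k w = (t : ℂ) ^ k * segrePart K k Y := by
    intro k
    have := (segrePart_eq_integral hK k Y LinearMap.id).2
    simp only [LinearMap.id_apply] at this
    simp only [hF]
    rw [integral_const_mul, ← this]
    ring
  have hFsum : ∀ w, HasSum (fun k => F k w) ((fsDensity K w : ℂ) *
      (1 / (1 - -(t : ℂ) * contract K (Fin.cons 1 w) Y) ^ (s + 1))) := by
    intro w
    simp_rw [hFr]
    exact (hasSum_choose_mul_geometric_of_norm_lt_one s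
      ((htq _ (cons_one_ne_zero w)).trans_lt ht)).mul_left _
  have hnorm : ∀ k, ∫ w, ‖F k w‖ ≤ ((k + s).choose s : ℝ) * (|t| * B) ^ k := by
    intro k
    have h1 : ∀ w, ‖F k w‖ ≤ fsDensity K w * (((k + s).choose s : ℝ) * (|t| * B) ^ k) := by
      intro w
      rw [hFr, norm_mul, norm_mul, norm_pow, Complex.norm_real, Real.norm_of_nonneg
        (fsDensity_nonneg hK w), Complex.norm_natCast]
      have := fsDensity_nonneg hK w
      have := htq _ (cons_one_ne_zero w)
      gcongr
    refine (integral_mono (hFint k).norm ((integrable_fsDensity hK).mul_const _) h1).trans ?_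
    rw [integral_mul_const, integral_fsDensity hK, one_mul]
  -- The density has mass one, so the integrals are dominated by a convergent binomial series in
  -- `|t| B < 1`, which permits exchanging sum and integral.
  have hsummable : Summable fun k => ∫ w, ‖F k w‖ := by
    refine Summable.of_nonneg_of_le (fun k => integral_nonneg fun w => norm_nonneg _) hnorm ?_
    exact summable_choose_mul_geometric_of_norm_lt_one s
      (by rwa [Real.norm_of_nonneg (by positivity)])
  have hmain := hasSum_integral_of_summable_integral_norm hFint hsummable
  simp_rw [hFval] at hmain
  convert! hmain using 1
  have e2 : ∀ w, ∑' k, F k w = ((s.factorial / Real.pi ^ s * K.det.re *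
      ((hval M (Fin.cons 1 w)).re ^ (s + 1))⁻¹ : ℝ) : ℂ) := by
    intro w
    rw [(hFsum w).tsum_eq, fsDensity]
    have h1 := hval_re hMh (Fin.cons 1 w)
    have h2 := hval_re hK.1 (Fin.cons 1 w)
    have h3 := hMval _ (cons_one_ne_zero w)
    rw [h1, h2] at h3
    push_cast
    rw [h3, mul_pow, mul_inv, one_div]
    ring
  simp_rw [e2]
  rw [integral_complex_ofReal, integral_const_mul, (integral_hval_pow hMp).2]
  have hdM : M.det = (1 + (t : ℂ) • Y).det * K.det := by
    rw [← Matrix.det_mul, hM, add_mul, one_mul, Matrix.smul_mul]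
  have hd1 : ∀ {A : Matrix (Fin (s + 1)) (Fin (s + 1)) ℂ}, A.PosDef →
      A.det = (A.det.re : ℂ) ∧ 0 < A.det.re := by
    intro A hA
    obtain ⟨h1, h2⟩ := Complex.lt_def.1 hA.det_pos
    exact ⟨Complex.ext rfl (by simpa using h2.symm), by simpa using h1⟩
  obtain ⟨hk1, hk2⟩ := hd1 hK
  obtain ⟨hm1, hm2⟩ := hd1 hMp
  have hpi := Real.pi_pos
  have e3 : (s.factorial : ℝ) / Real.pi ^ s * K.det.re * (Real.pi ^ s / (s.factorial * M.det.re)) =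
      K.det.re / M.det.re := by
    field_simp
  rw [e3, Complex.ofReal_div, ← hk1, ← hm1, hdM]
  have hk3 : K.det ≠ 0 := hK.det_pos.ne'
  have hm3 : (1 + (t : ℂ) • Y).det ≠ 0 := fun h =>
    hMp.det_pos.ne' (by rw [hdM, h, zero_mul])
  field_simp

end moments

/-! ### The algebraic identity between moments and determinants -/

section macmahon

open scoped Polynomial PowerSeries

/-- The polynomial `det (1 + T Y)`. -/
def detPoly {R : Type*} [CommRing R] {m : ℕ} (Y : Matrix (Fin m) (Fin m) R) : R[X] :=
  (1 + (Polynomial.X : R[X]) • Y.map (Polynomial.C : R → R[X])).det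

theorem eval_detPoly {R : Type*} [CommRing R] {m : ℕ} (Y : Matrix (Fin m) (Fin m) R) (t : R) :
    (detPoly Y).eval t = (1 + t • Y).det := by
  rw [detPoly, ← Polynomial.coe_evalRingHom, RingHom.map_det]
  congr 1
  ext i j
  by_cases h : i = j <;> simp [h] <;> ring

theorem map_detPoly {R S : Type*} [CommRing R] [CommRing S] (g : R →+* S) {m : ℕ}
    (Y : Matrix (Fin m) (Fin m) R) : (detPoly Y).map g = detPoly (Y.map g) := by
  rw [detPoly, ← Polynomial.coe_mapRingHom, RingHom.map_det, detPoly]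
  congr 1
  ext i j : 2
  simp only [RingHom.mapMatrix_apply, Matrix.map_apply, Matrix.add_apply, Matrix.smul_apply,
    smul_eq_mul, map_add, Polynomial.coe_mapRingHom, Matrix.one_apply]
  split_ifs <;> simp only [Polynomial.map_one, Polynomial.map_zero, Polynomial.map_mul,
    Polynomial.map_X, Polynomial.map_C]

/-- A power series with complex coefficients that sums to one near zero is the constant one. -/
theorem coeff_eq_of_hasSum_one {c : ℕ → ℂ}
    (h : ∀ᶠ t : ℝ in 𝓝 0, HasSum (fun k => (t : ℂ) ^ k * c k) 1) (k : ℕ) :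
    c k = if k = 0 then 1 else 0 := by
  set p : (ℕ → ℂ) → FormalMultilinearSeries ℝ ℝ ℂ := fun c k =>
    ContinuousMultilinearMap.mkPiRing ℝ (Fin k) (c k) with hp
  have hpc : ∀ c k, (p c).coeff k = c k := fun c k => by
    simp [hp, FormalMultilinearSeries.coeff, ContinuousMultilinearMap.mkPiRing_apply]
  have h1 : HasFPowerSeriesAt (fun _ : ℝ => (1 : ℂ)) (p c) 0 := by
    rw [hasFPowerSeriesAt_iff]
    filter_upwards [h] with t ht
    simpa [hpc] using ht
  have h2 : HasFPowerSeriesAt (fun _ : ℝ => (1 : ℂ)) (p fun k => if k = 0 then 1 else 0) 0 := by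
    rw [hasFPowerSeriesAt_iff]
    refine Filter.Eventually.of_forall fun t => ?_
    simp only [hpc]
    convert! hasSum_single 0 (f := fun k : ℕ => t ^ k • if k = 0 then (1 : ℂ) else 0) ?_ using 1
    · simp
    · intro k hk
      simp [hk]
  have := congrArg (fun q => q.coeff k) (h1.eq_formalMultilinearSeries h2)
  simpa only [hpc] using this

variable {s : ℕ}

/-- The generating series of the homogeneous polynomials `segrePart`. -/
def segreSeries {R : Type*} [CommRing R] [Algebra ℂ R] (K : Matrix (Fin (s + 1)) (Fin (s + 1)) ℂ)
    (Y : Matrix (Fin (s + 1)) (Fin (s + 1)) R) : R⟦X⟧ := PowerSeries.mk fun k => segrePart K k Y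

/-- For small real `t` the Cauchy product of the two absolutely convergent series sums to `1`;
uniqueness of power series coefficients makes this a formal identity. -/
theorem detPoly_mul_segreSeries_of_isHermitian {K : Matrix (Fin (s + 1)) (Fin (s + 1)) ℂ}
    (hK : K.PosDef) {Y : Matrix (Fin (s + 1)) (Fin (s + 1)) ℂ} (hY : (Y * K).IsHermitian) :
    (detPoly Y : ℂ⟦X⟧) * segreSeries K Y = 1 := by
  ext k
  rw [PowerSeries.coeff_one]
  refine coeff_eq_of_hasSum_one (c := fun k =>
    PowerSeries.coeff k ((detPoly Y : ℂ⟦X⟧) * segreSeries K Y)) ?_ k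
  have hdet : ∀ᶠ t : ℝ in 𝓝 0, (1 + (t : ℂ) • Y).det ≠ 0 := by
    have hc : Continuous fun t : ℝ => (1 + (t : ℂ) • Y).det := by fun_prop
    refine hc.continuousAt.eventually_ne ?_
    simp
  filter_upwards [hasSum_segrePart hK hY, hdet] with t ht hd
  have hp : HasSum (fun k => (t : ℂ) ^ k * (detPoly Y).coeff k) ((1 + (t : ℂ) • Y).det) := by
    rw [← eval_detPoly, Polynomial.eval_eq_sum_range]
    simp_rw [mul_comm ((t : ℂ) ^ _)]
    refine hasSum_sum_of_ne_finset_zero fun k hk => ?_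
    rw [Polynomial.coeff_eq_zero_of_natDegree_lt (by simpa using hk), zero_mul]
  have hps := hp.summable.norm
  have hts := ht.summable.norm
  have h1 := tsum_mul_tsum_eq_tsum_sum_antidiagonal_of_summable_norm hps hts
  have h2 := (summable_norm_sum_mul_antidiagonal_of_summable_norm hps hts).of_norm
  rw [hp.tsum_eq, ht.tsum_eq, mul_inv_cancel₀ hd] at h1
  have h3 := h2.hasSum
  rw [← h1] at h3
  convert! h3 using 1
  funext k
  rw [PowerSeries.coeff_mul, Finset.mul_sum]
  refine Finset.sum_congr rfl fun p hp => ?_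
  have hp' : p.1 + p.2 = k := Finset.HasAntidiagonal.mem_antidiagonal.1 hp
  rw [Polynomial.coeff_coe, segreSeries, PowerSeries.coeff_mk, ← hp', pow_add]
  ring

/-- A polynomial in the entries of a matrix `Y` that vanishes when `Y K` is Hermitian is zero. -/
theorem mvPolynomial_eq_zero_of_hermitian {m : ℕ} {K : Matrix (Fin m) (Fin m) ℂ}
    (hK : IsUnit K.det) (F : MvPolynomial (Fin m × Fin m) ℂ)
    (hF : ∀ Y : Matrix (Fin m) (Fin m) ℂ, (Y * K).IsHermitian →
      MvPolynomial.aeval (fun p => Y p.1 p.2) F = 0) : F = 0 := by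
  refine MvPolynomial.funext fun x => ?_
  set Y : Matrix (Fin m) (Fin m) ℂ := Matrix.of fun i j => x (i, j) with hY
  -- Cartesian decomposition `Y K = A + iB` with `A`, `B` Hermitian. The polynomial `z ↦ F((A + zB)
  -- K⁻¹)` vanishes for real `z`, hence identically, and `z = i` recovers `Y`.
  set A : Matrix (Fin m) (Fin m) ℂ := (1 / 2 : ℂ) • (Y * K + (Y * K)ᴴ) with hA
  set B : Matrix (Fin m) (Fin m) ℂ := (-Complex.I / 2 : ℂ) • (Y * K - (Y * K)ᴴ) with hB
  have hAh : A.IsHermitian := by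
    rw [Matrix.IsHermitian, hA, Matrix.conjTranspose_smul, Matrix.conjTranspose_add,
      Matrix.conjTranspose_conjTranspose, add_comm]
    simp
  have hBh : B.IsHermitian := by
    rw [Matrix.IsHermitian, hB, Matrix.conjTranspose_smul, Matrix.conjTranspose_sub,
      Matrix.conjTranspose_conjTranspose, ← neg_sub (Y * K), smul_neg, ← neg_smul]
    congr 1
    simp [neg_div]
  have hAB : A + Complex.I • B = Y * K := by
    rw [hA, hB, smul_smul]
    have : Complex.I * (-Complex.I / 2) = 1 / 2 := by
      rw [mul_div_assoc', mul_neg, Complex.I_mul_I, neg_neg]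
    rw [this, ← smul_add, add_add_sub_cancel, ← two_smul ℂ, smul_smul]
    norm_num
  let Z : Matrix (Fin m) (Fin m) ℂ[X] := (A.map Polynomial.C + (Polynomial.X : ℂ[X]) • B.map Polynomial.C) *
    K⁻¹.map Polynomial.C
  let Q : ℂ[X] := MvPolynomial.aeval (fun p : Fin m × Fin m => Z p.1 p.2) F
  have hQ : ∀ z : ℂ, Q.eval z =
      MvPolynomial.aeval (fun p : Fin m × Fin m => ((A + z • B) * K⁻¹) p.1 p.2) F := by
    intro z
    have h1 : Q.eval z = (Polynomial.aeval z) Q := by simp [Polynomial.coe_aeval_eq_eval]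
    rw [h1, MvPolynomial.comp_aeval_apply]
    congr 2
    funext p
    simp only [Z, Matrix.mul_apply, Matrix.add_apply, Matrix.smul_apply, Matrix.map_apply,
      smul_eq_mul, map_sum, map_mul, map_add, Polynomial.aeval_X, Polynomial.aeval_C,
      Algebra.algebraMap_self_apply]
  have hQ0 : Q = 0 := by
    refine Polynomial.eq_zero_of_infinite_isRoot Q (Set.Infinite.mono (s := Set.range ((↑) : ℝ → ℂ))
      ?_ (Set.infinite_range_of_injective Complex.ofReal_injective))
    rintro _ ⟨t, rfl⟩
    change Q.eval (t : ℂ) = 0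
    rw [hQ]
    refine hF _ ?_
    rw [Matrix.mul_assoc, Matrix.nonsing_inv_mul _ hK, mul_one]
    refine hAh.add ?_
    rw [Matrix.IsHermitian, Matrix.conjTranspose_smul, hBh.eq]
    simp
  have h := hQ Complex.I
  rw [hQ0, hAB, Matrix.mul_assoc, Matrix.mul_nonsing_inv _ hK, mul_one, Polynomial.eval_zero] at h
  rw [map_zero, h, MvPolynomial.aeval_eq_eval]
  rfl

theorem map_detPoly_mul_segreSeries {R S : Type*} [CommRing R] [Algebra ℂ R] [CommRing S]
    [Algebra ℂ S] (K : Matrix (Fin (s + 1)) (Fin (s + 1)) ℂ)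
    (G : Matrix (Fin (s + 1)) (Fin (s + 1)) R) (g : R →ₐ[ℂ] S) :
    PowerSeries.map (g : R →+* S) ((detPoly G : R⟦X⟧) * segreSeries K G) =
      (detPoly (G.map g) : S⟦X⟧) * segreSeries K (G.map g) := by
  rw [map_mul, ← Polynomial.polynomial_map_coe, map_detPoly]
  congr 1
  ext k
  simp only [segreSeries, PowerSeries.coeff_map, PowerSeries.coeff_mk]
  exact map_segrePart g K k G

/-- Prove the identity for the generic matrix of indeterminates: each coefficient is a polynomial
vanishing on the Hermitian slice, hence zero. Every other case is a specialization. -/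
theorem detPoly_mul_segreSeries {R : Type*} [CommRing R] [Algebra ℂ R]
    {K : Matrix (Fin (s + 1)) (Fin (s + 1)) ℂ}
    (hK : K.PosDef) (Y : Matrix (Fin (s + 1)) (Fin (s + 1)) R) :
    (detPoly Y : R⟦X⟧) * segreSeries K Y = 1 := by
  let S := MvPolynomial (Fin (s + 1) × Fin (s + 1)) ℂ
  let G : Matrix (Fin (s + 1)) (Fin (s + 1)) S := Matrix.of fun i j => MvPolynomial.X (i, j)
  have hG : (detPoly G : S⟦X⟧) * segreSeries K G = 1 := by
    rw [← sub_eq_zero]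
    refine PowerSeries.ext fun k => ?_
    rw [map_zero]
    refine mvPolynomial_eq_zero_of_hermitian hK.det_pos.ne'.isUnit _ fun Y hY => ?_
    have h1 := map_detPoly_mul_segreSeries K G (MvPolynomial.aeval (R := ℂ) fun p : Fin (s + 1) × Fin (s + 1) => Y p.1 p.2)
    have h2 : G.map (MvPolynomial.aeval (R := ℂ)
        fun p : Fin (s + 1) × Fin (s + 1) => Y p.1 p.2) = Y := by
      ext i j; simp [G]
    rw [h2, detPoly_mul_segreSeries_of_isHermitian hK hY] at h1
    have h3 := congrArg (PowerSeries.coeff k) h1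
    rw [PowerSeries.coeff_map] at h3
    rw [map_sub, map_sub]
    rw [sub_eq_zero]
    refine Eq.trans h3 ?_
    rw [PowerSeries.coeff_one, PowerSeries.coeff_one]
    split_ifs <;> simp
  have h1 := map_detPoly_mul_segreSeries K G (MvPolynomial.aeval (R := ℂ) fun p : Fin (s + 1) × Fin (s + 1) => Y p.1 p.2)
  have h2 : G.map (MvPolynomial.aeval (R := ℂ)
      fun p : Fin (s + 1) × Fin (s + 1) => Y p.1 p.2) = Y := by
    ext i j; simp [G]
  rw [h2, hG, map_one] at h1
  exact h1.symm

/-- If the homogeneous polynomials `segrePart` vanish in high degree, their sum is the inverse of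
`det (1 + Y)`. -/
theorem det_mul_sum_segrePart {R : Type*} [CommRing R] [Algebra ℂ R]
    {K : Matrix (Fin (s + 1)) (Fin (s + 1)) ℂ}
    (hK : K.PosDef) (Y : Matrix (Fin (s + 1)) (Fin (s + 1)) R) (n : ℕ)
    (hn : ∀ k, n < k → segrePart K k Y = 0) :
    (1 + Y).det * ∑ k ∈ Finset.range (n + 1), segrePart K k Y = 1 := by
  -- Vanishing in high degree turns the formal series into a polynomial, which may be evaluated at
  -- `T = 1`.
  set q : R[X] := ∑ k ∈ Finset.range (n + 1), Polynomial.monomial k (segrePart K k Y) with hq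
  have h1 : segreSeries K Y = (q : R⟦X⟧) := by
    ext k
    rw [segreSeries, PowerSeries.coeff_mk, Polynomial.coeff_coe, hq, Polynomial.finsetSum_coeff]
    simp only [Polynomial.coeff_monomial, Finset.sum_ite_eq', Finset.mem_range]
    split_ifs with h
    · rfl
    · exact hn k (by omega)
  have h2 := detPoly_mul_segreSeries hK Y
  rw [h1, ← Polynomial.coe_mul, ← Polynomial.coe_one, Polynomial.coe_inj] at h2
  have h3 := congrArg (Polynomial.eval 1) h2
  rw [Polynomial.eval_mul, eval_detPoly, one_smul, Polynomial.eval_one, hq,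
    Polynomial.eval_finsetSum] at h3
  simpa using h3

end macmahon

/-! ### Wirtinger calculus for matrix-valued functions -/

section wirtinger

variable {ι κ : Type} [Fintype ι] [Fintype κ] [DecidableEq ι] [DecidableEq κ]
variable {p q r m : ℕ}

/-- The entrywise derivative of a matrix-valued function, contracted with a linear functional on
covectors. -/
def mD (l : Covec ι →ₗ[ℂ] ℂ) (G : (ι → ℂ) → Matrix (Fin p) (Fin q) ℂ) (u : ι → ℂ) :
    Matrix (Fin p) (Fin q) ℂ := Matrix.of fun i j => l (fderiv ℝ (fun v => G v i j) u)

/-- Entrywise differentiability of a matrix-valued function. -/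
def MatDiffAt (G : (ι → ℂ) → Matrix (Fin p) (Fin q) ℂ) (u : ι → ℂ) : Prop :=
  ∀ i j, DifferentiableAt ℝ (fun v => G v i j) u

/-- Entrywise smoothness of a matrix-valued function. -/
def MSmoothAt (G : (ι → ℂ) → Matrix (Fin p) (Fin q) ℂ) (u : ι → ℂ) : Prop :=
  ∀ i j, ContDiffAt ℝ ∞ (fun v => G v i j) u

/-- Entrywise holomorphy of a matrix-valued function. -/
def MHolAt (G : (ι → ℂ) → Matrix (Fin p) (Fin q) ℂ) (u : ι → ℂ) : Prop :=
  ∀ i j, AnalyticAt ℂ (fun v => G v i j) u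

omit [DecidableEq ι] in
theorem MSmoothAt.mdiffAt {G : (ι → ℂ) → Matrix (Fin p) (Fin q) ℂ} {u : ι → ℂ}
    (h : MSmoothAt G u) : MatDiffAt G u := fun i j => (h i j).differentiableAt (by simp)

omit [DecidableEq ι] in
theorem MSmoothAt.eventually_mdiffAt {G : (ι → ℂ) → Matrix (Fin p) (Fin q) ℂ} {u : ι → ℂ}
    (h : MSmoothAt G u) : ∀ᶠ v in 𝓝 u, MatDiffAt G v := by
  simp only [MatDiffAt, Filter.eventually_all]
  intro i j
  have h1 : ContDiffAt ℝ 1 (fun v => G v i j) u := (h i j).of_le (by simp)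
  filter_upwards [h1.eventually (by simp)] with v hv using hv.differentiableAt (by simp)

omit [DecidableEq ι] in
theorem AnalyticAt.contDiffAt_real {f : (ι → ℂ) → ℂ} {u : ι → ℂ} (h : AnalyticAt ℂ f u) :
    ContDiffAt ℝ ∞ f u := (h.contDiffAt (n := ∞)).restrict_scalars ℝ

omit [DecidableEq ι] in
theorem MHolAt.msmoothAt {G : (ι → ℂ) → Matrix (Fin p) (Fin q) ℂ} {u : ι → ℂ}
    (h : MHolAt G u) : MSmoothAt G u := fun i j => AnalyticAt.contDiffAt_real (h i j)

omit [DecidableEq ι] in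
theorem MHolAt.eventually {G : (ι → ℂ) → Matrix (Fin p) (Fin q) ℂ} {u : ι → ℂ}
    (h : MHolAt G u) : ∀ᶠ v in 𝓝 u, MHolAt G v := by
  simp only [MHolAt, Filter.eventually_all]
  exact fun i j => (h i j).eventually_analyticAt

omit [DecidableEq ι] in
theorem mD_congr {l : Covec ι →ₗ[ℂ] ℂ} {G H : (ι → ℂ) → Matrix (Fin p) (Fin q) ℂ} {u : ι → ℂ}
    (h : G =ᶠ[𝓝 u] H) : mD l G u = mD l H u := by
  ext i j
  simp only [mD, Matrix.of_apply]
  congr 1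
  exact Filter.EventuallyEq.fderiv_eq (h.fun_comp fun M => M i j)

omit [DecidableEq ι] in
theorem MatDiffAt.mul {G : (ι → ℂ) → Matrix (Fin p) (Fin q) ℂ}
    {H : (ι → ℂ) → Matrix (Fin q) (Fin r) ℂ} {u : ι → ℂ} (hG : MatDiffAt G u) (hH : MatDiffAt H u) :
    MatDiffAt (fun v => G v * H v) u := by
  intro i j
  simp only [Matrix.mul_apply]
  exact DifferentiableAt.fun_sum fun k _ => (hG i k).mul (hH k j)

omit [DecidableEq ι] in
theorem MSmoothAt.mul {G : (ι → ℂ) → Matrix (Fin p) (Fin q) ℂ}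
    {H : (ι → ℂ) → Matrix (Fin q) (Fin r) ℂ} {u : ι → ℂ} (hG : MSmoothAt G u)
    (hH : MSmoothAt H u) : MSmoothAt (fun v => G v * H v) u := by
  intro i j
  simp only [Matrix.mul_apply]
  exact ContDiffAt.sum fun k _ => (hG i k).mul (hH k j)

omit [DecidableEq ι] in
theorem mD_mul (l : Covec ι →ₗ[ℂ] ℂ) {G : (ι → ℂ) → Matrix (Fin p) (Fin q) ℂ}
    {H : (ι → ℂ) → Matrix (Fin q) (Fin r) ℂ} {u : ι → ℂ} (hG : MatDiffAt G u) (hH : MatDiffAt H u) :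
    mD l (fun v => G v * H v) u = mD l G u * H u + G u * mD l H u := by
  ext i j
  simp only [mD, Matrix.of_apply, Matrix.mul_apply, Matrix.add_apply]
  rw [fderiv_fun_sum fun k _ => (hG i k).fun_mul (hH k j), map_sum, ← Finset.sum_add_distrib]
  refine Finset.sum_congr rfl fun k _ => ?_
  have h1 : fderiv ℝ (fun v => G v i k * H v k j) u =
      (G u i k) • fderiv ℝ (fun v => H v k j) u + (H u k j) • fderiv ℝ (fun v => G v i k) u :=
    fderiv_mul (hG i k) (hH k j)
  change l (fderiv ℝ (fun v => G v i k * H v k j) u) = _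
  rw [h1, map_add, map_smul, map_smul, smul_eq_mul, smul_eq_mul]
  ring

omit [DecidableEq ι] in
theorem mD_const (l : Covec ι →ₗ[ℂ] ℂ) (M : Matrix (Fin p) (Fin q) ℂ) (u : ι → ℂ) :
    mD l (fun _ => M) u = 0 := by
  ext i j
  simp [mD]

omit [DecidableEq ι] in
theorem mD_add (l : Covec ι →ₗ[ℂ] ℂ) {G H : (ι → ℂ) → Matrix (Fin p) (Fin q) ℂ}
    {u : ι → ℂ} (hG : MatDiffAt G u) (hH : MatDiffAt H u) :
    mD l (fun v => G v + H v) u = mD l G u + mD l H u := by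
  ext i j
  simp only [mD, Matrix.of_apply, Matrix.add_apply]
  rw [← map_add]
  congr 1
  exact fderiv_add (hG i j) (hH i j)

omit [DecidableEq ι] in
theorem mD_neg (l : Covec ι →ₗ[ℂ] ℂ) (G : (ι → ℂ) → Matrix (Fin p) (Fin q) ℂ)
    (u : ι → ℂ) : mD l (fun v => -G v) u = -mD l G u := by
  ext i j
  simp only [mD, Matrix.of_apply, Matrix.neg_apply]
  rw [← map_neg]
  congr 1
  exact fderiv_neg

omit [DecidableEq ι] in
theorem contDiffAt_det {𝕜 : Type*} [NontriviallyNormedField 𝕜] [NormedAlgebra 𝕜 ℂ] {V : Type*}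
    [NormedAddCommGroup V] [NormedSpace 𝕜 V] {N : WithTop ℕ∞}
    {G : V → Matrix (Fin p) (Fin p) ℂ} {u : V}
    (hG : ∀ i j, ContDiffAt 𝕜 N (fun v => G v i j) u) : ContDiffAt 𝕜 N (fun v => (G v).det) u := by
  simp only [Matrix.det_apply]
  exact ContDiffAt.sum fun σ _ => ContDiffAt.const_smul _ (contDiffAt_prod fun i _ => hG _ _)

/-- Cramer's rule. The generality in field and regularity serves both real smoothness
(`MSmoothAt.inv`) and, over `ℂ` with `N = ω`, holomorphy (`MHolAt.inv`). -/
theorem contDiffAt_inv {𝕜 : Type*} [NontriviallyNormedField 𝕜] [NormedAlgebra 𝕜 ℂ] {V : Type*}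
    [NormedAddCommGroup V] [NormedSpace 𝕜 V] {N : WithTop ℕ∞}
    {G : V → Matrix (Fin p) (Fin p) ℂ} {u : V}
    (hG : ∀ i j, ContDiffAt 𝕜 N (fun v => G v i j) u) (hd : (G u).det ≠ 0) (i j : Fin p) :
    ContDiffAt 𝕜 N (fun v => (G v)⁻¹ i j) u := by
  simp only [Matrix.inv_def, Matrix.smul_apply, Ring.inverse_eq_inv', smul_eq_mul,
    Matrix.adjugate_apply]
  refine ((contDiffAt_det hG).inv hd).mul (contDiffAt_det fun k l => ?_)
  by_cases h : k = j
  · subst h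
    simp only [Matrix.updateRow_self]
    exact contDiffAt_const
  · simp only [Matrix.updateRow_ne h]
    exact hG k l

theorem MSmoothAt.inv {G : (ι → ℂ) → Matrix (Fin p) (Fin p) ℂ} {u : ι → ℂ} (hG : MSmoothAt G u)
    (hd : (G u).det ≠ 0) : MSmoothAt (fun v => (G v)⁻¹) u := contDiffAt_inv hG hd

theorem MatDiffAt.det {G : (ι → ℂ) → Matrix (Fin p) (Fin p) ℂ} {u : ι → ℂ}
    (hG : MatDiffAt G u) : DifferentiableAt ℝ (fun v => (G v).det) u := by
  simp only [Matrix.det_apply]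
  have h : ∀ (σ : Equiv.Perm (Fin p)) (t : Finset (Fin p)),
      DifferentiableAt ℝ (fun v => ∏ i ∈ t, G v (σ i) i) u := by
    intro σ t
    induction t using Finset.induction_on with
    | empty => simpa using differentiableAt_const _
    | insert i t hi ih =>
      simp only [Finset.prod_insert hi]
      exact (hG _ _).mul ih
  exact DifferentiableAt.fun_sum fun σ _ => (h σ _).fun_const_smul _

theorem MatDiffAt.inv {G : (ι → ℂ) → Matrix (Fin p) (Fin p) ℂ} {u : ι → ℂ} (hG : MatDiffAt G u)
    (hd : (G u).det ≠ 0) : MatDiffAt (fun v => (G v)⁻¹) u := by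
  intro i j
  simp only [Matrix.inv_def, Matrix.smul_apply, Ring.inverse_eq_inv', smul_eq_mul,
    Matrix.adjugate_apply]
  refine (hG.det.fun_inv hd).mul (MatDiffAt.det (G := fun v => (G v).updateRow j (Pi.single i 1))
    fun k l => ?_)
  by_cases h : k = j
  · subst h
    simp only [Matrix.updateRow_self]
    exact differentiableAt_const _
  · simp only [Matrix.updateRow_ne h]
    exact hG k l

theorem MHolAt.inv {G : (ι → ℂ) → Matrix (Fin p) (Fin p) ℂ} {u : ι → ℂ} (hG : MHolAt G u)
    (hd : (G u).det ≠ 0) : MHolAt (fun v => (G v)⁻¹) u := fun i j =>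
  (contDiffAt_inv (N := ω) (fun i j => (hG i j).contDiffAt) hd i j).analyticAt

theorem MatDiffAt.eventually_det_ne {G : (ι → ℂ) → Matrix (Fin p) (Fin p) ℂ} {u : ι → ℂ}
    (hG : MatDiffAt G u) (hd : (G u).det ≠ 0) : ∀ᶠ v in 𝓝 u, (G v).det ≠ 0 :=
  hG.det.continuousAt.eventually_ne hd

theorem mD_inv (l : Covec ι →ₗ[ℂ] ℂ) {G : (ι → ℂ) → Matrix (Fin p) (Fin p) ℂ} {u : ι → ℂ}
    (hG : MatDiffAt G u) (hd : (G u).det ≠ 0) :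
    mD l (fun v => (G v)⁻¹) u = -((G u)⁻¹ * mD l G u * (G u)⁻¹) := by
  have hu : IsUnit (G u).det := isUnit_iff_ne_zero.2 hd
  have h1 : mD l (fun v => G v * (G v)⁻¹) u = 0 := by
    rw [mD_congr (H := fun _ => 1), mD_const]
    filter_upwards [hG.eventually_det_ne hd] with v hv
    exact Matrix.mul_nonsing_inv _ (isUnit_iff_ne_zero.2 hv)
  rw [mD_mul l hG (hG.inv hd)] at h1
  have h2 := congrArg (fun M => (G u)⁻¹ * M) h1
  simp only [mul_add, mul_zero, ← mul_assoc, Matrix.nonsing_inv_mul _ hu, one_mul] at h2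
  exact eq_neg_of_add_eq_zero_right h2

omit [DecidableEq ι] in
theorem mD_smul (l : Covec ι →ₗ[ℂ] ℂ) {f : (ι → ℂ) → ℂ} {G : (ι → ℂ) → Matrix (Fin p) (Fin q) ℂ}
    {u : ι → ℂ} (hf : DifferentiableAt ℝ f u) (hG : MatDiffAt G u) :
    mD l (fun v => f v • G v) u = l (fderiv ℝ f u) • G u + f u • mD l G u := by
  ext i j
  simp only [mD, Matrix.of_apply, Matrix.add_apply, Matrix.smul_apply, smul_eq_mul]
  have h1 : fderiv ℝ (fun v => f v * G v i j) u =
      (f u) • fderiv ℝ (fun v => G v i j) u + (G u i j) • fderiv ℝ f u :=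
    fderiv_mul hf (hG i j)
  rw [h1, map_add, map_smul, map_smul, smul_eq_mul, smul_eq_mul]
  ring

omit [DecidableEq ι] in
theorem MatDiffAt.sum {α : Type*} (t : Finset α) {G : α → (ι → ℂ) → Matrix (Fin p) (Fin q) ℂ}
    {u : ι → ℂ} (hG : ∀ c ∈ t, MatDiffAt (G c) u) : MatDiffAt (fun v => ∑ c ∈ t, G c v) u := by
  intro i j
  simp only [Matrix.sum_apply]
  exact DifferentiableAt.fun_sum fun c hc => hG c hc i j

omit [DecidableEq ι] in
theorem mD_sum (l : Covec ι →ₗ[ℂ] ℂ) {α : Type*} (t : Finset α)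
    {G : α → (ι → ℂ) → Matrix (Fin p) (Fin q) ℂ}
    {u : ι → ℂ} (hG : ∀ c ∈ t, MatDiffAt (G c) u) :
    mD l (fun v => ∑ c ∈ t, G c v) u = ∑ c ∈ t, mD l (G c) u := by
  ext i j
  simp only [mD, Matrix.of_apply, Matrix.sum_apply]
  rw [← map_sum]
  congr 1
  exact fderiv_fun_sum fun c hc => hG c hc i j

/-! #### Holomorphic functions -/

theorem coeffDzbar_fderiv_of_holomorphic {f : (ι → ℂ) → ℂ} {u : ι → ℂ}
    (hf : DifferentiableAt ℂ f u) (a : ι) : coeffDzbar a (fderiv ℝ f u) = 0 := by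
  rw [coeffDzbar_apply, hf.fderiv_restrictScalars ℝ]
  have h : (Pi.single a Complex.I : ι → ℂ) = Complex.I • Pi.single a 1 := by
    rw [← Pi.single_smul', smul_eq_mul, mul_one]
  simp only [ContinuousLinearMap.coe_restrictScalars']
  rw [h, map_smul, smul_eq_mul, ← mul_assoc, Complex.I_mul_I]
  ring

theorem coeffDz_fderiv_of_holomorphic {f : (ι → ℂ) → ℂ} {u : ι → ℂ}
    (hf : DifferentiableAt ℂ f u) (a : ι) :
    coeffDz a (fderiv ℝ f u) = fderiv ℂ f u (Pi.single a 1) := by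
  rw [coeffDz_apply, hf.fderiv_restrictScalars ℝ]
  have h : (Pi.single a Complex.I : ι → ℂ) = Complex.I • Pi.single a 1 := by
    rw [← Pi.single_smul', smul_eq_mul, mul_one]
  simp only [ContinuousLinearMap.coe_restrictScalars']
  rw [h, map_smul, smul_eq_mul, ← mul_assoc, Complex.I_mul_I]
  ring

theorem mD_dzbar_of_holomorphic {G : (ι → ℂ) → Matrix (Fin p) (Fin q) ℂ} {u : ι → ℂ}
    (hG : MHolAt G u) (a : ι) : mD (coeffDzbar a) G u = 0 := by
  ext i j
  exact coeffDzbar_fderiv_of_holomorphic (hG i j).differentiableAt a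

theorem MHolAt.mD {G : (ι → ℂ) → Matrix (Fin p) (Fin q) ℂ} {u : ι → ℂ}
    (hG : MHolAt G u) (a : ι) : MHolAt (mD (coeffDz a) G) u := by
  intro i j
  have h1 : AnalyticAt ℂ (fun v => fderiv ℂ (fun v => G v i j) v (Pi.single a 1)) u :=
    ((ContinuousLinearMap.apply ℂ ℂ (Pi.single a (1 : ℂ) : ι → ℂ)).analyticAt _).comp
      (hG i j).fderiv
  refine h1.congr ?_
  filter_upwards [(hG i j).eventually_analyticAt] with v hv
  exact (coeffDz_fderiv_of_holomorphic hv.differentiableAt a).symm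

omit [DecidableEq ι] in
theorem MatDiffAt.conjTranspose {G : (ι → ℂ) → Matrix (Fin p) (Fin q) ℂ} {u : ι → ℂ}
    (hG : MatDiffAt G u) : MatDiffAt (fun v => (G v)ᴴ) u := fun i j =>
  (Complex.conjCLE : ℂ →L[ℝ] ℂ).differentiableAt.comp u (hG j i)

omit [DecidableEq ι] in
theorem MSmoothAt.conjTranspose {G : (ι → ℂ) → Matrix (Fin p) (Fin q) ℂ} {u : ι → ℂ}
    (hG : MSmoothAt G u) : MSmoothAt (fun v => (G v)ᴴ) u := fun i j =>
  (Complex.conjCLE : ℂ →L[ℝ] ℂ).contDiff.contDiffAt.comp u (hG j i)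

omit [DecidableEq ι] in
theorem fderiv_conj {f : (ι → ℂ) → ℂ} {u : ι → ℂ} (hf : DifferentiableAt ℝ f u) :
    fderiv ℝ (fun v => star (f v)) u = (Complex.conjCLE : ℂ →L[ℝ] ℂ).comp (fderiv ℝ f u) :=
  ((Complex.conjCLE : ℂ →L[ℝ] ℂ).hasFDerivAt.comp u hf.hasFDerivAt).fderiv

theorem mD_dz_conjTranspose {G : (ι → ℂ) → Matrix (Fin p) (Fin q) ℂ} {u : ι → ℂ}
    (hG : MatDiffAt G u) (a : ι) :
    mD (coeffDz a) (fun v => (G v)ᴴ) u = (mD (coeffDzbar a) G u)ᴴ := by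
  ext i j
  simp only [mD, Matrix.of_apply, Matrix.conjTranspose_apply]
  rw [fderiv_conj (hG j i), coeffDz_apply, coeffDzbar_apply]
  simp [sub_eq_add_neg]

theorem mD_dzbar_conjTranspose {G : (ι → ℂ) → Matrix (Fin p) (Fin q) ℂ} {u : ι → ℂ}
    (hG : MatDiffAt G u) (a : ι) :
    mD (coeffDzbar a) (fun v => (G v)ᴴ) u = (mD (coeffDz a) G u)ᴴ := by
  ext i j
  simp only [mD, Matrix.of_apply, Matrix.conjTranspose_apply]
  rw [fderiv_conj (hG j i), coeffDz_apply, coeffDzbar_apply]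
  simp [sub_eq_add_neg]

/-- The derivative of a holomorphic map commutes with `i`, so the chain rule does not mix types:
`dz` coefficients see the Jacobian, `d\bar z` coefficients its conjugate. -/
theorem coeffDz_comp {f : (κ → ℂ) → ℂ} {F : (ι → ℂ) → κ → ℂ} {u : ι → ℂ}
    (hf : DifferentiableAt ℝ f (F u)) (hF : DifferentiableAt ℂ F u) (a : ι) :
    coeffDz a (fderiv ℝ (fun v => f (F v)) u) =
      ∑ c, fderiv ℂ F u (Pi.single a 1) c * coeffDz c (fderiv ℝ f (F u)) ∧
    coeffDzbar a (fderiv ℝ (fun v => f (F v)) u) =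
      ∑ c, star (fderiv ℂ F u (Pi.single a 1) c) * coeffDzbar c (fderiv ℝ f (F u)) := by
  have h1 : fderiv ℝ (fun v => f (F v)) u =
      (fderiv ℝ f (F u)).comp ((fderiv ℂ F u).restrictScalars ℝ) := by
    rw [← hF.fderiv_restrictScalars ℝ]
    exact fderiv_comp u hf (hF.restrictScalars ℝ)
  have h : (Pi.single a Complex.I : ι → ℂ) = Complex.I • Pi.single a 1 := by
    rw [← Pi.single_smul', smul_eq_mul, mul_one]
  rw [h1, coeffDz_apply, coeffDzbar_apply]
  simp only [ContinuousLinearMap.comp_apply, ContinuousLinearMap.coe_restrictScalars']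
  rw [h, map_smul]
  generalize fderiv ℂ F u (Pi.single a 1) = x
  rw [covec_apply_eq (fderiv ℝ f (F u)) x, covec_apply_eq (fderiv ℝ f (F u)) (Complex.I • x)]
  simp only [Pi.smul_apply, smul_eq_mul, map_mul, Complex.conj_I]
  rw [Finset.mul_sum, ← Finset.sum_sub_distrib, ← Finset.sum_add_distrib, Finset.mul_sum,
    Finset.mul_sum]
  constructor
  · refine Finset.sum_congr rfl fun c _ => ?_
    linear_combination (-(1 / 2) * coeffDz c (fderiv ℝ f (F u)) * x c + (1 / 2) *
      coeffDzbar c (fderiv ℝ f (F u)) * (starRingEnd ℂ) (x c)) * Complex.I_mul_I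
  · refine Finset.sum_congr rfl fun c _ => ?_
    rw [← starRingEnd_apply]
    linear_combination ((1 / 2) * coeffDz c (fderiv ℝ f (F u)) * x c - (1 / 2) *
      coeffDzbar c (fderiv ℝ f (F u)) * (starRingEnd ℂ) (x c)) * Complex.I_mul_I

theorem mD_comp {G : (κ → ℂ) → Matrix (Fin p) (Fin q) ℂ} {F : (ι → ℂ) → κ → ℂ} {u : ι → ℂ}
    (hG : MatDiffAt G (F u)) (hF : DifferentiableAt ℂ F u) (a : ι) :
    mD (coeffDz a) (fun v => G (F v)) u =
      ∑ c, fderiv ℂ F u (Pi.single a 1) c • mD (coeffDz c) G (F u) ∧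
    mD (coeffDzbar a) (fun v => G (F v)) u =
      ∑ c, star (fderiv ℂ F u (Pi.single a 1) c) • mD (coeffDzbar c) G (F u) := by
  constructor <;> ext i j <;> simp only [Matrix.sum_apply, Matrix.smul_apply, mD, Matrix.of_apply,
    smul_eq_mul]
  · exact (coeffDz_comp (hG i j) hF a).1
  · exact (coeffDz_comp (hG i j) hF a).2

omit [DecidableEq ι] [DecidableEq κ] in
theorem MatDiffAt.comp {G : (κ → ℂ) → Matrix (Fin p) (Fin q) ℂ} {F : (ι → ℂ) → κ → ℂ} {u : ι → ℂ}
    (hG : MatDiffAt G (F u)) (hF : DifferentiableAt ℂ F u) : MatDiffAt (fun v => G (F v)) u :=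
  fun i j => (hG i j).comp u (hF.restrictScalars ℝ)

omit [DecidableEq ι] in
theorem MSmoothAt.mD {G : (ι → ℂ) → Matrix (Fin p) (Fin q) ℂ} {u : ι → ℂ}
    (hG : MSmoothAt G u) (l : Covec ι →ₗ[ℂ] ℂ) : MSmoothAt (mD l G) u := by
  intro i j
  have := finite_covec (ι := ι)
  have h1 : ContDiffAt ℝ ∞ (fderiv ℝ fun v => G v i j) u := (hG i j).fderiv_right (by simp)
  have h2 : ContDiff ℝ ∞ (l : Covec ι → ℂ) :=
    ((LinearMap.toContinuousLinearMap l).restrictScalars ℝ).contDiff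
  exact h2.contDiffAt.comp u h1

end wirtinger

/-! ### The Chern connection and its curvature -/

section curvature

variable {ι κ : Type} [Fintype ι] [Fintype κ] [DecidableEq ι] [DecidableEq κ]
variable {r : ℕ}

theorem connCoeff_eq (G : (ι → ℂ) → Matrix (Fin r) (Fin r) ℂ) (a : ι) (u : ι → ℂ) :
    connCoeff G a u = (G u)⁻¹ * mD (coeffDz a) G u := rfl

/-- The coefficient of `d\bar z_b ∧ dz_a` in the curvature. -/
def curvCoef (G : (ι → ℂ) → Matrix (Fin r) (Fin r) ℂ) (b a : ι) (u : ι → ℂ) :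
    Matrix (Fin r) (Fin r) ℂ := mD (coeffDzbar b) (connCoeff G a) u

/-- The curvature matrix, with entries in the commutative algebra of even forms. -/
def curvE (G : (ι → ℂ) → Matrix (Fin r) (Fin r) ℂ) (u : ι → ℂ) :
    Matrix (Fin r) (Fin r) (EvenForm ι) :=
  Matrix.of fun i j => ∑ b, ∑ a, curvCoef G b a u i j • wedge (dzbar b) (dz a)

theorem coe_curvE (G : (ι → ℂ) → Matrix (Fin r) (Fin r) ℂ) (u : ι → ℂ) (i j : Fin r) :
    (curvE G u i j : Form ι) = curvature G u i j := by
  simp only [curvE, curvature, Matrix.of_apply, AddSubmonoidClass.coe_finsetSum,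
    SetLike.val_smul, coe_wedge]
  rfl

theorem curvE_mem_evenTwo (G : (ι → ℂ) → Matrix (Fin r) (Fin r) ℂ) (u : ι → ℂ) (i j : Fin r) :
    curvE G u i j ∈ evenTwo ι :=
  Submodule.sum_mem _ fun _ _ => Submodule.sum_mem _ fun _ _ =>
    Submodule.smul_mem _ _ (wedge_mem_evenTwo _ _)

/-- The normalized curvature `(i / 2π) Θ`. -/
def chernCurv (G : (ι → ℂ) → Matrix (Fin r) (Fin r) ℂ) (u : ι → ℂ) :
    Matrix (Fin r) (Fin r) (EvenForm ι) := (Complex.I / (2 * (Real.pi : ℂ))) • curvE G u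

theorem chernCurv_mem_evenTwo (G : (ι → ℂ) → Matrix (Fin r) (Fin r) ℂ) (u : ι → ℂ)
    (i j : Fin r) : chernCurv G u i j ∈ evenTwo ι :=
  Submodule.smul_mem _ _ (curvE_mem_evenTwo G u i j)

theorem chernForm_eq (G : (ι → ℂ) → Matrix (Fin r) (Fin r) ℂ) (u : ι → ℂ) :
    chernForm G u = ((1 + chernCurv G u).det : EvenForm ι) := by
  have h : ∀ i j, ((1 + (Complex.I / (2 * (Real.pi : ℂ))) • curvature G u :
      Matrix (Fin r) (Fin r) (Form ι)) i j) = ((1 + chernCurv G u) i j : EvenForm ι) := by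
    intro i j
    simp only [chernCurv, Matrix.add_apply, Matrix.smul_apply, ← coe_curvE, Matrix.one_apply]
    split_ifs <;> simp
  simp only [chernForm, Matrix.det_apply, h, AddSubmonoidClass.coe_finsetSum]
  refine Finset.sum_congr rfl fun σ _ => ?_
  rw [← List.prod_ofFn]
  have e : (((List.ofFn fun i => (1 + chernCurv G u) (σ i) i).prod : EvenForm ι) : Form ι) =
      (List.ofFn fun i => (((1 + chernCurv G u) (σ i) i : EvenForm ι) : Form ι)).prod := by
    rw [← Subalgebra.coe_val, map_list_prod, List.map_ofFn]
    rfl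
  rw [← e]
  rcases Int.units_eq_one_or (Equiv.Perm.sign σ) with h | h <;> rw [h] <;> simp

/-- `Ring.inverse` is zero off the units of the noncommutative exterior algebra, so a two-sided
inverse is required; commutativity of even forms supplies the second side. -/
theorem ringInverse_coe_of_mul_eq_one {x y : EvenForm ι} (h : x * y = 1) :
    Ring.inverse (x : Form ι) = y := by
  have h1 : (x : Form ι) * y = 1 := congrArg Subtype.val h
  have h2 : (y : Form ι) * x = 1 := congrArg Subtype.val ((mul_comm y x).trans h)
  exact Ring.inverse_unit (⟨x, y, h1, h2⟩ : (Form ι)ˣ)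

theorem segrePart_eq_zero {s : ℕ} (K : Matrix (Fin (s + 1)) (Fin (s + 1)) ℂ)
    {Y : Matrix (Fin (s + 1)) (Fin (s + 1)) (EvenForm ι)} (hY : ∀ i j, Y i j ∈ evenTwo ι) {k : ℕ}
    (hk : Fintype.card ι < k) : segrePart K k Y = 0 :=
  Finset.sum_eq_zero fun f _ => by
    rw [prod_evenTwo_eq_zero hk _ fun i => hY _ _, smul_zero]

/-- The total Segre form in terms of moments of the Fubini–Study density. -/
theorem segreForm_eq {s : ℕ} {K : Matrix (Fin (s + 1)) (Fin (s + 1)) ℂ} (hK : K.PosDef)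
    (G : (ι → ℂ) → Matrix (Fin (s + 1)) (Fin (s + 1)) ℂ) (u : ι → ℂ) :
    segreForm G u = ((∑ k ∈ Finset.range (Fintype.card ι + 1), segrePart K k (chernCurv G u) :
      EvenForm ι) : Form ι) := by
  rw [segreForm, chernForm_eq]
  exact ringInverse_coe_of_mul_eq_one (det_mul_sum_segrePart hK _ _ fun k hk =>
    segrePart_eq_zero K (chernCurv_mem_evenTwo G u) hk)

/-- The total Segre form of a line bundle. -/
theorem segreForm_line (G : (ι → ℂ) → Matrix (Fin 1) (Fin 1) ℂ) (u : ι → ℂ) :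
    segreForm G u = ((∑ m ∈ Finset.range (Fintype.card ι + 1), (-chernCurv G u 0 0) ^ m :
      EvenForm ι) : Form ι) := by
  rw [segreForm, chernForm_eq]
  refine ringInverse_coe_of_mul_eq_one ?_
  have h := mul_neg_geom_sum (-chernCurv G u 0 0) (Fintype.card ι + 1)
  rw [pow_evenTwo_eq_zero (Nat.lt_succ_self _)
    (Submodule.neg_mem _ (chernCurv_mem_evenTwo G u 0 0)), sub_neg_eq_add, sub_zero] at h
  simpa [Matrix.det_fin_one] using h

omit [DecidableEq κ] in
theorem connCoeff_congr {G H : (ι → ℂ) → Matrix (Fin r) (Fin r) ℂ} {u : ι → ℂ}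
    (h : G =ᶠ[𝓝 u] H) (a : ι) : connCoeff G a u = connCoeff H a u := by
  rw [connCoeff_eq, connCoeff_eq, mD_congr h, h.eq_of_nhds]

theorem curvCoef_congr {G H : (ι → ℂ) → Matrix (Fin r) (Fin r) ℂ} {u : ι → ℂ}
    (h : G =ᶠ[𝓝 u] H) (b a : ι) : curvCoef G b a u = curvCoef H b a u :=
  mD_congr (h.eventuallyEq_nhds.mono fun _ hv => connCoeff_congr hv a)

theorem curvE_congr {G H : (ι → ℂ) → Matrix (Fin r) (Fin r) ℂ} {u : ι → ℂ}
    (h : G =ᶠ[𝓝 u] H) : curvE G u = curvE H u := by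
  ext1 i j
  simp only [curvE, Matrix.of_apply, curvCoef_congr h]

theorem chernCurv_congr {G H : (ι → ℂ) → Matrix (Fin r) (Fin r) ℂ} {u : ι → ℂ}
    (h : G =ᶠ[𝓝 u] H) : chernCurv G u = chernCurv H u := by
  rw [chernCurv, chernCurv, curvE_congr h]

theorem MSmoothAt.connCoeff {G : (ι → ℂ) → Matrix (Fin r) (Fin r) ℂ} {u : ι → ℂ}
    (hG : MSmoothAt G u) (hd : (G u).det ≠ 0) (a : ι) : MSmoothAt (connCoeff G a) u :=
  show MSmoothAt (fun v => (G v)⁻¹ * ParabolicSegre.mD (coeffDz a) G v) u from (hG.inv hd).mul (hG.mD _)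

/-- The gauge rule `A' = g⁻¹ (F^*A) g + g⁻¹ ∂g`: since `g` is holomorphic, `∂(g^*) = 0` and the left
factor cancels. -/
theorem connCoeff_transform {G : (κ → ℂ) → Matrix (Fin r) (Fin r) ℂ}
    {G' g : (ι → ℂ) → Matrix (Fin r) (Fin r) ℂ} {F : (ι → ℂ) → κ → ℂ} {u : ι → ℂ}
    (hG : MatDiffAt G (F u)) (hd : (G (F u)).det ≠ 0) (hg : MHolAt g u) (hgd : (g u).det ≠ 0)
    (hF : DifferentiableAt ℂ F u) (h : G' =ᶠ[𝓝 u] fun v => (g v)ᴴ * G (F v) * g v) (a : ι) :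
    connCoeff G' a u = (g u)⁻¹ * (∑ c, fderiv ℂ F u (Pi.single a 1) c • connCoeff G c (F u)) * g u
      + (g u)⁻¹ * mD (coeffDz a) g u := by
  have hGF : MatDiffAt (fun v => G (F v)) u := hG.comp hF
  have hgm : MatDiffAt g u := hg.msmoothAt.mdiffAt
  have hu1 : IsUnit (g u).det := isUnit_iff_ne_zero.2 hgd
  have hu2 : IsUnit (G (F u)).det := isUnit_iff_ne_zero.2 hd
  have hu3 : IsUnit ((g u)ᴴ).det := by
    rw [Matrix.det_conjTranspose]; exact hu1.star
  rw [connCoeff_congr h, connCoeff_eq, mD_mul _ (hgm.conjTranspose.mul hGF) hgm,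
    mD_mul _ hgm.conjTranspose hGF, mD_dz_conjTranspose hgm, mD_dzbar_of_holomorphic hg,
    (mD_comp hG hF a).1, Matrix.mul_inv_rev, Matrix.mul_inv_rev]
  simp only [Matrix.conjTranspose_zero, zero_mul, zero_add, mul_add, connCoeff_eq]
  have e1 : ∑ c, fderiv ℂ F u (Pi.single a 1) c • ((G (F u))⁻¹ * mD (coeffDz c) G (F u)) =
      (G (F u))⁻¹ * ∑ c, fderiv ℂ F u (Pi.single a 1) c • mD (coeffDz c) G (F u) := by
    rw [Finset.mul_sum]
    exact Finset.sum_congr rfl fun c _ => (Matrix.mul_smul _ _ _).symm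
  rw [e1]
  generalize (∑ c, fderiv ℂ F u (Pi.single a 1) c • mD (coeffDz c) G (F u)) = S
  simp only [mul_assoc, Matrix.nonsing_inv_mul_cancel_left _ _ hu3,
    Matrix.nonsing_inv_mul_cancel_left _ _ hu2]

/-- The inhomogeneous term `g⁻¹ ∂g`, the matrix `g` and the Jacobian of `F` are holomorphic, so `∂̄`
acts only on the connection of `G`. The gauge rule must hold on a neighbourhood because it is
differentiated. -/
theorem curvCoef_transform {G : (κ → ℂ) → Matrix (Fin r) (Fin r) ℂ}
    {G' g : (ι → ℂ) → Matrix (Fin r) (Fin r) ℂ} {F : (ι → ℂ) → κ → ℂ} {u : ι → ℂ}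
    (hG : MSmoothAt G (F u)) (hd : (G (F u)).det ≠ 0) (hg : MHolAt g u) (hgd : (g u).det ≠ 0)
    (hF : AnalyticAt ℂ F u) (h : G' =ᶠ[𝓝 u] fun v => (g v)ᴴ * G (F v) * g v) (b a : ι) :
    curvCoef G' b a u = (g u)⁻¹ * (∑ c, ∑ d, (fderiv ℂ F u (Pi.single a 1) c *
      star (fderiv ℂ F u (Pi.single b 1) d)) • curvCoef G d c (F u)) * g u := by
  have hgm : MatDiffAt g u := hg.msmoothAt.mdiffAt
  have hgi := hg.inv hgd
  have hJ : ∀ c, AnalyticAt ℂ (fun v => fderiv ℂ F v (Pi.single a 1) c) u := fun c =>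
    ((ContinuousLinearMap.proj (R := ℂ) (φ := fun _ : κ => ℂ) c).analyticAt _).comp
      (((ContinuousLinearMap.apply ℂ (κ → ℂ) (Pi.single a (1 : ℂ) : ι → ℂ)).analyticAt _).comp
        hF.fderiv)
  have hJd : ∀ c, DifferentiableAt ℝ (fun v => fderiv ℂ F v (Pi.single a 1) c) u := fun c =>
    (hJ c).differentiableAt.restrictScalars ℝ
  have hev : connCoeff G' a =ᶠ[𝓝 u] fun v =>
      (g v)⁻¹ * (∑ c, fderiv ℂ F v (Pi.single a 1) c • connCoeff G c (F v)) * g v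
      + (g v)⁻¹ * mD (coeffDz a) g v := by
    filter_upwards [hF.continuousAt.eventually hG.eventually_mdiffAt, hF.continuousAt.eventually (hG.mdiffAt.eventually_det_ne hd), hg.eventually,
      hg.msmoothAt.mdiffAt.eventually_det_ne hgd, hF.eventually_analyticAt, h.eventuallyEq_nhds]
      with v h1 h2 h3 h4 h5 h6
    exact connCoeff_transform h1 h2 h3 h4 h5.differentiableAt h6 a
  have hC : ∀ c, MatDiffAt (fun v => connCoeff G c (F v)) u := fun c =>
    (hG.connCoeff hd c).mdiffAt.comp hF.differentiableAt
  have hsm : ∀ c ∈ Finset.univ, MatDiffAt (fun v => fderiv ℂ F v (Pi.single a 1) c •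
      connCoeff G c (F v)) u := fun c _ i j => (hJd c).mul (hC c i j)
  have hs := MatDiffAt.sum _ hsm
  rw [curvCoef, mD_congr hev, mD_add _ ((hgi.msmoothAt.mdiffAt.mul hs).mul hgm)
    (hgi.msmoothAt.mdiffAt.mul (hg.mD a).msmoothAt.mdiffAt),
    mD_mul _ (hgi.msmoothAt.mdiffAt.mul hs) hgm, mD_mul _ hgi.msmoothAt.mdiffAt hs,
    mD_mul _ hgi.msmoothAt.mdiffAt (hg.mD a).msmoothAt.mdiffAt,
    mD_dzbar_of_holomorphic hgi, mD_dzbar_of_holomorphic hg, mD_dzbar_of_holomorphic (hg.mD a),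
    mD_sum _ _ hsm]
  simp only [zero_mul, mul_zero, zero_add, add_zero]
  congr 2
  refine Finset.sum_congr rfl fun c _ => ?_
  rw [mD_smul _ (hJd c) (hC c), coeffDzbar_fderiv_of_holomorphic (hJ c).differentiableAt,
    zero_smul, zero_add, (mD_comp (hG.connCoeff hd c).mdiffAt hF.differentiableAt b).2,
    Finset.smul_sum]
  refine Finset.sum_congr rfl fun d _ => ?_
  rw [smul_smul]
  rfl

theorem pullCovec_dz (J : (ι → ℂ) →L[ℂ] (κ → ℂ)) (c : κ) :
    pullCovec (J.restrictScalars ℝ) (dz c) = ∑ a, J (Pi.single a 1) c • dz a := by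
  ext v
  have hv : v = ∑ a, v a • (Pi.single a 1 : ι → ℂ) := by
    conv_lhs => rw [pi_eq_sum_univ' v]
  rw [pullCovec_apply, ContinuousLinearMap.coe_restrictScalars', dz_apply]
  conv_lhs => rw [hv, map_sum]
  simp [Finset.sum_apply, mul_comm]

theorem pullCovec_dzbar (J : (ι → ℂ) →L[ℂ] (κ → ℂ)) (c : κ) :
    pullCovec (J.restrictScalars ℝ) (dzbar c) = ∑ a, star (J (Pi.single a 1) c) • dzbar a := by
  ext v
  have h := congrArg (fun φ : Covec ι => (starRingEnd ℂ) (φ v)) (pullCovec_dz J c)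
  simp only [pullCovec_apply, dz_apply] at h
  rw [pullCovec_apply, dzbar_apply, h]
  simp

omit [DecidableEq ι] [DecidableEq κ] in
theorem wedge_sum_smul {α β : Type*} (S : Finset α) (T : Finset β) (x : α → ℂ) (y : β → ℂ)
    (p : α → Covec ι) (q : β → Covec ι) :
    wedge (∑ i ∈ S, x i • p i) (∑ j ∈ T, y j • q j) =
      ∑ i ∈ S, ∑ j ∈ T, (x i * y j) • wedge (p i) (q j) := by
  ext
  simp only [coe_wedge, map_sum, map_smul, Finset.sum_mul, Finset.mul_sum,
    AddSubmonoidClass.coe_finsetSum, SetLike.val_smul, smul_mul_assoc, mul_smul_comm,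
    Finset.smul_sum, smul_smul]
  rw [Finset.sum_comm]
  refine Finset.sum_congr rfl fun i _ => Finset.sum_congr rfl fun j _ => ?_
  first | rfl | rw [mul_comm]

variable (ι) in
/-- Scalar matrices as matrices of even forms. -/
def scalarForm {m l : ℕ} (M : Matrix (Fin m) (Fin l) ℂ) : Matrix (Fin m) (Fin l) (EvenForm ι) :=
  M.map (algebraMap ℂ (EvenForm ι))

omit [DecidableEq ι] in
theorem scalarForm_mul_apply {m l p : ℕ} (M : Matrix (Fin m) (Fin l) ℂ)
    (Y : Matrix (Fin l) (Fin p) (EvenForm ι)) (i : Fin m) (j : Fin p) :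
    (scalarForm ι M * Y) i j = ∑ k, M i k • Y k j := by
  simp [scalarForm, Matrix.mul_apply, Algebra.smul_def]

omit [DecidableEq ι] in
theorem mul_scalarForm_apply {m l p : ℕ} (M : Matrix (Fin l) (Fin p) ℂ)
    (Y : Matrix (Fin m) (Fin l) (EvenForm ι)) (i : Fin m) (j : Fin p) :
    (Y * scalarForm ι M) i j = ∑ k, M k j • Y i k := by
  simp [scalarForm, Matrix.mul_apply, Algebra.smul_def, mul_comm]

/-- Transformation of the curvature under holomorphic maps and changes of frame. -/
theorem curvE_transform {G : (κ → ℂ) → Matrix (Fin r) (Fin r) ℂ}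
    {G' g : (ι → ℂ) → Matrix (Fin r) (Fin r) ℂ} {F : (ι → ℂ) → κ → ℂ} {u : ι → ℂ}
    (hG : MSmoothAt G (F u)) (hd : (G (F u)).det ≠ 0) (hg : MHolAt g u) (hgd : (g u).det ≠ 0)
    (hF : AnalyticAt ℂ F u) (h : G' =ᶠ[𝓝 u] fun v => (g v)ᴴ * G (F v) * g v) :
    curvE G' u = scalarForm ι (g u)⁻¹ *
      (curvE G (F u)).map (pullEven ((fderiv ℂ F u).restrictScalars ℝ)) * scalarForm ι (g u) := by
  have e : ∀ k l, pullEven ((fderiv ℂ F u).restrictScalars ℝ) (curvE G (F u) k l) =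
      ∑ b, ∑ a, (∑ c, ∑ d, (fderiv ℂ F u (Pi.single a 1) c *
      star (fderiv ℂ F u (Pi.single b 1) d)) • curvCoef G d c (F u)) k l •
        wedge (dzbar b) (dz a) := by
    intro k l
    simp only [curvE, Matrix.of_apply, map_sum, map_smul, pullEven_wedge, pullCovec_dz,
      pullCovec_dzbar, wedge_sum_smul, Matrix.sum_apply, Matrix.smul_apply, Finset.sum_smul,
      Finset.smul_sum, smul_smul, smul_eq_mul]
    rw [Finset.sum_congr rfl fun d _ => Finset.sum_comm]
    rw [Finset.sum_comm]
    refine Finset.sum_congr rfl fun b _ => ?_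
    rw [Finset.sum_congr rfl fun d _ => Finset.sum_comm]
    rw [Finset.sum_comm]
    refine Finset.sum_congr rfl fun a _ => ?_
    rw [Finset.sum_comm]
    refine Finset.sum_congr rfl fun c _ => Finset.sum_congr rfl fun d _ => ?_
    congr 1
    ring
  ext1 i j
  rw [mul_scalarForm_apply]
  simp only [scalarForm_mul_apply, Matrix.map_apply, e, Finset.smul_sum, smul_smul]
  simp only [curvE, Matrix.of_apply, curvCoef_transform hG hd hg hgd hF h]
  rw [Finset.sum_congr rfl fun l _ => Finset.sum_congr rfl fun k _ => rfl]
  simp only [Matrix.mul_apply, Finset.sum_mul, Finset.sum_smul]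
  rw [Finset.sum_congr rfl fun l _ => Finset.sum_comm, Finset.sum_comm]
  refine Finset.sum_congr rfl fun b _ => ?_
  rw [Finset.sum_congr rfl fun l _ => Finset.sum_comm, Finset.sum_comm]
  refine Finset.sum_congr rfl fun a _ => ?_
  refine Finset.sum_congr rfl fun l _ => Finset.sum_congr rfl fun k _ => ?_
  congr 1
  ring

end curvature

/-! ### The curvature of a quotient metric -/

section quotient

variable {ι : Type} [Fintype ι] [DecidableEq ι]
variable {r q : ℕ}

/-- The covariant derivative `∂_a Ξ - Ξ A_a` of a row of functionals. -/
def covDer (G : (ι → ℂ) → Matrix (Fin r) (Fin r) ℂ) (Ξ : (ι → ℂ) → Matrix (Fin q) (Fin r) ℂ)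
    (a : ι) (u : ι → ℂ) : Matrix (Fin q) (Fin r) ℂ :=
  mD (coeffDz a) Ξ u - Ξ u * connCoeff G a u

/-- The Gram matrix of the dual metric on a family of functionals. -/
def dualGram (G : (ι → ℂ) → Matrix (Fin r) (Fin r) ℂ) (Ξ : (ι → ℂ) → Matrix (Fin q) (Fin r) ℂ)
    (u : ι → ℂ) : Matrix (Fin q) (Fin q) ℂ := Ξ u * (G u)⁻¹ * (Ξ u)ᴴ

variable {G : (ι → ℂ) → Matrix (Fin r) (Fin r) ℂ} {Ξ : (ι → ℂ) → Matrix (Fin q) (Fin r) ℂ}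
  {u : ι → ℂ}

/-- As `∂(G⁻¹) = -G⁻¹ (∂G) G⁻¹`, differentiating `Ξ G⁻¹` produces exactly the covariant derivative
of `Ξ`. -/
theorem mD_dz_mul_inv (hG : MatDiffAt G u) (hd : (G u).det ≠ 0) (hΞ : MHolAt Ξ u) (a : ι) :
    mD (coeffDz a) (fun v => Ξ v * (G v)⁻¹) u = covDer G Ξ a u * (G u)⁻¹ := by
  rw [mD_mul _ hΞ.msmoothAt.mdiffAt (hG.inv hd), mD_inv _ hG hd, covDer, connCoeff_eq,
    Matrix.sub_mul, Matrix.mul_neg, sub_eq_add_neg]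
  simp only [Matrix.mul_assoc]

theorem mD_dz_dualGram (hG : MatDiffAt G u) (hd : (G u).det ≠ 0) (hΞ : MHolAt Ξ u) (a : ι) :
    mD (coeffDz a) (dualGram G Ξ) u = covDer G Ξ a u * ((G u)⁻¹ * (Ξ u)ᴴ) := by
  have h := mD_mul (coeffDz a) (hΞ.msmoothAt.mdiffAt.mul (hG.inv hd))
    hΞ.msmoothAt.mdiffAt.conjTranspose
  rw [mD_dz_mul_inv hG hd hΞ, mD_dz_conjTranspose hΞ.msmoothAt.mdiffAt,
    mD_dzbar_of_holomorphic hΞ] at h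
  rw [show dualGram G Ξ = fun v => Ξ v * (G v)⁻¹ * (Ξ v)ᴴ from rfl, h]
  simp [Matrix.mul_assoc]

theorem MSmoothAt.dualGram (hG : MSmoothAt G u) (hd : (G u).det ≠ 0) (hΞ : MHolAt Ξ u) :
    MSmoothAt (dualGram G Ξ) u :=
  (hΞ.msmoothAt.mul (hG.inv hd)).mul hΞ.msmoothAt.conjTranspose

theorem MSmoothAt.sub {p m : ℕ} {A B : (ι → ℂ) → Matrix (Fin p) (Fin m) ℂ} (hA : MSmoothAt A u)
    (hB : MSmoothAt B u) : MSmoothAt (fun v => A v - B v) u := fun i j => (hA i j).sub (hB i j)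

theorem mD_sub {p m : ℕ} (l : Covec ι →ₗ[ℂ] ℂ) {A B : (ι → ℂ) → Matrix (Fin p) (Fin m) ℂ}
    (hA : MatDiffAt A u) (hB : MatDiffAt B u) :
    mD l (fun v => A v - B v) u = mD l A u - mD l B u := by
  have hB' : MatDiffAt (fun v => -B v) u := fun i j => (hB i j).neg
  simp only [sub_eq_add_neg]
  rw [mD_add l hA hB', mD_neg]

/-- For Hermitian `G` the matrix `G⁻¹ Ξ^*` is the adjoint of `Ξ G⁻¹`, and conjugation exchanges `∂̄`
with `∂`. -/
theorem mD_dzbar_inv_mul (hG : MSmoothAt G u) (hd : (G u).det ≠ 0) (hΞ : MHolAt Ξ u)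
    (hH : ∀ᶠ v in 𝓝 u, (G v).IsHermitian) (b : ι) :
    mD (coeffDzbar b) (fun v => (G v)⁻¹ * (Ξ v)ᴴ) u = (G u)⁻¹ * (covDer G Ξ b u)ᴴ := by
  have h : (fun v => (G v)⁻¹ * (Ξ v)ᴴ) =ᶠ[𝓝 u] fun v => (Ξ v * (G v)⁻¹)ᴴ := by
    filter_upwards [hH] with v hv
    rw [Matrix.conjTranspose_mul, hv.inv.eq]
  rw [mD_congr h, mD_dzbar_conjTranspose (hΞ.msmoothAt.mul (hG.inv hd)).mdiffAt,
    mD_dz_mul_inv hG.mdiffAt hd hΞ, Matrix.conjTranspose_mul, hH.self_of_nhds.inv.eq]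

theorem mD_dzbar_dualGram (hG : MSmoothAt G u) (hd : (G u).det ≠ 0) (hΞ : MHolAt Ξ u)
    (hH : ∀ᶠ v in 𝓝 u, (G v).IsHermitian) (b : ι) :
    mD (coeffDzbar b) (dualGram G Ξ) u = Ξ u * ((G u)⁻¹ * (covDer G Ξ b u)ᴴ) := by
  have h := mD_mul (coeffDzbar b) hΞ.msmoothAt.mdiffAt
    ((hG.inv hd).mul hΞ.msmoothAt.conjTranspose).mdiffAt
  rw [mD_dzbar_inv_mul hG hd hΞ hH, mD_dzbar_of_holomorphic hΞ, Matrix.zero_mul, zero_add] at h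
  rw [show dualGram G Ξ = fun v => Ξ v * ((G v)⁻¹ * (Ξ v)ᴴ) from
    funext fun v => Matrix.mul_assoc _ _ _, h]

/-- The curvature of the metric induced on a quotient bundle. -/
theorem curvCoef_inv_dualGram (hG : MSmoothAt G u) (hd : (G u).det ≠ 0) (hΞ : MHolAt Ξ u)
    (hH : ∀ᶠ v in 𝓝 u, (G v).IsHermitian) (hΦ : (dualGram G Ξ u).det ≠ 0) (b a : ι) :
    curvCoef (fun v => (dualGram G Ξ v)⁻¹) b a u =
      (Ξ u * curvCoef G b a u * (G u)⁻¹ * (Ξ u)ᴴ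
        - covDer G Ξ a u * (G u)⁻¹ * (covDer G Ξ b u)ᴴ
        + covDer G Ξ a u * (G u)⁻¹ * (Ξ u)ᴴ * (dualGram G Ξ u)⁻¹ * Ξ u * (G u)⁻¹ *
          (covDer G Ξ b u)ᴴ) * (dualGram G Ξ u)⁻¹ := by
  have hS := hG.dualGram hd hΞ
  have hcs : MSmoothAt (covDer G Ξ a) u :=
    MSmoothAt.sub (hΞ.mD a).msmoothAt (hΞ.msmoothAt.mul (hG.connCoeff hd a))
  have hdiff : ∀ᶠ v in 𝓝 u, mD (coeffDz a) (fun v => (dualGram G Ξ v)⁻¹) v =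
      -((dualGram G Ξ v)⁻¹ * (covDer G Ξ a v * ((G v)⁻¹ * (Ξ v)ᴴ)) * (dualGram G Ξ v)⁻¹) := by
    filter_upwards [hS.eventually_mdiffAt, hS.mdiffAt.eventually_det_ne hΦ, hG.eventually_mdiffAt,
      hG.mdiffAt.eventually_det_ne hd, hΞ.eventually] with v h1 h2 h3 h4 h5
    rw [mD_inv _ h1 h2, mD_dz_dualGram h3 h4 h5]
  -- With `Φ` the dual Gram matrix, the connection of `Φ⁻¹` is `-(∂Φ) Φ⁻¹`.
  have hev : connCoeff (fun v => (dualGram G Ξ v)⁻¹) a =ᶠ[𝓝 u] fun v =>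
      -(covDer G Ξ a v * ((G v)⁻¹ * (Ξ v)ᴴ) * (dualGram G Ξ v)⁻¹) := by
    filter_upwards [hdiff, hS.mdiffAt.eventually_det_ne hΦ] with v h1 h2
    have hu := isUnit_iff_ne_zero.2 h2
    rw [connCoeff_eq, h1, Matrix.nonsing_inv_nonsing_inv _ hu, mul_neg]
    simp only [mul_assoc, Matrix.mul_nonsing_inv_cancel_left _ _ hu]
  have hK := (hG.inv hd).mul hΞ.msmoothAt.conjTranspose
  -- `Ξ` and `∂Ξ` are holomorphic, so only the connection is differentiated; this is where the
  -- curvature of the ambient bundle enters.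
  have hcov : mD (coeffDzbar b) (covDer G Ξ a) u = -(Ξ u * curvCoef G b a u) := by
    rw [show covDer G Ξ a = fun v => mD (coeffDz a) Ξ v - Ξ v * connCoeff G a v from rfl,
      mD_sub _ (hΞ.mD a).msmoothAt.mdiffAt (hΞ.msmoothAt.mul (hG.connCoeff hd a)).mdiffAt,
      mD_dzbar_of_holomorphic (hΞ.mD a), mD_mul _ hΞ.msmoothAt.mdiffAt
      (hG.connCoeff hd a).mdiffAt, mD_dzbar_of_holomorphic hΞ, Matrix.zero_mul, zero_add, zero_sub]
    rfl
  rw [curvCoef, mD_congr hev, mD_neg, mD_mul _ (hcs.mul hK).mdiffAt (hS.inv hΦ).mdiffAt,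
    mD_mul _ hcs.mdiffAt hK.mdiffAt, mD_inv _ hS.mdiffAt hΦ, mD_dzbar_dualGram hG hd hΞ hH,
    mD_dzbar_inv_mul hG hd hΞ hH, hcov]
  simp only [Matrix.mul_assoc, mul_neg, neg_mul, Matrix.mul_neg, Matrix.neg_mul, Matrix.add_mul,
    Matrix.sub_mul]
  abel

end quotient

/-! ### The curvature of the tautological quotient line bundle -/

section line

variable {n s : ℕ}

theorem wedge_swap {ι : Type} [Fintype ι] (a b : Covec ι) : wedge a b = -wedge b a := by
  ext
  simp only [coe_wedge, NegMemClass.coe_neg]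
  exact eq_neg_of_add_eq_zero_left (ExteriorAlgebra.ι_add_mul_swap a b)

theorem map_contract {R S : Type*} [CommRing R] [Algebra ℂ R] [CommRing S] [Algebra ℂ S]
    (g : R →ₐ[ℂ] S) {m : ℕ} (K : Matrix (Fin m) (Fin m) ℂ) (ξ : Fin m → ℂ)
    (Y : Matrix (Fin m) (Fin m) R) : g (contract K ξ Y) = contract K ξ (Y.map g) := by
  simp [contract]

theorem contract_smul {R : Type*} [CommRing R] [Algebra ℂ R] {m : ℕ}
    (K : Matrix (Fin m) (Fin m) ℂ) (ξ : Fin m → ℂ) (c : ℂ) (Y : Matrix (Fin m) (Fin m) R) :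
    contract K ξ (c • Y) = c • contract K ξ Y := by
  simp only [contract, Matrix.smul_apply, Finset.smul_sum]
  exact Finset.sum_congr rfl fun p _ => smul_comm _ _ _

theorem contract_curvE {ι : Type} [Fintype ι] [DecidableEq ι] {m : ℕ}
    (K : Matrix (Fin m) (Fin m) ℂ) (ξ : Fin m → ℂ)
    (G : (ι → ℂ) → Matrix (Fin m) (Fin m) ℂ) (u : ι → ℂ) :
    contract K ξ (curvE G u) =
      ∑ b, ∑ a, contract K ξ (curvCoef G b a u) • wedge (dzbar b) (dz a) := by
  simp only [contract, curvE, Matrix.of_apply, Finset.smul_sum, Finset.sum_smul, smul_smul,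
    smul_eq_mul]
  rw [Finset.sum_comm]
  refine Finset.sum_congr rfl fun b _ => ?_
  rw [Finset.sum_comm]

/-- The projection `ℂ^n × ℂ^s → ℂ^n` as a complex-linear map. -/
def baseProjC (n s : ℕ) : (Fin n ⊕ Fin s → ℂ) →L[ℂ] (Fin n → ℂ) :=
  ContinuousLinearMap.pi fun a =>
    ContinuousLinearMap.proj (R := ℂ) (φ := fun _ : Fin n ⊕ Fin s => ℂ) (Sum.inl a)

/-- The functional with affine coordinates `w` as a row. -/
def dualRow (n s : ℕ) (y : Fin n ⊕ Fin s → ℂ) : Matrix (Fin 1) (Fin (s + 1)) ℂ :=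
  Matrix.of fun _ => Fin.cons 1 fun i => y (Sum.inr i)

theorem dualRow_mHolAt (y : Fin n ⊕ Fin s → ℂ) : MHolAt (dualRow n s) y := by
  intro i j
  refine Fin.cases ?_ (fun j => ?_) j
  · simpa [dualRow] using analyticAt_const
  · have h : (fun v => dualRow n s v i j.succ) =
        ContinuousLinearMap.proj (R := ℂ) (φ := fun _ : Fin n ⊕ Fin s => ℂ) (Sum.inr j) := by
      ext v; simp [dualRow]
    rw [h]
    exact ContinuousLinearMap.analyticAt _ y

/-- The Gram matrix of the pull-back of a bundle to its projectivization. -/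
def pullGram (s : ℕ) (G : (Fin n → ℂ) → Matrix (Fin (s + 1)) (Fin (s + 1)) ℂ)
    (y : Fin n ⊕ Fin s → ℂ) : Matrix (Fin (s + 1)) (Fin (s + 1)) ℂ := G (baseProj n s y)

/-- The matrix of the Fubini–Study metric. -/
def fsMatrix (K : Matrix (Fin (s + 1)) (Fin (s + 1)) ℂ) (ξ : Fin (s + 1) → ℂ) :
    Matrix (Fin (s + 1)) (Fin (s + 1)) ℂ :=
  Matrix.of fun i j => K i j / hval K ξ - (K *ᵥ star ξ) i * (ξ ᵥ* K) j / hval K ξ ^ 2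

/-- The radial direction `ξ` is degenerate for the Fubini–Study form, as it must be for a form
coming from projective space. Together with `fsMatrix_mulVec` this allows passing to affine
components. -/
theorem vecMul_fsMatrix {K : Matrix (Fin (s + 1)) (Fin (s + 1)) ℂ} {ξ : Fin (s + 1) → ℂ}
    (h : hval K ξ ≠ 0) : ξ ᵥ* fsMatrix K ξ = 0 := by
  ext j
  simp only [fsMatrix, Matrix.vecMul, dotProduct, Matrix.of_apply, Pi.zero_apply, mul_sub,
    Finset.sum_sub_distrib, mul_div_assoc']
  rw [← Finset.sum_div, ← Finset.sum_div]
  have h1 : ∑ i, ξ i * ((K *ᵥ star ξ) i * (ξ ᵥ* K) j) = hval K ξ * (ξ ᵥ* K) j := by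
    rw [hval, dotProduct, Finset.sum_mul]
    exact Finset.sum_congr rfl fun i _ => by ring
  have h2 : ∑ i, ξ i * K i j = (ξ ᵥ* K) j := rfl
  have h3 : (∑ i, ξ i * ((K *ᵥ star ξ) i * ∑ i, ξ i * K i j)) = hval K ξ * (ξ ᵥ* K) j := h1
  rw [h3, h2]
  field_simp
  ring

theorem fsMatrix_mulVec {K : Matrix (Fin (s + 1)) (Fin (s + 1)) ℂ} {ξ : Fin (s + 1) → ℂ}
    (h : hval K ξ ≠ 0) : fsMatrix K ξ *ᵥ star ξ = 0 := by
  ext i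
  have h1 : (fsMatrix K ξ *ᵥ star ξ) i =
      (K *ᵥ star ξ) i / hval K ξ - (K *ᵥ star ξ) i * ((ξ ᵥ* K) ⬝ᵥ star ξ) / hval K ξ ^ 2 := by
    simp only [Matrix.mulVec, dotProduct, fsMatrix, Matrix.of_apply, sub_mul,
      Finset.sum_sub_distrib, Finset.sum_div, Finset.mul_sum]
    congr 1
    · exact Finset.sum_congr rfl fun j _ => by ring
    · exact Finset.sum_congr rfl fun j _ => by ring
  rw [h1, ← Matrix.dotProduct_mulVec]
  change _ - _ * hval K ξ / _ = 0
  field_simp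
  ring

/-- The affine components of a row relative to the row `(1, w)`. -/
def affinePart (w : Fin s → ℂ) (α : Fin (s + 1) → ℂ) (i : Fin s) : ℂ := α i.succ - α 0 * w i

/-- Write each row as a multiple of `(1, w)`, which is degenerate on both sides, plus a row with
zero first entry. -/
theorem sesq_eq_affine {M : Matrix (Fin (s + 1)) (Fin (s + 1)) ℂ} {w : Fin s → ℂ}
    (h1 : (Fin.cons 1 w : Fin (s + 1) → ℂ) ᵥ* M = 0)
    (h2 : M *ᵥ star (Fin.cons 1 w : Fin (s + 1) → ℂ) = 0) (α β : Fin (s + 1) → ℂ) :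
    α ⬝ᵥ M *ᵥ star β = ∑ i, ∑ j, affinePart w α i * M i.succ j.succ * star (affinePart w β j) := by
  have e : ∀ γ : Fin (s + 1) → ℂ, γ = γ 0 • (Fin.cons 1 w : Fin (s + 1) → ℂ) +
      Fin.cons 0 (affinePart w γ) := by
    intro γ
    ext i
    refine Fin.cases ?_ (fun i => ?_) i
    · simp
    · simp [affinePart]
  have e2 : star (Fin.cons 0 (affinePart w β) : Fin (s + 1) → ℂ) =
      Fin.cons 0 (star (affinePart w β)) := by
    ext i
    refine Fin.cases ?_ (fun i => ?_) i <;> simp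
  conv_lhs => rw [e α, e β, star_add, star_smul, Matrix.mulVec_add, Matrix.mulVec_smul, h2,
    smul_zero, zero_add, add_dotProduct, smul_dotProduct, Matrix.dotProduct_mulVec, h1,
    zero_dotProduct, smul_zero, zero_add, e2]
  simp only [dotProduct, Fin.sum_univ_succ, Fin.cons_zero, Fin.cons_succ, zero_mul, zero_add,
    Matrix.mulVec, mul_zero, Finset.mul_sum, Pi.star_apply, Finset.sum_const_zero, mul_assoc]

/-- The Fubini–Study form in affine coordinates. -/
def fsForm (K : Matrix (Fin (s + 1)) (Fin (s + 1)) ℂ) (w : Fin s → ℂ) : EvenForm (Fin s) :=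
  (Complex.I / (2 * (Real.pi : ℂ))) • ∑ i : Fin s, ∑ j : Fin s,
    fsMatrix K (Fin.cons 1 w) i.succ j.succ • wedge (dz i) (dzbar j)

theorem fsForm_mem_evenTwo (K : Matrix (Fin (s + 1)) (Fin (s + 1)) ℂ) (w : Fin s → ℂ) :
    fsForm K w ∈ evenTwo (Fin s) :=
  Submodule.smul_mem _ _ (Submodule.sum_mem _ fun _ _ => Submodule.sum_mem _ fun _ _ =>
    Submodule.smul_mem _ _ (wedge_mem_evenTwo _ _))

theorem row_mul_apply {m : ℕ} (A B : Matrix (Fin 1) (Fin m) ℂ) (K : Matrix (Fin m) (Fin m) ℂ) :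
    (A * K * Bᴴ) 0 0 = A 0 ⬝ᵥ K *ᵥ star (B 0) := by
  rw [Matrix.mul_assoc, Matrix.mul_apply, dotProduct]
  exact Finset.sum_congr rfl fun i _ => by
    rw [Matrix.mul_apply, Matrix.mulVec, dotProduct]
    rfl

theorem fin_one_inv_apply (M : Matrix (Fin 1) (Fin 1) ℂ) : M⁻¹ 0 0 = (M 0 0)⁻¹ := by
  rw [Matrix.inv_def, Matrix.det_fin_one]
  simp [Matrix.adjugate_fin_one]

/-- For a quotient of rank one, the two second-fundamental-form terms of the quotient curvature
combine into the Fubini–Study matrix evaluated on the covariant derivatives. -/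
theorem curvCoef_line {ι : Type} [Fintype ι] [DecidableEq ι]
    {G : (ι → ℂ) → Matrix (Fin (s + 1)) (Fin (s + 1)) ℂ}
    {Ξ : (ι → ℂ) → Matrix (Fin 1) (Fin (s + 1)) ℂ} {u : ι → ℂ}
    (hG : MSmoothAt G u) (hp : (G u).PosDef) (hΞ : MHolAt Ξ u)
    (hH : ∀ᶠ v in 𝓝 u, (G v).IsHermitian) (h0 : Ξ u 0 ≠ 0) (b a : ι) :
    curvCoef (fun v => (dualGram G Ξ v)⁻¹) b a u 0 0 =
      contract (G u)⁻¹ (Ξ u 0) (curvCoef G b a u) -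
        covDer G Ξ a u 0 ⬝ᵥ fsMatrix (G u)⁻¹ (Ξ u 0) *ᵥ star (covDer G Ξ b u 0) := by
  have hφ : dualGram G Ξ u 0 0 = hval (G u)⁻¹ (Ξ u 0) := row_mul_apply _ _ _
  have hφ0 : hval (G u)⁻¹ (Ξ u 0) ≠ 0 := (posDef_hval_pos hp.inv h0).ne'
  have hdet : (dualGram G Ξ u).det ≠ 0 := by rwa [Matrix.det_fin_one, hφ]
  rw [curvCoef_inv_dualGram hG hp.det_pos.ne' hΞ hH hdet, contract_complex]
  set K := (G u)⁻¹
  set ξ := Ξ u 0 with hξ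
  set η := covDer G Ξ a u with hη
  set η' := covDer G Ξ b u with hη'
  have e1 : (Ξ u * curvCoef G b a u * K * (Ξ u)ᴴ) 0 0 = hval (curvCoef G b a u * K) ξ := by
    rw [Matrix.mul_assoc (Ξ u), row_mul_apply]; rfl
  have e2 : (η * K * (Ξ u)ᴴ * (dualGram G Ξ u)⁻¹ * Ξ u * K * η'ᴴ) 0 0 =
      (η 0 ⬝ᵥ K *ᵥ star ξ) * (hval K ξ)⁻¹ * (ξ ⬝ᵥ K *ᵥ star (η' 0)) := by
    have : η * K * (Ξ u)ᴴ * (dualGram G Ξ u)⁻¹ * Ξ u * K * η'ᴴ =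
      (η * K * (Ξ u)ᴴ) * (dualGram G Ξ u)⁻¹ * (Ξ u * K * η'ᴴ) := by
      simp only [Matrix.mul_assoc]
    rw [this, Matrix.mul_apply, Fin.sum_univ_one, Matrix.mul_apply, Fin.sum_univ_one,
      row_mul_apply, row_mul_apply, fin_one_inv_apply, hφ]
  rw [Matrix.mul_apply, Fin.sum_univ_one, fin_one_inv_apply, hφ, Matrix.add_apply,
    Matrix.sub_apply, e1, e2, row_mul_apply]
  have e3 : η 0 ⬝ᵥ fsMatrix K ξ *ᵥ star (η' 0) = (η 0 ⬝ᵥ K *ᵥ star (η' 0)) / hval K ξ -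
      (η 0 ⬝ᵥ K *ᵥ star ξ) * (ξ ⬝ᵥ K *ᵥ star (η' 0)) / hval K ξ ^ 2 := by
    have e4 : fsMatrix K ξ *ᵥ star (η' 0) = (hval K ξ)⁻¹ • (K *ᵥ star (η' 0)) -
        ((ξ ⬝ᵥ K *ᵥ star (η' 0)) / hval K ξ ^ 2) • (K *ᵥ star ξ) := by
      ext i
      rw [Matrix.dotProduct_mulVec]
      simp only [Matrix.mulVec, dotProduct, fsMatrix, Matrix.of_apply, sub_mul,
        Finset.sum_sub_distrib, Finset.sum_div, Finset.mul_sum, Pi.sub_apply, Pi.smul_apply,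
        smul_eq_mul, Finset.sum_mul]
      congr 1
      · exact Finset.sum_congr rfl fun j _ => by ring
      · rw [Finset.sum_comm]
        refine Finset.sum_congr rfl fun j _ => Finset.sum_congr rfl fun k _ => ?_
        ring
    rw [e4, dotProduct_sub, dotProduct_smul, dotProduct_smul, smul_eq_mul, smul_eq_mul]
    ring
  rw [e3]
  field_simp
  ring

theorem mD_dz_pullGram_inr {G : (Fin n → ℂ) → Matrix (Fin (s + 1)) (Fin (s + 1)) ℂ}
    {y : Fin n ⊕ Fin s → ℂ} (hG : MatDiffAt G (baseProj n s y)) (k : Fin s) :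
    mD (coeffDz (Sum.inr k)) (pullGram s G) y = 0 := by
  have h := (mD_comp (F := baseProjC n s) hG (baseProjC n s).differentiableAt (Sum.inr k)).1
  rw [ContinuousLinearMap.fderiv] at h
  refine h.trans (Finset.sum_eq_zero fun c _ => ?_)
  simp [baseProjC]

/-- Along the fibre the pulled-back connection vanishes, so the covariant derivative of `(1, w)` is
the ordinary one. This makes the map `P` of `chernCurv_line` the identity on vertical vectors. -/
theorem covDer_inr {G : (Fin n → ℂ) → Matrix (Fin (s + 1)) (Fin (s + 1)) ℂ}
    {y : Fin n ⊕ Fin s → ℂ} (hG : MatDiffAt G (baseProj n s y)) (k : Fin s) :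
    affinePart (fun i => y (Sum.inr i)) (covDer (pullGram s G) (dualRow n s) (Sum.inr k) y 0) =
      Pi.single k 1 := by
  have h1 : ∀ j, covDer (pullGram s G) (dualRow n s) (Sum.inr k) y 0 j =
      coeffDz (Sum.inr k) (fderiv ℝ (fun v => dualRow n s v 0 j) y) := by
    intro j
    rw [covDer, connCoeff_eq, mD_dz_pullGram_inr hG]
    simp [mD]
  ext i
  rw [affinePart, h1, h1]
  have h2 : (fun v => dualRow n s v 0 0) = fun _ => 1 := by ext v; simp [dualRow]
  have h3 : (fun v => dualRow n s v 0 i.succ) =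
    ContinuousLinearMap.proj (R := ℂ) (φ := fun _ : Fin n ⊕ Fin s => ℂ) (Sum.inr i) := by
    ext v; simp [dualRow]
  rw [h2, h3, coeffDz_fderiv_of_holomorphic (ContinuousLinearMap.differentiableAt _),
    ContinuousLinearMap.fderiv]
  simp [Pi.single_apply]

/-- The curvature of the tautological quotient is the sum of the contraction of the curvature
of the bundle and the pull-back of the Fubini–Study form. -/
theorem chernCurv_line {G : (Fin n → ℂ) → Matrix (Fin (s + 1)) (Fin (s + 1)) ℂ}
    {y : Fin n ⊕ Fin s → ℂ} (hG : MSmoothAt G (baseProj n s y))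
    (hp : ∀ᶠ v in 𝓝 (baseProj n s y), (G v).PosDef) :
    ∃ P : (Fin n ⊕ Fin s → ℂ) →L[ℝ] (Fin s → ℂ), (∀ w, P (Sum.elim 0 w) = w) ∧
      chernCurv (fun v => (dualGram (pullGram s G) (dualRow n s) v)⁻¹) y 0 0 =
        pullEven (baseProj n s) (contract (G (baseProj n s y))⁻¹
          (Fin.cons 1 fun i => y (Sum.inr i)) (chernCurv G (baseProj n s y))) +
        pullEven P (fsForm (G (baseProj n s y))⁻¹ fun i => y (Sum.inr i)) := by
  have hG' : MSmoothAt (pullGram s G) y := fun i j =>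
    (hG i j).comp y (baseProj n s).contDiff.contDiffAt
  have hp' : ∀ᶠ v in 𝓝 y, (pullGram s G v).PosDef :=
    (baseProj n s).continuous.continuousAt.eventually hp
  set w : Fin s → ℂ := fun i => y (Sum.inr i) with hw
  set η : Fin n ⊕ Fin s → Fin (s + 1) → ℂ := fun a =>
    covDer (pullGram s G) (dualRow n s) a y 0 with hη
  set K := (G (baseProj n s y))⁻¹ with hK
  have hKp : K.PosDef := hp.self_of_nhds.inv
  have hrow : dualRow n s y 0 = Fin.cons 1 w := rfl
  -- The affine parts of the covariant derivatives of the tautological row assemble into the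
  -- vertical projection whose kernel is the horizontal space of the Chern connection.
  set J : (Fin n ⊕ Fin s → ℂ) →L[ℂ] (Fin s → ℂ) := LinearMap.toContinuousLinearMap
    (Matrix.toLin' (Matrix.of fun i a => affinePart w (η a) i)) with hJ
  have hJs : ∀ a i, J (Pi.single a 1) i = affinePart w (η a) i := by
    intro a i
    simp [hJ]
  refine ⟨J.restrictScalars ℝ, fun w' => ?_, ?_⟩
  · ext i
    have : ∀ k, affinePart w (η (Sum.inr k)) i = if i = k then 1 else 0 := by
      intro k
      have := congrFun (covDer_inr hG.mdiffAt k) i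
      rw [hη, this, Pi.single_apply]
    simp [hJ, Matrix.mulVec, dotProduct, this]
  · have hφ0 : hval K (Fin.cons 1 w) ≠ 0 := (posDef_hval_pos hKp (cons_one_ne_zero w)).ne'
    have hcurv : ∀ b a, curvCoef (fun v => (dualGram (pullGram s G) (dualRow n s) v)⁻¹) b a y 0 0 =
        contract K (Fin.cons 1 w) (curvCoef (pullGram s G) b a y) -
          ∑ i, ∑ j, affinePart w (η a) i * fsMatrix K (Fin.cons 1 w) i.succ j.succ *
            star (affinePart w (η b) j) := by
      intro b a
      rw [curvCoef_line hG' hp'.self_of_nhds (dualRow_mHolAt y) (hp'.mono fun v hv => hv.1)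
        (hrow ▸ cons_one_ne_zero w)]
      exact congrArg₂ _ rfl (sesq_eq_affine (vecMul_fsMatrix hφ0) (fsMatrix_mulVec hφ0) _ _)
    have hpull : (curvE (pullGram s G) y) =
        (curvE G (baseProj n s y)).map (pullEven (baseProj n s)) := by
      have h := curvE_transform (G' := pullGram s G) (g := fun _ => 1) (F := baseProjC n s)
        (u := y) hG hp.self_of_nhds.det_pos.ne' (fun i j => analyticAt_const) (by simp)
        ((baseProjC n s).analyticAt y)
        (Filter.Eventually.of_forall fun v => by
          simp only [Matrix.conjTranspose_one, one_mul, mul_one]; rfl)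
      rw [ContinuousLinearMap.fderiv] at h
      simp only [inv_one, scalarForm, Matrix.map_one _ (map_zero _) (map_one _), one_mul,
        mul_one] at h
      exact h
    have hfirst : pullEven (baseProj n s) (contract K (Fin.cons 1 w)
        (chernCurv G (baseProj n s y))) = (Complex.I / (2 * (Real.pi : ℂ))) •
          ∑ b, ∑ a, contract K (Fin.cons 1 w) (curvCoef (pullGram s G) b a y) •
            wedge (dzbar b) (dz a) := by
      rw [chernCurv, contract_smul, map_smul, map_contract, ← hpull, contract_curvE]
    rw [hfirst, fsForm, map_smul, ← smul_add, chernCurv, Matrix.smul_apply]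
    congr 1
    simp only [curvE, Matrix.of_apply, hcurv, sub_smul, Finset.sum_sub_distrib]
    rw [sub_eq_add_neg]
    congr 1
    simp only [map_sum, map_smul, pullEven_wedge, pullCovec_dz, pullCovec_dzbar, hJs,
      wedge_sum_smul]
    rw [← Finset.sum_neg_distrib]
    simp only [Finset.sum_smul, Finset.smul_sum, ← Finset.sum_neg_distrib]
    rw [Finset.sum_congr rfl fun b _ => Finset.sum_comm, Finset.sum_comm]
    refine Finset.sum_congr rfl fun i _ => ?_
    rw [Finset.sum_congr rfl fun b _ => Finset.sum_comm, Finset.sum_comm]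
    refine Finset.sum_congr rfl fun j _ => ?_
    rw [Finset.sum_comm]
    refine Finset.sum_congr rfl fun a _ => Finset.sum_congr rfl fun b _ => ?_
    -- The minus sign of the second fundamental form is absorbed by reordering `d\bar z ∧ dz` into
    -- `dz ∧ d\bar z`.
    rw [wedge_swap (dzbar b), smul_neg, neg_neg, smul_smul]
    congr 1
    ring

end line

/-! ### The fibre density of the Segre form of the tautological quotient -/

section fibre

variable {n s : ℕ}

/-- Replace the first basis row by `ξ = (1, w)`, a change of determinant one. In the resulting Gram
matrix of `K` the pivot is `φ = ξ K ξ^*`, and its Schur complement is `φ` times the affine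
Fubini–Study matrix, whence `det K = φ · φ^s · det`. -/
theorem det_fsMatrix {K : Matrix (Fin (s + 1)) (Fin (s + 1)) ℂ} {w : Fin s → ℂ}
    (h : hval K (Fin.cons 1 w) ≠ 0) :
    (Matrix.of fun i j : Fin s => fsMatrix K (Fin.cons 1 w) i.succ j.succ).det =
      K.det / hval K (Fin.cons 1 w) ^ (s + 1) := by
  set ξ : Fin (s + 1) → ℂ := Fin.cons 1 w with hξ
  set φ := hval K ξ with hφ
  set T : Matrix (Fin (s + 1)) (Fin (s + 1)) ℂ := Matrix.updateRow 1 0 ξ with hT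
  have hT0 : T 0 = ξ := Matrix.updateRow_self
  have hTs : ∀ i : Fin s, T i.succ = Pi.single i.succ 1 := by
    intro i
    rw [hT, Matrix.updateRow_ne (Fin.succ_ne_zero i)]
    ext j
    rw [Matrix.one_apply, Pi.single_apply]
    simp [eq_comm]
  have hTd : T.det = 1 := by
    rw [Matrix.det_of_isUpperTriangular (fun i j hij => ?_), Fin.prod_univ_succ]
    · rw [hT0]
      simp [hξ, hTs]
    · refine Fin.cases (fun h => ?_) (fun i h => ?_) i hij
      · simp at h
      · rw [hTs]
        exact Pi.single_eq_of_ne (ne_of_lt h) _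
  set N := T * K * Tᴴ with hN
  have hNd : N.det = K.det := by
    rw [hN, Matrix.det_mul, Matrix.det_mul, Matrix.det_conjTranspose, hTd]; simp
  have hNe : ∀ i j, N i j = T i ⬝ᵥ K *ᵥ star (T j) := by
    intro i j
    rw [hN, Matrix.mul_assoc, Matrix.mul_apply, dotProduct]
    exact Finset.sum_congr rfl fun k _ => by
      rw [Matrix.mul_apply, Matrix.mulVec, dotProduct]; rfl
  have hst : ∀ j : Fin s, star (Pi.single j.succ 1 : Fin (s + 1) → ℂ) = Pi.single j.succ 1 := by
    intro j; ext k; by_cases hk : k = j.succ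
    · subst hk; simp
    · simp [hk]
  have h00 : N 0 0 = φ := by rw [hNe, hT0]; rfl
  have h0s : ∀ j : Fin s, N 0 j.succ = (ξ ᵥ* K) j.succ := by
    intro j; rw [hNe, hT0, hTs, hst, Matrix.dotProduct_mulVec]; simp
  have hs0 : ∀ i : Fin s, N i.succ 0 = (K *ᵥ star ξ) i.succ := by
    intro i; rw [hNe, hT0, hTs]; simp
  have hss : ∀ i j : Fin s, N i.succ j.succ = K i.succ j.succ := by
    intro i j; rw [hNe, hTs, hTs, hst]; simp
  -- Gaussian elimination of the first column below the pivot `φ`.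
  set R : Matrix (Fin (s + 1)) (Fin (s + 1)) ℂ := Matrix.of fun i j =>
    N i j + (Fin.cons 0 (fun i : Fin s => -(N i.succ 0 / φ)) : Fin (s + 1) → ℂ) i * N 0 j with hR
  have hRd : R.det = N.det := Matrix.det_eq_of_forall_row_eq_smul_add_const
    (Fin.cons 0 (fun i : Fin s => -(N i.succ 0 / φ))) 0 rfl fun i j => rfl
  have hR0 : R 0 0 = φ := by simp [hR, h00]
  have hRs : ∀ i : Fin s, R i.succ 0 = 0 := by
    intro i
    simp only [hR, Matrix.of_apply, Fin.cons_succ, h00]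
    field_simp
    ring
  have hRm : (R.submatrix (Fin.succAbove 0) Fin.succ) =
      φ • (Matrix.of fun i j : Fin s => fsMatrix K ξ i.succ j.succ) := by
    ext i j
    simp only [hR, Matrix.submatrix_apply, Matrix.of_apply, Fin.zero_succAbove, Fin.cons_succ,
      Matrix.smul_apply, fsMatrix, hss, hs0, h0s, smul_eq_mul]
    rw [← hφ]
    field_simp
    ring
  rw [Matrix.det_succ_column_zero, Fin.sum_univ_succ] at hRd
  simp only [hRs, hR0, hRm, Matrix.det_smul, Fintype.card_fin, mul_zero, zero_mul,
    Finset.sum_const_zero, add_zero, Fin.val_zero, pow_zero, one_mul, hNd] at hRd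
  rw [eq_div_iff (pow_ne_zero _ h), ← hRd]
  ring

/-- The normalization `(-2i)(i / 2π) = 1/π` and `det_fsMatrix` give exactly the density whose
integral is one. -/
theorem topCoeff_fsForm_pow {K : Matrix (Fin (s + 1)) (Fin (s + 1)) ℂ} (hK : K.PosDef)
    (w : Fin s → ℂ) : topCoeff s ((fsForm K w ^ s : EvenForm (Fin s)) : Form (Fin s)) =
      (fsDensity K w : ℂ) := by
  have hφ := posDef_hval_pos hK (cons_one_ne_zero w)
  have hg := topCoeff_pow (Complex.I / (2 * (Real.pi : ℂ)))
    (Matrix.of fun i j : Fin s => fsMatrix K (Fin.cons 1 w) i.succ j.succ)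
  have hpi : (Real.pi : ℂ) ≠ 0 := by exact_mod_cast Real.pi_ne_zero
  simp only [Matrix.of_apply] at hg
  rw [fsForm, hg]
  have h1 : -2 * Complex.I * (Complex.I / (2 * (Real.pi : ℂ))) = 1 / Real.pi := by
    field_simp
    linear_combination (-1 : ℂ) * Complex.I_sq
  have h2 : (Matrix.of fun i j : Fin s => fsMatrix K (Fin.cons 1 w) i.succ j.succ).det = _ :=
    det_fsMatrix hφ.ne'
  rw [h1, h2]
  have h3 : K.det = (K.det.re : ℂ) :=
    Complex.ext rfl (by simpa using (Complex.lt_def.1 hK.det_pos).2.symm)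
  rw [hval_re hK.1, h3, fsDensity]
  push_cast
  rw [one_div, inv_pow]
  ring

theorem evalVec_pow_eq_zero {ι : Type} [Fintype ι] {k l : ℕ} (h : 2 * l ≠ k)
    {x : EvenForm ι} (hx : x ∈ evenTwo ι) (v : Fin k → ι → ℂ) :
    evalVec v ((x ^ l : EvenForm ι) : Form ι) = 0 := by
  have h1 : ((x ^ l : EvenForm ι) : Form ι) ∈
      (LinearMap.range (ExteriorAlgebra.ι ℂ : Covec ι →ₗ[ℂ] _)) ^ (2 * l) := by
    rw [pow_mul, SubmonoidClass.coe_pow]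
    exact Submodule.pow_mem_pow _ (coe_mem_of_mem_evenTwo hx) l
  have h2 := ExteriorAlgebra.ιMulti_span_fixedDegree (R := ℂ) (M := Covec ι) (2 * l)
  have h3 : ((x ^ l : EvenForm ι) : Form ι) ∈
      Submodule.span ℂ (Set.range (ExteriorAlgebra.ιMulti ℂ (2 * l) (M := Covec ι))) := by
    convert! h1
  have h4 : Submodule.span ℂ (Set.range (ExteriorAlgebra.ιMulti ℂ (2 * l) (M := Covec ι))) ≤
      LinearMap.ker (evalVec v) := by
    rw [Submodule.span_le]
    rintro _ ⟨z, rfl⟩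
    exact evalVec_ιMulti_of_ne h v z
  exact h4 h3

/-- The truncation of `(1 + ρ) ^ (-(s + 1))`, where `ρ` is the contraction of `Y` by `ξ`. -/
def segreIntegrand {R : Type*} [CommRing R] [Algebra ℂ R] (n : ℕ)
    (K : Matrix (Fin (s + 1)) (Fin (s + 1)) ℂ) (ξ : Fin (s + 1) → ℂ)
    (Y : Matrix (Fin (s + 1)) (Fin (s + 1)) R) : R :=
  ∑ k ∈ Finset.range (n + 1), ((-1) ^ k * ((k + s).choose s : ℂ)) • contract K ξ Y ^ k

/-- Expand `∑ (-1)^m (ρ + ω)^m` binomially. Evaluation on the full vertical frame kills every power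
of `ω` except `ω^s`, so `m = s + k` contributes `(-1)^{s+k} C(k+s, s) ρ^k`. -/
theorem evalVec_segreForm_line {G : (Fin n → ℂ) → Matrix (Fin (s + 1)) (Fin (s + 1)) ℂ}
    {y : Fin n ⊕ Fin s → ℂ} (hG : MSmoothAt G (baseProj n s y))
    (hp : ∀ᶠ v in 𝓝 (baseProj n s y), (G v).PosDef) {k : ℕ} (v : Fin k → Fin n → ℂ)
    (θ : Form (Fin n)) :
    evalVec (liftFrame s v) (pullForm (baseProj n s) θ *
      segreForm (fun v => (dualGram (pullGram s G) (dualRow n s) v)⁻¹) y) =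
    (-1) ^ s * ((fsDensity (G (baseProj n s y))⁻¹ (fun i => y (Sum.inr i)) : ℂ) *
      evalVec v (θ * (segreIntegrand n (G (baseProj n s y))⁻¹
        (Fin.cons 1 fun i => y (Sum.inr i)) (chernCurv G (baseProj n s y)) : EvenForm (Fin n)))) := by
  obtain ⟨P, hP, hc⟩ := chernCurv_line hG hp
  set K := (G (baseProj n s y))⁻¹ with hK
  set w : Fin s → ℂ := fun i => y (Sum.inr i) with hw
  have hKp : K.PosDef := hp.self_of_nhds.inv
  set ρ := contract K (Fin.cons 1 w) (chernCurv G (baseProj n s y)) with hρ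
  set L : EvenForm (Fin n ⊕ Fin s) →ₗ[ℂ] ℂ := (evalVec (liftFrame s v)).comp
    ((LinearMap.mulLeft ℂ (pullForm (baseProj n s) θ)).comp
      (Subalgebra.val (Algebra.adjoin ℂ (twoProducts (Fin n ⊕ Fin s)))).toLinearMap) with hL
  have hLe : ∀ e : EvenForm (Fin n ⊕ Fin s), L e = evalVec (liftFrame s v)
    (pullForm (baseProj n s) θ * (e : Form (Fin n ⊕ Fin s))) := fun e => rfl
  have hterm : ∀ a b : ℕ, L (pullEven (baseProj n s) ρ ^ a * pullEven P (fsForm K w) ^ b) =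
      if b = s then evalVec v (θ * ((ρ ^ a : EvenForm (Fin n)) : Form (Fin n))) *
        (fsDensity K w : ℂ) else 0 := by
    intro a b
    rw [hLe, ← map_pow, ← map_pow, MulMemClass.coe_mul, ← mul_assoc, coe_pullEven, coe_pullEven,
      ← map_mul, evalVec_liftFrame_mul P hP]
    split_ifs with hb
    · subst hb
      rw [topCoeff_fsForm_pow hKp]
    · rw [topCoeff, evalVec_pow_eq_zero (by omega) (fsForm_mem_evenTwo K w), mul_zero]
  rw [segreForm_line, ← hLe, hc, map_sum, Fintype.card_sum, Fintype.card_fin, Fintype.card_fin]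
  have hpow : ∀ m : ℕ, L ((-(pullEven (baseProj n s) ρ + pullEven P (fsForm K w))) ^ m) =
      if s ≤ m then (-1) ^ m * (m.choose s : ℂ) *
        (evalVec v (θ * ((ρ ^ (m - s) : EvenForm (Fin n)) : Form (Fin n))) *
        (fsDensity K w : ℂ)) else 0 := by
    intro m
    have e : (-(pullEven (baseProj n s) ρ + pullEven P (fsForm K w))) ^ m =
        ((-1 : ℂ) ^ m) • ∑ j ∈ Finset.range (m + 1), (m.choose j : ℂ) •
          (pullEven (baseProj n s) ρ ^ j * pullEven P (fsForm K w) ^ (m - j)) := by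
      rw [neg_pow, add_pow, Algebra.smul_def, map_pow, map_neg, map_one]
      congr 1
      refine Finset.sum_congr rfl fun j _ => ?_
      rw [Algebra.smul_def, map_natCast, mul_comm]
    rw [e, map_smul, map_sum, smul_eq_mul]
    simp only [map_smul, hterm, smul_eq_mul]
    split_ifs with hm
    · rw [Finset.sum_eq_single (m - s)]
      · rw [if_pos (by omega), Nat.choose_symm hm, mul_assoc]
      · intro j hj hne
        rw [Finset.mem_range] at hj
        rw [if_neg (by omega), mul_zero]
      · intro h
        rw [Finset.mem_range] at h
        omega
    · rw [Finset.sum_eq_zero, mul_zero]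
      intro j hj
      rw [if_neg (by omega), mul_zero]
  simp only [hpow]
  -- The powers `m < s` contribute nothing; the truncation at `n + s` upstairs leaves exactly the
  -- range `k ≤ n` on the base.
  rw [show n + s + 1 = s + (n + 1) by ring, Finset.sum_range_add, Finset.sum_eq_zero, zero_add]
  · rw [segreIntegrand]
    simp only [AddSubmonoidClass.coe_finsetSum, SetLike.val_smul, Finset.mul_sum, map_sum,
      mul_smul_comm, map_smul, smul_eq_mul]
    refine Finset.sum_congr rfl fun j _ => ?_
    rw [if_pos (by omega), Nat.add_sub_cancel_left, pow_add, add_comm s j]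
    ring
  · intro m hm
    rw [if_neg (by simpa using hm)]

/-- The fibre integral of the integrand `(1 + ρ) ^ (-(s + 1))` is the total Segre form. -/
theorem integral_segreIntegrand {K : Matrix (Fin (s + 1)) (Fin (s + 1)) ℂ} (hK : K.PosDef)
    (G : (Fin n → ℂ) → Matrix (Fin (s + 1)) (Fin (s + 1)) ℂ) (u : Fin n → ℂ) {k : ℕ}
    (v : Fin k → Fin n → ℂ) (θ : Form (Fin n)) :
    Integrable (fun w : Fin s → ℂ => (fsDensity K w : ℂ) * evalVec v (θ *
      (segreIntegrand n K (Fin.cons 1 w) (chernCurv G u) : EvenForm (Fin n)))) ∧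
    ∫ w : Fin s → ℂ, (fsDensity K w : ℂ) * evalVec v (θ *
      (segreIntegrand n K (Fin.cons 1 w) (chernCurv G u) : EvenForm (Fin n))) =
        evalVec v (θ * segreForm G u) := by
  set L : EvenForm (Fin n) →ₗ[ℂ] ℂ := (evalVec v).comp ((LinearMap.mulLeft ℂ θ).comp
      (Subalgebra.val (Algebra.adjoin ℂ (twoProducts (Fin n)))).toLinearMap) with hL
  have hLe : ∀ e : EvenForm (Fin n), evalVec v (θ * (e : Form (Fin n))) = L e := fun e => rfl
  have e : ∀ w : Fin s → ℂ, (fsDensity K w : ℂ) *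
      L (segreIntegrand n K (Fin.cons 1 w) (chernCurv G u)) =
      ∑ k ∈ Finset.range (n + 1), ((-1) ^ k * ((k + s).choose s : ℂ)) * ((fsDensity K w : ℂ) *
        L (contract K (Fin.cons 1 w) (chernCurv G u) ^ k)) := by
    intro w
    rw [segreIntegrand, map_sum, Finset.mul_sum]
    refine Finset.sum_congr rfl fun k _ => ?_
    rw [map_smul, smul_eq_mul]
    ring
  rw [segreForm_eq hK]
  simp only [hLe, e]
  have hi := fun k => segrePart_eq_integral hK k (chernCurv G u) L
  refine ⟨integrable_finsetSum _ fun k _ => (hi k).1.const_mul _, ?_⟩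
  rw [integral_finsetSum _ fun k _ => (hi k).1.const_mul _, map_sum, Fintype.card_fin]
  refine Finset.sum_congr rfl fun k _ => ?_
  rw [integral_const_mul, (hi k).2]

end fibre

/-! ### The induced metric on the tautological quotient -/

section quotientNorm

variable {n s : ℕ}

theorem mem_span_affine_iff {V : Type*} [AddCommGroup V] [Module ℂ V]
    (b : Module.Basis (Fin (s + 1)) ℂ V) (w : Fin s → ℂ) (v : V) :
    v ∈ Submodule.span ℂ (Set.range fun i : Fin s => b i.succ - w i • b 0) ↔
      (Fin.cons 1 w : Fin (s + 1) → ℂ) ⬝ᵥ b.repr v = 0 := by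
  set ξ : V →ₗ[ℂ] ℂ := b.constr ℂ (Fin.cons 1 w : Fin (s + 1) → ℂ) with hξ
  have h1 : ∀ v, ξ v = (Fin.cons 1 w : Fin (s + 1) → ℂ) ⬝ᵥ b.repr v := by
    intro v
    rw [hξ, Module.Basis.constr_apply_fintype, dotProduct]
    exact Finset.sum_congr rfl fun i _ => by simp [mul_comm]
  rw [← h1]
  constructor
  · intro hv
    have hle : Submodule.span ℂ (Set.range fun i : Fin s => b i.succ - w i • b 0) ≤
        LinearMap.ker ξ := by
      rw [Submodule.span_le]
      have h0 : ξ (b 0) = 1 := by simp [hξ]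
      have hsucc : ∀ i : Fin s, ξ (b i.succ) = w i := by intro i; simp [hξ]
      rintro _ ⟨i, rfl⟩
      simp [h0, hsucc]
    exact hle hv
  · intro hv
    have h2 : v = ξ v • b 0 + ∑ i : Fin s, b.repr v i.succ • (b i.succ - w i • b 0) := by
      conv_lhs => rw [← b.sum_repr v, Fin.sum_univ_succ]
      rw [h1, dotProduct, Fin.sum_univ_succ]
      simp only [smul_sub, Finset.sum_sub_distrib, Fin.cons_zero, Fin.cons_succ, one_mul, add_smul,
        Finset.sum_smul, smul_smul, mul_comm (w _)]
      abel
    rw [h2, hv, zero_smul, zero_add]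
    exact Submodule.sum_mem _ fun i _ => Submodule.smul_mem _ _ (Submodule.subset_span ⟨i, rfl⟩)

/-- The minimum of a positive definite Hermitian form on an affine hyperplane. -/
theorem isLeast_hermitian_hyperplane {m : ℕ} {G : Matrix (Fin m) (Fin m) ℂ} (hG : G.PosDef)
    {ξ : Fin m → ℂ} (hξ : ξ ≠ 0) :
    IsLeast {t : ℝ | ∃ x : Fin m → ℂ, ξ ⬝ᵥ x = 1 ∧ t = (star x ⬝ᵥ G *ᵥ x).re}
      (hval G⁻¹ ξ).re⁻¹ := by
  have hu : IsUnit G.det := isUnit_iff_ne_zero.2 hG.det_pos.ne'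
  set φ := (hval G⁻¹ ξ).re with hφ
  have hφ1 : hval G⁻¹ ξ = (φ : ℂ) := hval_re hG.inv.1 ξ
  have hφ0 : 0 < φ := (Complex.lt_def.1 (posDef_hval_pos hG.inv hξ)).1
  have hφc : (φ : ℂ) ≠ 0 := by exact_mod_cast hφ0.ne'
  -- The point of the affine hyperplane that is `G`-orthogonal to its direction; the excess of any
  -- other value over the minimum is the norm of `x - x₀`.
  set x₀ : Fin m → ℂ := (φ : ℂ)⁻¹ • (G⁻¹ *ᵥ star ξ) with hx₀
  have hx1 : ξ ⬝ᵥ x₀ = 1 := by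
    rw [hx₀, dotProduct_smul]
    change (φ : ℂ)⁻¹ • hval G⁻¹ ξ = 1
    rw [hφ1, smul_eq_mul, inv_mul_cancel₀ hφc]
  have hGx : G *ᵥ x₀ = (φ : ℂ)⁻¹ • star ξ := by
    rw [hx₀, Matrix.mulVec_smul, Matrix.mulVec_mulVec, Matrix.mul_nonsing_inv _ hu,
      Matrix.one_mulVec]
  have hx₀G : ∀ x, ξ ⬝ᵥ x = 1 → star x₀ ⬝ᵥ G *ᵥ x = (φ : ℂ)⁻¹ := by
    intro x hx
    rw [Matrix.dotProduct_mulVec, ← hG.1.eq, ← Matrix.star_mulVec, hGx, star_smul, star_star,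
      smul_dotProduct, hx]
    simp
  have hxG : ∀ x, ξ ⬝ᵥ x = 1 → star x ⬝ᵥ G *ᵥ x₀ = (φ : ℂ)⁻¹ := by
    intro x hx
    rw [hGx, dotProduct_smul, Matrix.star_dotProduct_star, hx]
    simp
  constructor
  · refine ⟨x₀, hx1, ?_⟩
    rw [hx₀G x₀ hx1, ← Complex.ofReal_inv, Complex.ofReal_re]
  · rintro _ ⟨x, hx, rfl⟩
    have h := hG.posSemidef.dotProduct_mulVec_nonneg (x - x₀)
    rw [star_sub, Matrix.mulVec_sub, sub_dotProduct, dotProduct_sub, dotProduct_sub, hxG x hx,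
      hx₀G x hx, hx₀G x₀ hx1] at h
    have h' := (Complex.le_def.1 h).1
    rw [← Complex.ofReal_inv] at h'
    simp only [Complex.zero_re, Complex.sub_re, Complex.ofReal_re] at h'
    linarith

variable {X : Type*} [TopologicalSpace X] [ChartedSpace (Fin n → ℂ) X]
  {E : X → Type*} [TopologicalSpace (TotalSpace (Fin (s + 1) → ℂ) E)]
  [∀ x, AddCommGroup (E x)] [∀ x, Module ℂ (E x)] [∀ x, TopologicalSpace (E x)]
  [FiberBundle (Fin (s + 1) → ℂ) E]
  {H : ∀ x, E x →ₗ⋆[ℂ] E x →ₗ[ℂ] ℂ}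

theorem sesqForm_apply_sum {V : Type*} [AddCommGroup V] [Module ℂ V] {m : ℕ}
    (B : V →ₗ⋆[ℂ] V →ₗ[ℂ] ℂ) (e : Fin m → V) (a b : Fin m → ℂ) :
    B (∑ i, a i • e i) (∑ j, b j • e j) =
      star a ⬝ᵥ (Matrix.of fun i j => B (e i) (e j)) *ᵥ b := by
  simp only [map_sum, LinearMap.sum_apply, map_smulₛₗ, LinearMap.smul_apply, smul_eq_mul,
    dotProduct, Matrix.mulVec, Matrix.of_apply, Finset.mul_sum, Pi.star_apply, RingHom.id_apply]
  rw [Finset.sum_comm]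
  refine Finset.sum_congr rfl fun i _ => Finset.sum_congr rfl fun j _ => ?_
  rw [starRingEnd_apply]
  ring

theorem gram_posDef {U : Set X} (hH : IsHermitianMetricOn (n := n) (s := s) H U)
    (c : FrameChart n s E) {u : Fin n → ℂ} (hu : u ∈ c.chart.target) (hU : c.chart.symm u ∈ U) :
    (gram H c u).PosDef := by
  set b := c.isFrame.toBasisAt (c.chart.map_target hu) with hb
  have hbi : ∀ i, c.frame i (c.chart.symm u) = b i := fun i => by
    rw [hb, IsLocalFrameOn.toBasisAt_coe]
  refine Matrix.PosDef.of_dotProduct_mulVec_pos ?_ fun x hx => ?_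
  · ext i j
    exact hH.conj_symm _ hU _ _
  · have h1 := sesqForm_apply_sum (H (c.chart.symm u)) (fun i => c.frame i (c.chart.symm u)) x x
    change _ = star x ⬝ᵥ gram H c u *ᵥ x at h1
    rw [← h1]
    set v := ∑ i, x i • c.frame i (c.chart.symm u) with hv
    have hv0 : v ≠ 0 := by
      intro h
      apply hx
      have : ∑ i, x i • b i = 0 := by rw [← h, hv]; simp only [hbi]
      exact funext (Fintype.linearIndependent_iff.1 b.linearIndependent x this)
    refine Complex.lt_def.2 ⟨hH.pos _ hU v hv0, ?_⟩
    exact (Complex.conj_eq_iff_im.1 (hH.conj_symm _ hU v v)).symm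

theorem gram_mSmoothAt {U : Set X} (hU : IsOpen U)
    (hH : IsHermitianMetricOn (n := n) (s := s) H U)
    (c : FrameChart n s E) {u : Fin n → ℂ} (hu : u ∈ c.chart.target) (hx : c.chart.symm u ∈ U) :
    MSmoothAt (gram H c) u := fun i j =>
  (hH.smooth c i j).contDiffAt
    ((c.chart.isOpen_inter_preimage_symm hU).mem_nhds ⟨hu, hx⟩)

theorem eventually_gram_posDef {U : Set X} (hU : IsOpen U)
    (hH : IsHermitianMetricOn (n := n) (s := s) H U)
    (c : FrameChart n s E) {u : Fin n → ℂ} (hu : u ∈ c.chart.target) (hx : c.chart.symm u ∈ U) :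
    ∀ᶠ v in 𝓝 u, (gram H c v).PosDef := by
  filter_upwards [(c.chart.isOpen_inter_preimage_symm hU).mem_nhds ⟨hu, hx⟩] with v hv
  exact gram_posDef hH c hv.1 hv.2

/-- In frame coordinates the lifts of the class of `e_0` are the vectors with `ξ ⬝ᵥ x = 1`, so the
quotient norm is the minimum of a positive form on an affine hyperplane. -/
theorem quotNormSq_affinePoint {U : Set X} (hH : IsHermitianMetricOn (n := n) (s := s) H U)
    (c : FrameChart n s E) {u : Fin n → ℂ} (hu : u ∈ c.chart.target) (hx : c.chart.symm u ∈ U)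
    (w : Fin s → ℂ) :
    quotNormSq H (affinePoint c u hu w) (Submodule.Quotient.mk (c.frame 0 (c.chart.symm u))) =
      (hval (gram H c u)⁻¹ (Fin.cons 1 w)).re⁻¹ := by
  set b := c.isFrame.toBasisAt (c.chart.map_target hu) with hb
  have hbi : ∀ i, c.frame i (c.chart.symm u) = b i := fun i => by
    rw [hb, IsLocalFrameOn.toBasisAt_coe]
  rw [quotNormSq, ← (isLeast_hermitian_hyperplane (gram_posDef hH c hu hx)
    (cons_one_ne_zero w)).csInf_eq]
  congr 1
  ext t
  have hmk : ∀ v : E (c.chart.symm u), (affinePoint c u hu w).hyp.mkQ v =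
      Submodule.Quotient.mk (c.frame 0 (c.chart.symm u)) ↔
      (Fin.cons 1 w : Fin (s + 1) → ℂ) ⬝ᵥ b.repr v = 1 := by
    intro v
    refine Iff.trans (Submodule.Quotient.eq (affinePoint c u hu w).hyp) ?_
    change v - _ ∈ Submodule.span ℂ (Set.range fun i : Fin s =>
      c.frame i.succ (c.chart.symm u) - w i • c.frame 0 (c.chart.symm u)) ↔ _
    simp only [hbi]
    rw [mem_span_affine_iff, map_sub, Finsupp.coe_sub, dotProduct_sub, sub_eq_zero]
    simp [dotProduct, Finsupp.single_apply, eq_comm]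
  have hval' : ∀ v : E (c.chart.symm u), H (c.chart.symm u) v v =
      star (b.repr v : Fin (s + 1) → ℂ) ⬝ᵥ gram H c u *ᵥ b.repr v := by
    intro v
    have h1 := sesqForm_apply_sum (H (c.chart.symm u)) (fun i => c.frame i (c.chart.symm u))
      (b.repr v) (b.repr v)
    simp only [hbi, b.sum_repr] at h1
    rw [h1]
    congr 2
    ext i j
    simp [gram, hbi]
  constructor
  · rintro ⟨v, hv, rfl⟩
    exact ⟨b.repr v, (hmk v).1 hv, congrArg Complex.re (hval' v)⟩
  · rintro ⟨x, hx, rfl⟩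
    refine ⟨b.equivFun.symm x, ?_, ?_⟩
    · refine (hmk _).2 ?_
      rw [← Module.Basis.equivFun_apply, LinearEquiv.apply_symm_apply]
      exact hx
    · refine congrArg Complex.re ?_
      refine Eq.trans ?_ (hval' (b.equivFun.symm x)).symm
      rw [← Module.Basis.equivFun_apply, LinearEquiv.apply_symm_apply]

/-- Agreement near `y`, and not merely at `y`, is needed because the Segre form depends on
derivatives of the Gram matrix. -/
theorem lineGram_eventuallyEq {U : Set X} (hU : IsOpen U)
    (hH : IsHermitianMetricOn (n := n) (s := s) H U)
    (c : FrameChart n s E) {y : Fin n ⊕ Fin s → ℂ} (hu : baseProj n s y ∈ c.chart.target)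
    (hx : c.chart.symm (baseProj n s y) ∈ U) :
    lineGram H c =ᶠ[𝓝 y] fun v => (dualGram (pullGram s (gram H c)) (dualRow n s) v)⁻¹ := by
  have h1 := (baseProj n s).continuous.continuousAt.eventually
    ((c.chart.isOpen_inter_preimage_symm hU).mem_nhds ⟨hu, hx⟩)
  filter_upwards [h1] with v hv
  ext i j
  rw [Subsingleton.elim i 0, Subsingleton.elim j 0, fin_one_inv_apply]
  have h2 : dualGram (pullGram s (gram H c)) (dualRow n s) v 0 0 =
      hval (gram H c (baseProj n s v))⁻¹ (Fin.cons 1 fun i => v (Sum.inr i)) := row_mul_apply _ _ _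
  rw [h2, lineGram, Matrix.of_apply, dif_pos hv.1, quotNormSq_affinePoint hH c hv.1 hv.2,
    Complex.ofReal_inv, ← hval_re (gram_posDef hH c hv.1 hv.2).inv.1]

theorem segreForm_congr {ι : Type} [Fintype ι] [DecidableEq ι] {r : ℕ}
    {G G' : (ι → ℂ) → Matrix (Fin r) (Fin r) ℂ} {u : ι → ℂ}
    (h : G =ᶠ[𝓝 u] G') : segreForm G u = segreForm G' u := by
  rw [segreForm, segreForm, chernForm_eq, chernForm_eq, chernCurv_congr h]

/-- The integrand of the fibre integral of `π^* θ ∧ s(𝒪(1), h)`. -/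
theorem evalVec_segreForm_lineGram {U : Set X} (hU : IsOpen U)
    (hH : IsHermitianMetricOn (n := n) (s := s) H U)
    (c : FrameChart n s E) {y : Fin n ⊕ Fin s → ℂ} (hu : baseProj n s y ∈ c.chart.target)
    (hx : c.chart.symm (baseProj n s y) ∈ U) {k : ℕ} (v : Fin k → Fin n → ℂ) (θ : Form (Fin n)) :
    evalVec (liftFrame s v) (pullForm (baseProj n s) θ * segreForm (lineGram H c) y) =
    (-1) ^ s * ((fsDensity (gram H c (baseProj n s y))⁻¹ (fun i => y (Sum.inr i)) : ℂ) *
      evalVec v (θ * (segreIntegrand n (gram H c (baseProj n s y))⁻¹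
        (Fin.cons 1 fun i => y (Sum.inr i)) (chernCurv (gram H c) (baseProj n s y)) :
          EvenForm (Fin n)))) := by
  rw [segreForm_congr (lineGram_eventuallyEq hU hH c hu hx)]
  exact evalVec_segreForm_line (gram_mSmoothAt hU hH c hu hx)
    (eventually_gram_posDef hU hH c hu hx) v θ

theorem isFiberIntegral_segreForm {U : Set X} (hU : IsOpen U)
    (hH : IsHermitianMetricOn (n := n) (s := s) H U)
    (c : FrameChart n s E) {u : Fin n → ℂ} (hu : u ∈ c.chart.target) (hx : c.chart.symm u ∈ U) :
    IsFiberIntegral (segreForm (lineGram H c)) u ((-1 : ℂ) ^ s • segreForm (gram H c) u) := by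
  intro k v
  have hb : ∀ w : Fin s → ℂ, baseProj n s (Sum.elim u w) = u := fun w => rfl
  have e : ∀ w : Fin s → ℂ, evalVec (liftFrame s v) (segreForm (lineGram H c) (Sum.elim u w)) =
      (-1) ^ s * ((fsDensity (gram H c u)⁻¹ w : ℂ) * evalVec v (1 * (segreIntegrand n
        (gram H c u)⁻¹ (Fin.cons 1 w) (chernCurv (gram H c) u) : EvenForm (Fin n)))) := by
    intro w
    have h := evalVec_segreForm_lineGram hU hH c (y := Sum.elim u w) hu hx v 1
    rw [map_one, one_mul] at h
    exact h
  obtain ⟨h1, h2⟩ := integral_segreIntegrand (gram_posDef hH c hu hx).inv (gram H c) u v 1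
  simp only [e]
  refine ⟨h1.const_mul _, ?_⟩
  rw [integral_const_mul, h2, one_mul, map_smul, smul_eq_mul]

end quotientNorm

/-! ### Changes of charts and frames -/

section change

variable {n s : ℕ} {X : Type*} [TopologicalSpace X] [ChartedSpace (Fin n → ℂ) X]

/-- The change of coordinates between two charts. -/
def transition (φ φ' : OpenPartialHomeomorph X (Fin n → ℂ)) (u : Fin n → ℂ) : Fin n → ℂ :=
  φ' (φ.symm u)

theorem transition_analyticAt [IsManifold 𝓘(ℂ, Fin n → ℂ) ω X]
    {φ φ' : OpenPartialHomeomorph X (Fin n → ℂ)} (hφ : IsHolChart n φ)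
    (hφ' : IsHolChart n φ') {u : Fin n → ℂ} (hu : u ∈ φ.target) (hx : φ.symm u ∈ φ'.source) :
    AnalyticAt ℂ (transition φ φ') u := by
  have h1 := contMDiffAt_symm_of_mem_maximalAtlas hφ hu
  have h2 := contMDiffAt_of_mem_maximalAtlas hφ' hx
  exact (contMDiffAt_iff_contDiffAt.1 (h2.comp u h1)).analyticAt

/-- `localForm` uses real derivatives although `X` is only given a holomorphic structure; read in
the preferred chart, the inverse chart is an analytic transition map. -/
theorem mdifferentiableAt_real_symm [IsManifold 𝓘(ℂ, Fin n → ℂ) ω X]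
    {φ : OpenPartialHomeomorph X (Fin n → ℂ)} (hφ : IsHolChart n φ) {u : Fin n → ℂ}
    (hu : u ∈ φ.target) :
    MDifferentiableAt 𝓘(ℝ, Fin n → ℂ) 𝓘(ℝ, Fin n → ℂ) φ.symm u := by
  rw [mdifferentiableAt_iff_target]
  refine ⟨φ.continuousAt_symm hu, ?_⟩
  have h := transition_analyticAt hφ (IsManifold.chart_mem_maximalAtlas (φ.symm u)) hu
    (mem_chart_source _ _)
  exact (h.differentiableAt.restrictScalars ℝ).mdifferentiableAt

theorem eventually_symm_transition {φ φ' : OpenPartialHomeomorph X (Fin n → ℂ)}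
    {u : Fin n → ℂ} (hu : u ∈ φ.target) (hx : φ.symm u ∈ φ'.source) :
    ∀ᶠ v in 𝓝 u, φ'.symm (transition φ φ' v) = φ.symm v := by
  filter_upwards [(φ.continuousAt_symm hu).eventually (φ'.open_source.mem_nhds hx)] with v hv
  exact φ'.left_inv hv

/-- Transformation of the local expression of a form under a change of charts. -/
theorem localForm_transition [IsManifold 𝓘(ℂ, Fin n → ℂ) ω X]
    {φ φ' : OpenPartialHomeomorph X (Fin n → ℂ)} (hφ : IsHolChart n φ)
    (hφ' : IsHolChart n φ') {u : Fin n → ℂ} (hu : u ∈ φ.target) (hx : φ.symm u ∈ φ'.source)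
    (f : X → Form (Fin n)) :
    localForm f φ u = pullForm ((fderiv ℂ (transition φ φ') u).restrictScalars ℝ)
      (localForm f φ' (transition φ φ' u)) := by
  have hF := (transition_analyticAt hφ hφ' hu hx).differentiableAt
  have ht : transition φ φ' u ∈ φ'.target := φ'.map_source hx
  have hd : mfderiv 𝓘(ℝ, Fin n → ℂ) 𝓘(ℝ, Fin n → ℂ) φ.symm u =
      (mfderiv 𝓘(ℝ, Fin n → ℂ) 𝓘(ℝ, Fin n → ℂ) φ'.symm (transition φ φ' u)).comp
        (mfderiv 𝓘(ℝ, Fin n → ℂ) 𝓘(ℝ, Fin n → ℂ) (transition φ φ') u) := by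
    rw [← mfderiv_comp u (mdifferentiableAt_real_symm hφ' ht)
      (hF.restrictScalars ℝ).mdifferentiableAt]
    refine Filter.EventuallyEq.mfderiv_eq ?_
    filter_upwards [eventually_symm_transition hu hx] with v hv using hv.symm
  have hd2 : mfderiv 𝓘(ℝ, Fin n → ℂ) 𝓘(ℝ, Fin n → ℂ) (transition φ φ') u =
      (fderiv ℂ (transition φ φ') u).restrictScalars ℝ := by
    rw [mfderiv_eq_fderiv]
    exact hF.fderiv_restrictScalars ℝ
  have hsymm : φ'.symm (transition φ φ' u) = φ.symm u := φ'.left_inv hx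
  have hcomp : ∀ (A B C : (Fin n → ℂ) →L[ℝ] (Fin n → ℂ)) (θ θ' : Form (Fin n)),
      C = A.comp B → θ = θ' → pullForm C θ = pullForm B (pullForm A θ') := by
    rintro A B _ θ _ rfl rfl
    rw [pullForm, pullForm, pullForm, ← AlgHom.comp_apply, ExteriorAlgebra.map_comp_map]
    rfl
  rw [hd2] at hd
  exact hcomp _ _ _ _ _ hd (by rw [hsymm])

variable {E : X → Type*} [TopologicalSpace (TotalSpace (Fin (s + 1) → ℂ) E)]
  [∀ x, AddCommGroup (E x)] [∀ x, Module ℂ (E x)] [∀ x, TopologicalSpace (E x)]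
  [FiberBundle (Fin (s + 1) → ℂ) E] [VectorBundle ℂ (Fin (s + 1) → ℂ) E]

/-- The coordinates of a frame in a trivialization. -/
def frameMatrix (e : Trivialization (Fin (s + 1) → ℂ)
    (TotalSpace.proj : TotalSpace (Fin (s + 1) → ℂ) E → X)) (c : FrameChart n s E) (x : X) :
    Matrix (Fin (s + 1)) (Fin (s + 1)) ℂ := Matrix.of fun i j => (e ⟨x, c.frame j x⟩).2 i

omit [VectorBundle ℂ (Fin (s + 1) → ℂ) E] in
theorem linearEquivAt_frame (e : Trivialization (Fin (s + 1) → ℂ)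
    (TotalSpace.proj : TotalSpace (Fin (s + 1) → ℂ) E → X)) [e.IsLinear ℂ]
    (c : FrameChart n s E) {x : X}
    (he : x ∈ e.baseSet) (j : Fin (s + 1)) :
    e.linearEquivAt ℂ x he (c.frame j x) = fun i => frameMatrix e c x i j := rfl

omit [VectorBundle ℂ (Fin (s + 1) → ℂ) E] in
theorem frameMatrix_det_ne_zero (e : Trivialization (Fin (s + 1) → ℂ)
    (TotalSpace.proj : TotalSpace (Fin (s + 1) → ℂ) E → X)) [e.IsLinear ℂ]
    (c : FrameChart n s E) {x : X}
    (he : x ∈ e.baseSet) (hx : x ∈ c.chart.source) : (frameMatrix e c x).det ≠ 0 := by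
  have h1 := (c.isFrame.linearIndependent hx).map' (e.linearEquivAt ℂ x he).toLinearMap
    (LinearEquiv.ker _)
  have h2 : LinearIndependent ℂ (frameMatrix e c x).col := h1
  exact ((Matrix.isUnit_iff_isUnit_det _).1
    (Matrix.linearIndependent_cols_iff_isUnit.1 h2)).ne_zero

theorem frameMatrix_analyticAt [ContMDiffVectorBundle ω (Fin (s + 1) → ℂ) E 𝓘(ℂ, Fin n → ℂ)]
    (e : Trivialization (Fin (s + 1) → ℂ)
    (TotalSpace.proj : TotalSpace (Fin (s + 1) → ℂ) E → X)) [MemTrivializationAtlas e]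
    (c : FrameChart n s E) {φ : OpenPartialHomeomorph X (Fin n → ℂ)}
    (hφ : φ ∈ IsManifold.maximalAtlas 𝓘(ℂ, Fin n → ℂ) ω X) {u : Fin n → ℂ} (hu : u ∈ φ.target)
    (he : φ.symm u ∈ e.baseSet) (hx : φ.symm u ∈ c.chart.source) :
    MHolAt (fun v => frameMatrix e c (φ.symm v)) u := by
  intro i j
  have h1 : ContMDiffAt 𝓘(ℂ, Fin n → ℂ) (𝓘(ℂ, Fin n → ℂ).prod 𝓘(ℂ, Fin (s + 1) → ℂ)) ω
      (fun x => TotalSpace.mk' (Fin (s + 1) → ℂ) x (c.frame j x)) (φ.symm u) :=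
    (c.isFrame.contMDiffOn j).contMDiffAt (c.chart.open_source.mem_nhds hx)
  have h2 := (e.contMDiffAt_section_iff he).1 h1
  have h3 := contMDiffAt_iff_contDiffAt.1 (h2.comp u (contMDiffAt_symm_of_mem_maximalAtlas hφ hu))
  exact (contDiffAt_pi.1 h3 i).analyticAt

/-- Holomorphic transition matrices between frames. -/
theorem exists_frame_change [ContMDiffVectorBundle ω (Fin (s + 1) → ℂ) E 𝓘(ℂ, Fin n → ℂ)]
    (c c' : FrameChart n s E) {u : Fin n → ℂ} (hu : u ∈ c.chart.target)
    (hx : c.chart.symm u ∈ c'.chart.source) :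
    ∃ g : (Fin n → ℂ) → Matrix (Fin (s + 1)) (Fin (s + 1)) ℂ, MHolAt g u ∧ (g u).det ≠ 0 ∧
      ∀ H : ∀ x, E x →ₗ⋆[ℂ] E x →ₗ[ℂ] ℂ, gram H c =ᶠ[𝓝 u]
        fun v => (g v)ᴴ * gram H c' (transition c.chart c'.chart v) * g v := by
  set e := trivializationAt (Fin (s + 1) → ℂ) E (c.chart.symm u) with he
  have heu : c.chart.symm u ∈ e.baseSet := FiberBundle.mem_baseSet_trivializationAt' _
  have hxs : c.chart.symm u ∈ c.chart.source := c.chart.map_target hu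
  have hM := frameMatrix_analyticAt e c c.isHolChart hu heu hxs
  have hM' := frameMatrix_analyticAt e c' c.isHolChart hu heu hx
  have hd := frameMatrix_det_ne_zero e c heu hxs
  have hd' := frameMatrix_det_ne_zero e c' heu hx
  -- Both frames are holomorphic invertible matrices in a common trivialization, and the transition
  -- matrix is their quotient.
  refine ⟨fun v => (frameMatrix e c' (c.chart.symm v))⁻¹ * frameMatrix e c (c.chart.symm v),
    ?_, ?_, fun H => ?_⟩
  · intro i j
    simp only [Matrix.mul_apply]
    exact Finset.analyticAt_fun_sum _ fun k _ => ((hM'.inv hd') i k).mul (hM k j)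
  · rw [Matrix.det_mul]
    refine mul_ne_zero ?_ hd
    exact ((Matrix.isUnit_nonsing_inv_det_iff).2 (isUnit_iff_ne_zero.2 hd')).ne_zero
  · have hcont := c.chart.continuousAt_symm hu
    filter_upwards [c.chart.open_target.mem_nhds hu, hcont.eventually
      (c'.chart.open_source.mem_nhds hx), hcont.eventually (e.open_baseSet.mem_nhds heu)]
      with v h1 h2 h3
    set x := c.chart.symm v with hxv
    have h2' : x ∈ c'.chart.source := h2
    have hu' : IsUnit (frameMatrix e c' x).det :=
      isUnit_iff_ne_zero.2 (frameMatrix_det_ne_zero e c' h3 h2)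
    set g := (frameMatrix e c' x)⁻¹ * frameMatrix e c x with hg
    have hfr : ∀ j, c.frame j x = ∑ i, g i j • c'.frame i x := by
      intro j
      apply (e.linearEquivAt ℂ x h3).injective
      rw [map_sum]
      simp only [map_smul, linearEquivAt_frame]
      ext k
      have h4 : (frameMatrix e c' x * g) k j = frameMatrix e c x k j := by
        rw [hg, Matrix.mul_nonsing_inv_cancel_left _ _ hu']
      rw [← h4, Matrix.mul_apply, Finset.sum_apply]
      exact Finset.sum_congr rfl fun i _ => mul_comm _ _
    have hsymm : c'.chart.symm (transition c.chart c'.chart v) = x := c'.chart.left_inv h2'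
    have hG : gram H c' (transition c.chart c'.chart v) =
        Matrix.of fun i j => H x (c'.frame i x) (c'.frame j x) := by
      unfold gram
      rw [hsymm]
    ext i j
    rw [hG]
    change H x (c.frame i x) (c.frame j x) = _
    rw [hfr i, hfr j, sesqForm_apply_sum, Matrix.mul_assoc, Matrix.mul_apply, dotProduct]
    exact Finset.sum_congr rfl fun k _ => by rw [Matrix.mul_apply]; rfl

theorem chernCurv_transform {ι κ : Type} [Fintype ι] [Fintype κ] [DecidableEq ι] [DecidableEq κ]
    {r : ℕ} {G : (κ → ℂ) → Matrix (Fin r) (Fin r) ℂ}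
    {G' g : (ι → ℂ) → Matrix (Fin r) (Fin r) ℂ} {F : (ι → ℂ) → κ → ℂ} {u : ι → ℂ}
    (hG : MSmoothAt G (F u)) (hd : (G (F u)).det ≠ 0) (hg : MHolAt g u) (hgd : (g u).det ≠ 0)
    (hF : AnalyticAt ℂ F u) (h : G' =ᶠ[𝓝 u] fun v => (g v)ᴴ * G (F v) * g v) :
    chernCurv G' u = scalarForm ι (g u)⁻¹ *
      (chernCurv G (F u)).map (pullEven ((fderiv ℂ F u).restrictScalars ℝ)) *
        scalarForm ι (g u) := by
  rw [chernCurv, curvE_transform hG hd hg hgd hF h, chernCurv]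
  have : ((Complex.I / (2 * (Real.pi : ℂ))) • curvE G (F u)).map
      (pullEven ((fderiv ℂ F u).restrictScalars ℝ)) = (Complex.I / (2 * (Real.pi : ℂ))) •
        (curvE G (F u)).map (pullEven ((fderiv ℂ F u).restrictScalars ℝ)) := by
    ext1 i j
    simp
  rw [this, Matrix.mul_smul, Matrix.smul_mul]

/-- Invariance of the total Segre form under holomorphic maps and changes of frame. -/
theorem segreForm_transform {ι κ : Type} [Fintype ι] [Fintype κ] [DecidableEq ι] [DecidableEq κ]
    {G : (κ → ℂ) → Matrix (Fin (s + 1)) (Fin (s + 1)) ℂ}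
    {G' g : (ι → ℂ) → Matrix (Fin (s + 1)) (Fin (s + 1)) ℂ} {F : (ι → ℂ) → κ → ℂ} {u : ι → ℂ}
    (hG : MSmoothAt G (F u)) (hd : (G (F u)).det ≠ 0) (hg : MHolAt g u) (hgd : (g u).det ≠ 0)
    (hF : AnalyticAt ℂ F u) (h : G' =ᶠ[𝓝 u] fun v => (g v)ᴴ * G (F v) * g v) :
    segreForm G' u =
      pullForm ((fderiv ℂ F u).restrictScalars ℝ) (segreForm G (F u)) := by
  set A := (fderiv ℂ F u).restrictScalars ℝ with hA
  have hu : IsUnit (g u).det := isUnit_iff_ne_zero.2 hgd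
  -- Any positive definite `K` would do: this only exhibits an inverse of the Chern form among even
  -- forms, which pull-back then preserves.
  have h1 := det_mul_sum_segrePart (K := (1 : Matrix (Fin (s + 1)) (Fin (s + 1)) ℂ))
    Matrix.PosDef.one (chernCurv G (F u)) (Fintype.card κ) fun k hk =>
      segrePart_eq_zero _ (chernCurv_mem_evenTwo G (F u)) hk
  set y := ∑ k ∈ Finset.range (Fintype.card κ + 1), segrePart
    (1 : Matrix (Fin (s + 1)) (Fin (s + 1)) ℂ) k (chernCurv G (F u))
  have hsi : scalarForm ι (g u)⁻¹ * scalarForm ι (g u) = 1 := by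
    rw [scalarForm, scalarForm, ← Matrix.map_mul, Matrix.nonsing_inv_mul _ hu,
      Matrix.map_one _ (map_zero _) (map_one _)]
  have hdet : (1 + chernCurv G' u).det = pullEven A (1 + chernCurv G (F u)).det := by
    have h2 : 1 + chernCurv G' u = scalarForm ι (g u)⁻¹ *
        (1 + (chernCurv G (F u)).map (pullEven A)) * scalarForm ι (g u) := by
      rw [mul_add, add_mul, mul_one, hsi,
        chernCurv_transform hG hd hg hgd hF h]
    have h3 : (1 + (chernCurv G (F u)).map (pullEven A)) =
        (1 + chernCurv G (F u)).map (pullEven A) := by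
      rw [Matrix.map_add _ (map_add _), Matrix.map_one _ (map_zero _) (map_one _)]
    rw [h2, Matrix.det_mul, Matrix.det_mul, mul_right_comm, ← Matrix.det_mul, hsi, Matrix.det_one,
      one_mul, h3, ← AlgHom.mapMatrix_apply, ← AlgHom.map_det]
  have h4 : (1 + chernCurv G' u).det * pullEven A y = 1 := by
    rw [hdet, ← map_mul, h1, map_one]
  rw [segreForm, segreForm, chernForm_eq, chernForm_eq, ringInverse_coe_of_mul_eq_one h1,
    ringInverse_coe_of_mul_eq_one h4, coe_pullEven]

end change

/-! ### Transformation of densities -/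

section densities

variable {n s : ℕ}

theorem hval_transform {m : ℕ} {K K' g : Matrix (Fin m) (Fin m) ℂ} (h : g * K * gᴴ = K')
    (ξ : Fin m → ℂ) : hval K (ξ ᵥ* g) = hval K' ξ := by
  rw [hval, hval, Matrix.star_vecMul, Matrix.mulVec_mulVec, ← Matrix.dotProduct_mulVec,
    Matrix.mulVec_mulVec, ← mul_assoc, h]

theorem ratio_transform {m : ℕ} {K K' g : Matrix (Fin m) (Fin m) ℂ} (h : g * K * gᴴ = K')
    (ξ : Fin m → ℂ) (i l : Fin m) :
    ∑ j, g l j * ratio K (ξ ᵥ* g) i j = (ξ ᵥ* g) i * (K' *ᵥ star ξ) l / hval K' ξ := by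
  simp only [ratio, hval_transform h]
  have h1 : (K' *ᵥ star ξ) l = ∑ j, g l j * (K *ᵥ star (ξ ᵥ* g)) j := by
    rw [← h, Matrix.star_vecMul, Matrix.mulVec_mulVec, mul_assoc, ← Matrix.mulVec_mulVec]
    rfl
  rw [h1, Finset.mul_sum, Finset.sum_div]
  exact Finset.sum_congr rfl fun j _ => by ring

/-- The contraction `ρ` is intrinsic: conjugating the curvature, changing the dual metric and
changing the coordinates of the functional cancel. -/
theorem contract_transform {ι : Type} [Fintype ι] {m : ℕ} {K K' g : Matrix (Fin m) (Fin m) ℂ}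
    (hg : g.det ≠ 0) (h : g * K * gᴴ = K') (ξ : Fin m → ℂ)
    (Y : Matrix (Fin m) (Fin m) (EvenForm ι)) :
    contract K (ξ ᵥ* g) (scalarForm ι g⁻¹ * Y * scalarForm ι g) = contract K' ξ Y := by
  have hu : IsUnit g.det := isUnit_iff_ne_zero.2 hg
  have hgg : ∀ k, ∑ i, (ξ ᵥ* g) i * g⁻¹ i k = ξ k := by
    intro k
    have : (ξ ᵥ* g) ᵥ* g⁻¹ = ξ := by
      rw [Matrix.vecMul_vecMul, Matrix.mul_nonsing_inv _ hu, Matrix.vecMul_one]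
    exact congrFun this k
  simp only [contract, Fintype.sum_prod_type, mul_scalarForm_apply, scalarForm_mul_apply,
    Finset.smul_sum, smul_smul]
  have e : ∀ k l, ratio K' ξ k l = ∑ i, ∑ j, ratio K (ξ ᵥ* g) i j * (g l j * g⁻¹ i k) := by
    intro k l
    have : ∀ i, ∑ j, ratio K (ξ ᵥ* g) i j * (g l j * g⁻¹ i k) =
        ((ξ ᵥ* g) i * g⁻¹ i k) * ((K' *ᵥ star ξ) l / hval K' ξ) := by
      intro i
      rw [mul_right_comm, ← mul_div_assoc, ← ratio_transform h, Finset.sum_mul]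
      exact Finset.sum_congr rfl fun j _ => by ring
    rw [Finset.sum_congr rfl fun i _ => this i, ← Finset.sum_mul, hgg, ratio, mul_div_assoc]
  simp only [e, Finset.sum_smul]
  have comm4 : ∀ f : Fin m → Fin m → Fin m → Fin m → EvenForm ι,
      ∑ i, ∑ j, ∑ l, ∑ k, f i j k l = ∑ k, ∑ l, ∑ i, ∑ j, f i j k l := by
    intro f
    calc ∑ i, ∑ j, ∑ l, ∑ k, f i j k l = ∑ i, ∑ l, ∑ j, ∑ k, f i j k l :=
          Finset.sum_congr rfl fun i _ => Finset.sum_comm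
      _ = ∑ l, ∑ i, ∑ j, ∑ k, f i j k l := Finset.sum_comm
      _ = ∑ l, ∑ i, ∑ k, ∑ j, f i j k l :=
          Finset.sum_congr rfl fun l _ => Finset.sum_congr rfl fun i _ => Finset.sum_comm
      _ = ∑ l, ∑ k, ∑ i, ∑ j, f i j k l :=
          Finset.sum_congr rfl fun l _ => Finset.sum_comm
      _ = ∑ k, ∑ l, ∑ i, ∑ j, f i j k l := Finset.sum_comm
  exact comm4 fun i j k l => (ratio K (ξ ᵥ* g) i j * (g l j * g⁻¹ i k)) • Y k l

/-- The density of `θ ∧ (1 + ρ_ξ) ^ (-(s + 1))`. -/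
def segreDensity (θ : Form (Fin n)) (M : Matrix (Fin (s + 1)) (Fin (s + 1)) ℂ)
    (Y : Matrix (Fin (s + 1)) (Fin (s + 1)) (EvenForm (Fin n))) (ξ : Fin (s + 1) → ℂ) : ℂ :=
  topCoeff n (θ * (segreIntegrand n M⁻¹ ξ Y : EvenForm (Fin n)))

theorem map_segreIntegrand {R S : Type*} [CommRing R] [Algebra ℂ R] [CommRing S] [Algebra ℂ S]
    (f : R →ₐ[ℂ] S) (K : Matrix (Fin (s + 1)) (Fin (s + 1)) ℂ) (ξ : Fin (s + 1) → ℂ)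
    (Y : Matrix (Fin (s + 1)) (Fin (s + 1)) R) :
    f (segreIntegrand n K ξ Y) = segreIntegrand n K ξ (Y.map f) := by
  simp [segreIntegrand, map_contract]

theorem segreDensity_transform {G G' g : (Fin n → ℂ) → Matrix (Fin (s + 1)) (Fin (s + 1)) ℂ}
    {F : (Fin n → ℂ) → Fin n → ℂ} {u : Fin n → ℂ}
    (hG : MSmoothAt G (F u)) (hd : (G (F u)).det ≠ 0) (hg : MHolAt g u) (hgd : (g u).det ≠ 0)
    (hF : AnalyticAt ℂ F u) (h : G' =ᶠ[𝓝 u] fun v => (g v)ᴴ * G (F v) * g v)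
    {θ θ' : Form (Fin n)} (hθ : θ = pullForm ((fderiv ℂ F u).restrictScalars ℝ) θ')
    (ξ : Fin (s + 1) → ℂ) :
    segreDensity θ (G' u) (chernCurv G' u) (ξ ᵥ* g u) =
      (((fderiv ℂ F u).restrictScalars ℝ).det : ℂ) *
        segreDensity θ' (G (F u)) (chernCurv G (F u)) ξ := by
  have hu : IsUnit (g u).det := isUnit_iff_ne_zero.2 hgd
  have hu2 : IsUnit ((g u)ᴴ).det := by rw [Matrix.det_conjTranspose]; exact hu.star
  have hK : g u * (G' u)⁻¹ * (g u)ᴴ = (G (F u))⁻¹ := by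
    rw [h.eq_of_nhds, Matrix.mul_inv_rev, Matrix.mul_inv_rev, ← mul_assoc, ← mul_assoc,
      Matrix.mul_nonsing_inv _ hu, one_mul, mul_assoc, Matrix.nonsing_inv_mul _ hu2, mul_one]
  have hQ : segreIntegrand n (G' u)⁻¹ (ξ ᵥ* g u) (chernCurv G' u) =
      pullEven ((fderiv ℂ F u).restrictScalars ℝ)
        (segreIntegrand n (G (F u))⁻¹ ξ (chernCurv G (F u))) := by
    rw [map_segreIntegrand, chernCurv_transform hG hd hg hgd hF h]
    simp only [segreIntegrand, contract_transform hgd hK]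
  rw [segreDensity, hQ, hθ, coe_pullEven, ← map_mul, topCoeff_pullForm]
  rfl

theorem det_restrictScalars_nonneg (A : (Fin n → ℂ) →L[ℂ] (Fin n → ℂ)) :
    0 ≤ (A.restrictScalars ℝ).det := by
  have h := det_restrictScalars_complex (A : (Fin n → ℂ) →ₗ[ℂ] (Fin n → ℂ))
  have h2 : (A.restrictScalars ℝ).det =
    ((A : (Fin n → ℂ) →ₗ[ℂ] (Fin n → ℂ)).restrictScalars ℝ).det := rfl
  rw [h2, h]
  positivity

theorem segreDensity_smul {θ : Form (Fin n)} {M : Matrix (Fin (s + 1)) (Fin (s + 1)) ℂ}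
    {Y : Matrix (Fin (s + 1)) (Fin (s + 1)) (EvenForm (Fin n))} {c : ℂ} (hc : c ≠ 0)
    (ξ : Fin (s + 1) → ℂ) : segreDensity θ M Y (c • ξ) = segreDensity θ M Y ξ := by
  simp only [segreDensity, segreIntegrand, contract, ratio_smul _ hc]

/-- The supremum over the fibre of the absolute values of the densities. -/
def supDensity (θ : Form (Fin n)) (M : Matrix (Fin (s + 1)) (Fin (s + 1)) ℂ)
    (Y : Matrix (Fin (s + 1)) (Fin (s + 1)) (EvenForm (Fin n))) : ENNReal :=
  ⨆ (ξ : Fin (s + 1) → ℂ) (_ : ξ ≠ 0), ‖segreDensity θ M Y ξ‖ₑ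

theorem vecMul_ne_zero {m : ℕ} {g : Matrix (Fin m) (Fin m) ℂ} (hg : g.det ≠ 0) {ξ : Fin m → ℂ}
    (hξ : ξ ≠ 0) : ξ ᵥ* g ≠ 0 := fun h => by
  apply hξ
  have hu : IsUnit g.det := isUnit_iff_ne_zero.2 hg
  rw [← Matrix.vecMul_one ξ, ← Matrix.mul_nonsing_inv _ hu, ← Matrix.vecMul_vecMul, h,
    Matrix.zero_vecMul]

/-- A change of frame permutes the nonzero `ξ`, so only the Jacobian survives; this is why the
supremum is not restricted to one affine chart. Allowing any analytic `F` covers chart transitions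
and the branched cover alike. -/
theorem supDensity_transform {G G' g : (Fin n → ℂ) → Matrix (Fin (s + 1)) (Fin (s + 1)) ℂ}
    {F : (Fin n → ℂ) → Fin n → ℂ} {u : Fin n → ℂ}
    (hG : MSmoothAt G (F u)) (hd : (G (F u)).det ≠ 0) (hg : MHolAt g u) (hgd : (g u).det ≠ 0)
    (hF : AnalyticAt ℂ F u) (h : G' =ᶠ[𝓝 u] fun v => (g v)ᴴ * G (F v) * g v)
    {θ θ' : Form (Fin n)} (hθ : θ = pullForm ((fderiv ℂ F u).restrictScalars ℝ) θ') :
    ENNReal.ofReal |((fderiv ℂ F u).restrictScalars ℝ).det| *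
      supDensity θ' (G (F u)) (chernCurv G (F u)) = supDensity θ (G' u) (chernCurv G' u) := by
  have key : ∀ ξ, ‖segreDensity θ (G' u) (chernCurv G' u) (ξ ᵥ* g u)‖ₑ =
      ENNReal.ofReal |((fderiv ℂ F u).restrictScalars ℝ).det| *
        ‖segreDensity θ' (G (F u)) (chernCurv G (F u)) ξ‖ₑ := by
    intro ξ
    rw [segreDensity_transform hG hd hg hgd hF h hθ, enorm_mul]
    congr 1
    rw [← ofReal_norm, Complex.norm_real, Real.norm_eq_abs]
  have hu : IsUnit (g u).det := isUnit_iff_ne_zero.2 hgd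
  rw [supDensity, supDensity, ENNReal.mul_iSup]
  simp only [ENNReal.mul_iSup]
  refine le_antisymm (iSup₂_le fun ξ hξ => ?_) (iSup₂_le fun ξ hξ => ?_)
  · rw [← key]
    exact le_iSup₂_of_le (ξ ᵥ* g u) (vecMul_ne_zero hgd hξ) le_rfl
  · have e : ξ = (ξ ᵥ* (g u)⁻¹) ᵥ* g u := by
      rw [Matrix.vecMul_vecMul, Matrix.nonsing_inv_mul _ hu, Matrix.vecMul_one]
    have hinv : ((g u)⁻¹).det ≠ 0 :=
      ((Matrix.isUnit_nonsing_inv_det_iff).2 hu).ne_zero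
    refine le_iSup₂_of_le (ξ ᵥ* (g u)⁻¹) (vecMul_ne_zero hinv hξ) ?_
    rw [← key, ← e]

end densities

/-! ### Continuity of form-valued functions -/

section weak

variable {ι κ : Type} [Fintype ι] [Fintype κ] {V : Type*} [TopologicalSpace V] {S : Set V}

/-- Continuity of all coefficients of a form-valued function. -/
def FormContinuousOn (g : V → Form ι) (S : Set V) : Prop :=
  ∀ l : Form ι →ₗ[ℂ] ℂ, ContinuousOn (fun v => l (g v)) S

theorem FormContinuousOn.const (x : Form ι) : FormContinuousOn (fun _ : V => x) S :=
  fun _ => continuousOn_const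

theorem FormContinuousOn.smul {c : V → ℂ} {g : V → Form ι} (hc : ContinuousOn c S)
    (hg : FormContinuousOn g S) : FormContinuousOn (fun v => c v • g v) S := fun l => by
  simp only [map_smul, smul_eq_mul]
  exact hc.mul (hg l)

theorem FormContinuousOn.sum {α : Type*} (t : Finset α) {g : α → V → Form ι}
    (hg : ∀ a ∈ t, FormContinuousOn (g a) S) : FormContinuousOn (fun v => ∑ a ∈ t, g a v) S :=
  fun l => by
    simp only [map_sum]
    exact continuousOn_finsetSum _ fun a ha => hg a ha l

theorem FormContinuousOn.add {g h : V → Form ι} (hg : FormContinuousOn g S)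
    (hh : FormContinuousOn h S) : FormContinuousOn (fun v => g v + h v) S := fun l => by
  simp only [map_add]
  exact (hg l).add (hh l)

theorem FormContinuousOn.comp {W : Type*} [TopologicalSpace W] {T : Set W} {g : V → Form ι}
    (hg : FormContinuousOn g S) {φ : W → V} (hφ : ContinuousOn φ T) (hm : MapsTo φ T S) :
    FormContinuousOn (fun w => g (φ w)) T := fun l => (hg l).comp hφ hm

theorem FormContinuousOn.mono {T : Set V} {g : V → Form ι} (hg : FormContinuousOn g S)
    (h : T ⊆ S) : FormContinuousOn g T := fun l => (hg l).mono h

theorem exists_form_basis (ι : Type) [Fintype ι] :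
    ∃ (d : ℕ) (_ : Module.Basis (Fin d) ℂ (Form ι)), True := by
  have := finite_form (ι := ι)
  exact ⟨_, Module.finBasis ℂ (Form ι), trivial⟩

/-- Continuity is tested on linear functionals, and in a finite basis the product is bilinear in
continuous coordinates. -/
theorem FormContinuousOn.mul {g h : V → Form ι} (hg : FormContinuousOn g S)
    (hh : FormContinuousOn h S) : FormContinuousOn (fun v => g v * h v) S := by
  obtain ⟨d, b, -⟩ := exists_form_basis ι
  have e : (fun v => g v * h v) = fun v => ∑ i, ∑ j,
      (b.coord i (g v) * b.coord j (h v)) • (b i * b j) := by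
    ext1 v
    conv_lhs => rw [← b.sum_repr (g v), ← b.sum_repr (h v), Finset.sum_mul_sum]
    simp only [smul_mul_smul_comm]
    rfl
  rw [e]
  exact .sum _ fun i _ => .sum _ fun j _ =>
    .smul ((hg (b.coord i)).mul (hh (b.coord j))) (.const _)

theorem FormContinuousOn.pow {g : V → Form ι} (hg : FormContinuousOn g S) (k : ℕ) :
    FormContinuousOn (fun v => g v ^ k) S := by
  induction k with
  | zero => simpa using FormContinuousOn.const (S := S) (1 : Form ι)
  | succ k ih =>
    simp only [pow_succ]
    exact ih.mul hg

theorem formContinuousOn_pullForm_const {A : V → (ι → ℂ) →L[ℝ] (κ → ℂ)} (hA : ContinuousOn A S)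
    (x : Form κ) : FormContinuousOn (fun v => pullForm (A v) x) S := by
  classical
  induction x using ExteriorAlgebra.induction with
  | algebraMap c =>
    simp only [AlgHom.commutes]
    exact .const _
  | ι φ =>
    simp only [pullForm_ι]
    have e : (fun v => ExteriorAlgebra.ι ℂ (pullCovec (A v) φ)) = fun v => ∑ a,
        (coeffDz a (pullCovec (A v) φ) • ExteriorAlgebra.ι ℂ (dz a) +
          coeffDzbar a (pullCovec (A v) φ) • ExteriorAlgebra.ι ℂ (dzbar a)) := by
      ext1 v
      conv_lhs => rw [covec_eq_sum (pullCovec (A v) φ)]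
      simp only [map_sum, map_add, map_smul]
    rw [e]
    have hc : ∀ w : ι → ℂ, ContinuousOn (fun v => φ (A v w)) S := fun w =>
      φ.continuous.comp_continuousOn (hA.clm_apply continuousOn_const)
    refine .sum _ fun a _ => .add (.smul ?_ (.const _)) (.smul ?_ (.const _))
    · simp only [coeffDz_apply, pullCovec_apply]
      exact continuousOn_const.mul ((hc _).sub (continuousOn_const.mul (hc _)))
    · simp only [coeffDzbar_apply, pullCovec_apply]
      exact continuousOn_const.mul ((hc _).add (continuousOn_const.mul (hc _)))
  | mul x y hx hy =>
    simp only [map_mul]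
    exact hx.mul hy
  | add x y hx hy =>
    simp only [map_add]
    exact hx.add hy

theorem FormContinuousOn.pullForm {A : V → (ι → ℂ) →L[ℝ] (κ → ℂ)} (hA : ContinuousOn A S)
    {θ : V → Form κ} (hθ : FormContinuousOn θ S) :
    FormContinuousOn (fun v => pullForm (A v) (θ v)) S := by
  obtain ⟨d, b, -⟩ := exists_form_basis κ
  have e : (fun v => ParabolicSegre.pullForm (A v) (θ v)) = fun v => ∑ i,
      b.coord i (θ v) • ParabolicSegre.pullForm (A v) (b i) := by
    ext1 v
    conv_lhs => rw [← b.sum_repr (θ v)]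
    simp only [map_sum, map_smul]
    rfl
  rw [e]
  exact .sum _ fun i _ => .smul (hθ (b.coord i)) (formContinuousOn_pullForm_const hA _)

end weak

/-! ### Continuity and local boundedness of the fibre densities. -/

section densityContinuity

variable {n s : ℕ}

theorem formContinuousOn_chernCurv {ι : Type} [Fintype ι] [DecidableEq ι] {r : ℕ}
    {G : (ι → ℂ) → Matrix (Fin r) (Fin r) ℂ} {O : Set (ι → ℂ)}
    (hG : ∀ u ∈ O, MSmoothAt G u) (hd : ∀ u ∈ O, (G u).det ≠ 0) (i j : Fin r) :
    FormContinuousOn (fun u => (chernCurv G u i j : Form ι)) O := by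
  have e : (fun u => (chernCurv G u i j : Form ι)) = fun u => (Complex.I / (2 * (Real.pi : ℂ))) •
      ∑ b, ∑ a, curvCoef G b a u i j • (wedge (dzbar b) (dz a) : Form ι) := by
    ext1 u
    simp only [chernCurv, curvE, Matrix.smul_apply, Matrix.of_apply, SetLike.val_smul,
      AddSubmonoidClass.coe_finsetSum]
  rw [e]
  refine .smul continuousOn_const (.sum _ fun b _ => .sum _ fun a _ => .smul ?_ (.const _))
  intro u hu
  exact (((hG u hu).connCoeff (hd u hu) a).mD (coeffDzbar b) i j).continuousAt.continuousWithinAt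

variable {G : (Fin n → ℂ) → Matrix (Fin (s + 1)) (Fin (s + 1)) ℂ} {O : Set (Fin n → ℂ)}

theorem continuousOn_inv_gram (hG : ∀ u ∈ O, MSmoothAt G u) (hp : ∀ u ∈ O, (G u).PosDef)
    (i j : Fin (s + 1)) : ContinuousOn (fun u => (G u)⁻¹ i j) O := fun u hu =>
  ((hG u hu).inv (hp u hu).det_pos.ne' i j).continuousAt.continuousWithinAt

theorem continuousOn_mulVec_gram (hG : ∀ u ∈ O, MSmoothAt G u) (hp : ∀ u ∈ O, (G u).PosDef)
    (i : Fin (s + 1)) :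
    ContinuousOn (fun q : (Fin n → ℂ) × (Fin (s + 1) → ℂ) => ((G q.1)⁻¹ *ᵥ star q.2) i)
      (O ×ˢ univ) := by
  simp only [Matrix.mulVec, dotProduct, Pi.star_apply]
  refine continuousOn_finsetSum _ fun j _ => ContinuousOn.mul ?_ ?_
  · exact (continuousOn_inv_gram hG hp i j).comp continuousOn_fst fun q hq => hq.1
  · exact (continuous_star.comp ((continuous_apply j).comp continuous_snd)).continuousOn

theorem continuousOn_hval_gram (hG : ∀ u ∈ O, MSmoothAt G u) (hp : ∀ u ∈ O, (G u).PosDef) :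
    ContinuousOn (fun q : (Fin n → ℂ) × (Fin (s + 1) → ℂ) => hval (G q.1)⁻¹ q.2)
      (O ×ˢ univ) := by
  simp only [hval, dotProduct]
  refine continuousOn_finsetSum _ fun i _ => ContinuousOn.mul ?_ (continuousOn_mulVec_gram hG hp i)
  exact ((continuous_apply i).comp continuous_snd).continuousOn

theorem continuousOn_ratio_gram (hG : ∀ u ∈ O, MSmoothAt G u) (hp : ∀ u ∈ O, (G u).PosDef)
    (i j : Fin (s + 1)) :
    ContinuousOn (fun q : (Fin n → ℂ) × (Fin (s + 1) → ℂ) => ratio (G q.1)⁻¹ q.2 i j)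
      (O ×ˢ {0}ᶜ) := by
  have hsub : O ×ˢ ({0}ᶜ : Set (Fin (s + 1) → ℂ)) ⊆ O ×ˢ univ := prod_mono_right (subset_univ _)
  simp only [ratio]
  refine ContinuousOn.div (ContinuousOn.mul ?_ ((continuousOn_mulVec_gram hG hp j).mono hsub))
    ((continuousOn_hval_gram hG hp).mono hsub) fun q hq => ?_
  · exact ((continuous_apply i).comp continuous_snd).continuousOn
  · exact (posDef_hval_pos (hp _ hq.1).inv hq.2).ne'

theorem continuousOn_segreDensity {θ : (Fin n → ℂ) → Form (Fin n)} (hθ : FormContinuousOn θ O)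
    (hG : ∀ u ∈ O, MSmoothAt G u) (hp : ∀ u ∈ O, (G u).PosDef) :
    ContinuousOn (fun q : (Fin n → ℂ) × (Fin (s + 1) → ℂ) =>
      segreDensity (θ q.1) (G q.1) (chernCurv G q.1) q.2) (O ×ˢ {0}ᶜ) := by
  have hfst : ContinuousOn (fun q : (Fin n → ℂ) × (Fin (s + 1) → ℂ) => q.1) (O ×ˢ {0}ᶜ) :=
    continuousOn_fst
  have hm : MapsTo (fun q : (Fin n → ℂ) × (Fin (s + 1) → ℂ) => q.1) (O ×ˢ {0}ᶜ) O :=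
    fun q hq => hq.1
  have h2 : FormContinuousOn (fun q : (Fin n → ℂ) × (Fin (s + 1) → ℂ) =>
      ((segreIntegrand n (G q.1)⁻¹ q.2 (chernCurv G q.1) : EvenForm (Fin n)) : Form (Fin n))) (O ×ˢ {0}ᶜ) := by
    simp only [segreIntegrand, contract, AddSubmonoidClass.coe_finsetSum, SetLike.val_smul,
      SubmonoidClass.coe_pow]
    refine .sum _ fun k _ => .smul continuousOn_const (.pow (.sum _ fun p _ => .smul
      (continuousOn_ratio_gram hG hp _ _) ?_) k)
    exact (formContinuousOn_chernCurv hG (fun u hu => (hp u hu).det_pos.ne') p.1 p.2).comp hfst hm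
  exact ((hθ.comp hfst hm).mul h2) (topCoeff n)

/-- The density is invariant under scaling of `ξ`, so the supremum may be taken over the unit
sphere, and compactness of `C` times the sphere applies. -/
theorem exists_supDensity_bound {θ : (Fin n → ℂ) → Form (Fin n)} (hθ : FormContinuousOn θ O)
    (hG : ∀ u ∈ O, MSmoothAt G u) (hp : ∀ u ∈ O, (G u).PosDef) {C : Set (Fin n → ℂ)}
    (hC : IsCompact C) (hCO : C ⊆ O) :
    ∃ B : NNReal, ∀ u ∈ C, supDensity (θ u) (G u) (chernCurv G u) ≤ B := by
  obtain ⟨B, hB⟩ := (hC.prod (isCompact_sphere (0 : Fin (s + 1) → ℂ) 1)).exists_bound_of_continuousOn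
    ((continuousOn_segreDensity hθ hG hp).mono (prod_mono hCO fun ξ hξ h => by
      rw [mem_singleton_iff] at h
      subst h
      simp at hξ))
  refine ⟨B.toNNReal, fun u hu => iSup₂_le fun ξ hξ => ?_⟩
  have hn : ‖ξ‖ ≠ 0 := norm_ne_zero_iff.2 hξ
  have h1 := hB (u, (((‖ξ‖⁻¹ : ℝ) : ℂ) • ξ)) ⟨hu, by simp [norm_smul, hn]⟩
  dsimp only at h1
  rw [segreDensity_smul (by simpa using hξ)] at h1
  rw [← ofReal_norm]
  exact ENNReal.ofReal_le_ofReal h1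

theorem continuous_prod_cons_one :
    Continuous fun q : (Fin n → ℂ) × (Fin s → ℂ) =>
      (⟨q.1, (Fin.cons 1 q.2 : Fin (s + 1) → ℂ)⟩ : (Fin n → ℂ) × (Fin (s + 1) → ℂ)) := by
  refine continuous_fst.prodMk (continuous_pi fun i => ?_)
  refine Fin.cases ?_ (fun i => ?_) i
  · simpa only [Fin.cons_zero] using continuous_const
  · simp only [Fin.cons_succ]
    exact (continuous_apply i).comp continuous_snd

theorem ContinuousOn.comp_cons_one {f : (Fin n → ℂ) × (Fin (s + 1) → ℂ) → ℂ}
    {S : Set (Fin (s + 1) → ℂ)} (hf : ContinuousOn f (O ×ˢ S)) (hS : {0}ᶜ ⊆ S) :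
    ContinuousOn (fun q : (Fin n → ℂ) × (Fin s → ℂ) =>
      f (q.1, (Fin.cons 1 q.2 : Fin (s + 1) → ℂ))) (O ×ˢ univ) :=
  hf.comp continuous_prod_cons_one.continuousOn
    fun q hq => ⟨hq.1, hS (cons_one_ne_zero q.2)⟩

theorem continuousOn_fsDensity (hG : ∀ u ∈ O, MSmoothAt G u) (hp : ∀ u ∈ O, (G u).PosDef) :
    ContinuousOn (fun q : (Fin n → ℂ) × (Fin s → ℂ) => fsDensity (G q.1)⁻¹ q.2)
      (O ×ˢ univ) := by
  have h3 := ContinuousOn.comp_cons_one (continuousOn_hval_gram hG hp) (subset_univ _)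
  have h4 : ContinuousOn (fun q : (Fin n → ℂ) × (Fin s → ℂ) => (G q.1)⁻¹.det) (O ×ˢ univ) := by
    simp only [Matrix.det_apply]
    refine continuousOn_finsetSum _ fun σ _ => ContinuousOn.const_smul
      (continuousOn_finsetProd _ fun i _ => ?_) _
    exact (continuousOn_inv_gram hG hp _ _).comp continuousOn_fst fun q hq => hq.1
  simp only [fsDensity]
  refine (continuousOn_const.mul (Complex.continuous_re.comp_continuousOn h4)).mul
    (((Complex.continuous_re.comp_continuousOn h3).pow _).inv₀ fun q hq => ?_)
  have h5 := (Complex.lt_def.1 (posDef_hval_pos (hp _ hq.1).inv (cons_one_ne_zero q.2))).1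
  exact pow_ne_zero _ h5.ne'

end densityContinuity

/-! ### Change of charts in integrals -/

section chartIntegrals

variable {n s : ℕ} {X : Type*} [TopologicalSpace X] [ChartedSpace (Fin n → ℂ) X]

/-- The image is the preimage of `S` under the continuous inverse chart on its open domain. -/
theorem measurableSet_chart_image {φ : OpenPartialHomeomorph X (Fin n → ℂ)} {S : Set X}
    (hS : MeasurableSet[borel X] S) (hsub : S ⊆ φ.source) : MeasurableSet (φ '' S) := by
  borelize X
  have h1 : φ '' S = Subtype.val '' ((fun y : φ.target => φ.symm y) ⁻¹' S) := by
    ext y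
    constructor
    · rintro ⟨x, hx, rfl⟩
      exact ⟨⟨φ x, φ.map_source (hsub hx)⟩, by simpa [φ.left_inv (hsub hx)] using hx, rfl⟩
    · rintro ⟨y, hy, rfl⟩
      exact ⟨_, hy, φ.right_inv y.2⟩
  rw [h1]
  refine φ.open_target.measurableSet.subtype_image ?_
  have h2 : Continuous fun y : φ.target => φ.symm y :=
    continuousOn_iff_continuous_domRestrict.1 φ.continuousOn_symm
  exact h2.measurable hS

theorem transition_image {φ φ' : OpenPartialHomeomorph X (Fin n → ℂ)} {S : Set X}
    (hsub : S ⊆ φ.source) : transition φ φ' '' (φ '' S) = φ' '' S := by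
  rw [image_image]
  exact image_congr fun x hx => by rw [transition, φ.left_inv (hsub hx)]

theorem transition_injOn {φ φ' : OpenPartialHomeomorph X (Fin n → ℂ)} {S : Set X}
    (hsub : S ⊆ φ.source) (hsub' : S ⊆ φ'.source) : InjOn (transition φ φ') (φ '' S) := by
  rintro _ ⟨x, hx, rfl⟩ _ ⟨y, hy, rfl⟩ h
  rw [transition, transition, φ.left_inv (hsub hx), φ.left_inv (hsub hy)] at h
  rw [φ'.injOn (hsub' hx) (hsub' hy) h]

theorem transition_hasFDerivWithinAt [IsManifold 𝓘(ℂ, Fin n → ℂ) ω X]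
    {φ φ' : OpenPartialHomeomorph X (Fin n → ℂ)} (hφ : IsHolChart n φ) (hφ' : IsHolChart n φ')
    {S : Set X} (hsub : S ⊆ φ.source) (hsub' : S ⊆ φ'.source) :
    ∀ u ∈ φ '' S, HasFDerivWithinAt (transition φ φ')
      ((fderiv ℂ (transition φ φ') u).restrictScalars ℝ) (φ '' S) u := by
  rintro _ ⟨x, hx, rfl⟩
  refine HasFDerivAt.hasFDerivWithinAt (HasFDerivAt.restrictScalars ℝ ?_)
  refine (transition_analyticAt hφ hφ' (φ.map_source (hsub hx)) ?_).differentiableAt.hasFDerivAt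
  rw [φ.left_inv (hsub hx)]
  exact hsub' hx

variable {E : X → Type*} [TopologicalSpace (TotalSpace (Fin (s + 1) → ℂ) E)]
  [∀ x, AddCommGroup (E x)] [∀ x, Module ℂ (E x)] [∀ x, TopologicalSpace (E x)]
  [FiberBundle (Fin (s + 1) → ℂ) E]

/-- The supremum over the fibre of the densities of `f ∧ (1 + ρ) ^ (-(s + 1))`. -/
def formSupDensity (H : ∀ x, E x →ₗ⋆[ℂ] E x →ₗ[ℂ] ℂ) (f : X → Form (Fin n))
    (c : FrameChart n s E) (u : Fin n → ℂ) : ENNReal :=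
  supDensity (localForm f c.chart u) (gram H c u) (chernCurv (gram H c) u)

variable {H : ∀ x, E x →ₗ⋆[ℂ] E x →ₗ[ℂ] ℂ} {U : Set X}

theorem formSupDensity_eq_zero {f : X → Form (Fin n)} {c : FrameChart n s E} {u : Fin n → ℂ}
    (h : f (c.chart.symm u) = 0) : formSupDensity H f c u = 0 := by
  have h1 : localForm f c.chart u = 0 := by rw [localForm, h, map_zero]
  simp [formSupDensity, supDensity, segreDensity, h1]

variable [IsManifold 𝓘(ℂ, Fin n → ℂ) ω X] [VectorBundle ℂ (Fin (s + 1) → ℂ) E]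
  [ContMDiffVectorBundle ω (Fin (s + 1) → ℂ) E 𝓘(ℂ, Fin n → ℂ)]

theorem formSupDensity_transition (hU : IsOpen U)
    (hH : IsHermitianMetricOn (n := n) (s := s) H U) (f : X → Form (Fin n))
    (c c' : FrameChart n s E) {u : Fin n → ℂ} (hu : u ∈ c.chart.target)
    (hx : c.chart.symm u ∈ c'.chart.source) (hxU : c.chart.symm u ∈ U) :
    ENNReal.ofReal |((fderiv ℂ (transition c.chart c'.chart) u).restrictScalars ℝ).det| *
      formSupDensity H f c' (transition c.chart c'.chart u) = formSupDensity H f c u := by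
  obtain ⟨g, hg, hgd, h⟩ := exists_frame_change c c' hu hx
  have ht : transition c.chart c'.chart u ∈ c'.chart.target := c'.chart.map_source hx
  have hs : c'.chart.symm (transition c.chart c'.chart u) ∈ U := by
    rwa [transition, c'.chart.left_inv hx]
  exact supDensity_transform (gram_mSmoothAt hU hH c' ht hs) (gram_posDef hH c' ht hs).det_pos.ne'
    hg hgd (transition_analyticAt c.isHolChart c'.isHolChart hu hx) (h H)
    (localForm_transition c.isHolChart c'.isHolChart hu hx f)

theorem lintegral_formSupDensity_image (hU : IsOpen U)
    (hH : IsHermitianMetricOn (n := n) (s := s) H U) (f : X → Form (Fin n))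
    (c c' : FrameChart n s E) {S : Set X} (hS : MeasurableSet[borel X] S)
    (hc : S ⊆ c.chart.source) (hc' : S ⊆ c'.chart.source) (hSU : S ⊆ U) :
    ∫⁻ u in c'.chart '' S, formSupDensity H f c' u = ∫⁻ u in c.chart '' S, formSupDensity H f c u := by
  have hm := measurableSet_chart_image hS hc
  rw [← transition_image hc, lintegral_image_eq_lintegral_abs_det_fderiv_mul volume hm
    (transition_hasFDerivWithinAt c.isHolChart c'.isHolChart hc hc') (transition_injOn hc hc')]
  refine setLIntegral_congr_fun hm ?_
  rintro _ ⟨x, hx, rfl⟩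
  have e := c.chart.left_inv (hc hx)
  exact formSupDensity_transition hU hH f c c' (c.chart.map_source (hc hx))
    (e.symm ▸ hc' hx) (e.symm ▸ hSU hx)

/-- Top forms transform by the Jacobian and measures by its absolute value; these agree because
holomorphic maps have nonnegative real Jacobian. -/
theorem baseDensity_transition (hU : IsOpen U)
    (hH : IsHermitianMetricOn (n := n) (s := s) H U) (f : X → Form (Fin n))
    (c c' : FrameChart n s E) {u : Fin n → ℂ} (hu : u ∈ c.chart.target)
    (hx : c.chart.symm u ∈ c'.chart.source) (hxU : c.chart.symm u ∈ U) :
    baseDensity H f c u =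
      |((fderiv ℂ (transition c.chart c'.chart) u).restrictScalars ℝ).det| •
        baseDensity H f c' (transition c.chart c'.chart u) := by
  obtain ⟨g, hg, hgd, h⟩ := exists_frame_change c c' hu hx
  have ht : transition c.chart c'.chart u ∈ c'.chart.target := c'.chart.map_source hx
  have hs : c'.chart.symm (transition c.chart c'.chart u) ∈ U := by
    rwa [transition, c'.chart.left_inv hx]
  rw [baseDensity, localForm_transition c.isHolChart c'.isHolChart hu hx f,
    segreForm_transform (gram_mSmoothAt hU hH c' ht hs) (gram_posDef hH c' ht hs).det_pos.ne'
    hg hgd (transition_analyticAt c.isHolChart c'.isHolChart hu hx) (h H), ← map_mul,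
    topCoeff_pullForm, abs_of_nonneg (det_restrictScalars_nonneg _), Complex.real_smul]
  rfl

theorem integral_baseDensity_image (hU : IsOpen U)
    (hH : IsHermitianMetricOn (n := n) (s := s) H U) (f : X → Form (Fin n))
    (c c' : FrameChart n s E) {S : Set X} (hS : MeasurableSet[borel X] S)
    (hc : S ⊆ c.chart.source) (hc' : S ⊆ c'.chart.source) (hSU : S ⊆ U) :
    ∫ u in c'.chart '' S, baseDensity H f c' u = ∫ u in c.chart '' S, baseDensity H f c u := by
  have hm := measurableSet_chart_image hS hc
  rw [← transition_image hc, integral_image_eq_integral_abs_det_fderiv_smul volume hm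
    (transition_hasFDerivWithinAt c.isHolChart c'.isHolChart hc hc') (transition_injOn hc hc')]
  refine setIntegral_congr_fun hm ?_
  rintro _ ⟨x, hx, rfl⟩
  have e := c.chart.left_inv (hc hx)
  exact (baseDensity_transition hU hH f c c' (c.chart.map_source (hc hx))
    (e.symm ▸ hc' hx) (e.symm ▸ hSU hx)).symm

end chartIntegrals

/-! ### Local integrability across the divisor -/

section cover

variable {n : ℕ}

theorem contDiff_cover (N : ℕ) (a : Fin n) : ContDiff ℂ ω (cover N a) := by
  refine contDiff_pi.2 fun b => ?_
  by_cases h : b = a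
  · subst h
    simpa only [cover, Function.update_self] using (contDiff_apply ℂ ℂ b).pow N
  · simpa only [cover, Function.update_of_ne h] using contDiff_apply ℂ ℂ b

theorem cover_apply_self (N : ℕ) (a : Fin n) (w : Fin n → ℂ) : cover N a w a = w a ^ N :=
  Function.update_self _ _ _

theorem cover_apply_of_ne (N : ℕ) {a b : Fin n} (h : b ≠ a) (w : Fin n → ℂ) :
    cover N a w b = w b := Function.update_of_ne h _ _

/-- The points of a closed polydisc off the branch locus, at which the branching coordinate is
the principal root of its power: a fundamental domain of the branched cover. -/
def rootSector (N : ℕ) (a : Fin n) (z : Fin n → ℂ) (ρ : ℝ) : Set (Fin n → ℂ) :=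
  {w | w ∈ Metric.closedBall z ρ ∧ w a ≠ 0 ∧ (w a ^ N) ^ ((N : ℂ)⁻¹) = w a}

theorem measurableSet_rootSector (N : ℕ) (a : Fin n) (z : Fin n → ℂ) (ρ : ℝ) :
    MeasurableSet (rootSector N a z ρ) := by
  have ha : Measurable fun w : Fin n → ℂ => w a := measurable_pi_apply a
  refine Metric.isClosed_closedBall.measurableSet.inter (MeasurableSet.inter ?_ ?_)
  · exact ha (measurableSet_singleton 0).compl
  · exact measurableSet_eq_fun ((ha.pow_const N).pow_const _) ha

theorem injOn_cover_rootSector (N : ℕ) (a : Fin n) (z : Fin n → ℂ) (ρ : ℝ) :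
    InjOn (cover N a) (rootSector N a z ρ) := by
  intro w hw w' hw' h
  ext b
  by_cases hb : b = a
  · subst hb
    have := congrFun h b
    rw [cover_apply_self, cover_apply_self] at this
    rw [← hw.2.2, ← hw'.2.2, this]
  · have := congrFun h b
    rwa [cover_apply_of_ne N hb, cover_apply_of_ne N hb] at this

/-- The preimage uses the principal `N`-th root of `ζ_a`; the condition `‖ζ a‖ < ρ ^ N` keeps that
root in the polydisc. -/
theorem mem_cover_image_rootSector {N : ℕ} (hN : N ≠ 0) {a : Fin n} {z ζ : Fin n → ℂ} {ρ : ℝ}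
    (hz : z a = 0) (hρ : 0 < ρ) (hζ : ζ ∈ Metric.ball z ρ) (hζN : ‖ζ a‖ < ρ ^ N)
    (hζ0 : ζ a ≠ 0) : ζ ∈ cover N a '' rootSector N a z ρ := by
  set t : ℂ := ζ a ^ ((N : ℂ)⁻¹) with ht
  have htN : t ^ N = ζ a := Complex.cpow_nat_inv_pow _ hN
  refine ⟨Function.update ζ a t, ⟨?_, ?_, ?_⟩, ?_⟩
  · rw [mem_closedBall_iff_norm, pi_norm_le_iff_of_nonneg hρ.le]
    intro b
    by_cases hb : b = a
    · subst hb
      rw [Pi.sub_apply, Function.update_self, hz, sub_zero]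
      refine (lt_of_pow_lt_pow_left₀ N hρ.le ?_).le
      rwa [← norm_pow, htN]
    · rw [Pi.sub_apply, Function.update_of_ne hb]
      rw [mem_ball_iff_norm] at hζ
      exact (norm_le_pi_norm (ζ - z) b).trans hζ.le
  · rw [Function.update_self]
    intro h0
    rw [h0, zero_pow hN] at htN
    exact hζ0 htN.symm
  · rw [Function.update_self, htN]
  · ext b
    by_cases hb : b = a
    · subst hb
      rw [cover_apply_self, Function.update_self, htN]
    · rw [cover_apply_of_ne N hb, Function.update_of_ne hb]

end cover

/-! ### Integrability of the fibrewise supremum, locally and then over the support of a test form.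
-/

section localIntegrability

variable {n s : ℕ} {X : Type*} [TopologicalSpace X] [ChartedSpace (Fin n → ℂ) X]
  {E : X → Type*} [TopologicalSpace (TotalSpace (Fin (s + 1) → ℂ) E)]
  [∀ x, AddCommGroup (E x)] [∀ x, Module ℂ (E x)] [∀ x, TopologicalSpace (E x)]
  [FiberBundle (Fin (s + 1) → ℂ) E] {H : ∀ x, E x →ₗ⋆[ℂ] E x →ₗ[ℂ] ℂ}

theorem IsSmoothForm.formContinuousOn {f : X → Form (Fin n)} (hf : IsSmoothForm f)
    {φ : OpenPartialHomeomorph X (Fin n → ℂ)} (hφ : IsHolChart n φ) :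
    FormContinuousOn (localForm f φ) φ.target := fun l => (hf φ hφ l).continuousOn

theorem exists_lintegral_lt_top_of_mem {U : Set X} (hU : IsOpen U)
    (hH : IsHermitianMetricOn (n := n) (s := s) H U) {f : X → Form (Fin n)} (hf : IsSmoothForm f)
    (c : FrameChart n s E) {p : X} (hp : p ∈ c.chart.source) (hpU : p ∈ U) :
    ∃ V, IsOpen V ∧ p ∈ V ∧ V ⊆ c.chart.source ∧
      ∫⁻ u in c.chart '' (V ∩ U), formSupDensity H f c u < ⊤ := by
  have hO := c.chart.isOpen_inter_preimage_symm hU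
  have hpO : c.chart p ∈ c.chart.target ∩ c.chart.symm ⁻¹' U :=
    ⟨c.chart.map_source hp, by rwa [mem_preimage, c.chart.left_inv hp]⟩
  obtain ⟨ρ, hρ, hb⟩ := Metric.nhds_basis_closedBall.mem_iff.1 (hO.mem_nhds hpO)
  obtain ⟨B, hB⟩ := exists_supDensity_bound
    ((hf.formContinuousOn c.isHolChart).mono inter_subset_left)
    (fun u hu => gram_mSmoothAt hU hH c hu.1 hu.2) (fun u hu => gram_posDef hH c hu.1 hu.2)
    (isCompact_closedBall (c.chart p) ρ) hb
  refine ⟨c.chart.source ∩ c.chart ⁻¹' Metric.ball (c.chart p) ρ,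
    c.chart.isOpen_inter_preimage Metric.isOpen_ball, ⟨hp, Metric.mem_ball_self hρ⟩,
    inter_subset_left, ?_⟩
  refine (lintegral_mono_set ?_).trans_lt (setLIntegral_lt_top_of_le_nnreal
    (isCompact_closedBall (c.chart p) ρ).measure_ne_top ⟨B, hB⟩)
  rintro _ ⟨x, hx, rfl⟩
  exact Metric.ball_subset_closedBall hx.1.2

theorem ParabolicStructure.denom_ne_zero {D : Set X} (P : ParabolicStructure n s E D) :
    P.denom ≠ 0 := by
  rw [ParabolicStructure.denom, Ne, Finset.lcm_eq_zero_iff]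
  rintro ⟨j, -, hj⟩
  exact (P.weight j).den_nz hj

/-- The Segre form may blow up at `D`, but the Jacobian of the branched cover compensates. On the
cover the metric extends smoothly, so Jacobian times supremum is bounded off the branch locus, and
changing variables on one sector, where the cover is injective, bounds the integral below. -/
theorem exists_lintegral_lt_top_of_mem_divisor {D : Set X} (hD : IsClosed D)
    {P : ParabolicStructure n s E D} (hH : IsAdmissible P H) {f : X → Form (Fin n)}
    (hf : IsSmoothForm f) {p : X} (hpD : p ∈ D) :
    ∃ (c : FrameChart n s E) (V : Set X), IsOpen V ∧ p ∈ V ∧ V ⊆ c.chart.source ∧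
      ∫⁻ u in c.chart '' (V ∩ Dᶜ), formSupDensity H f c u < ⊤ := by
  obtain ⟨c, a, Ht, hp, ⟨-, hDa⟩, -, hsm, hext⟩ := hH.exists_extension p hpD
  have hN := P.denom_ne_zero
  set N := P.denom with hNdef
  set z := c.chart p with hz
  have hza : z a = 0 := (hDa p hp).1 hpD
  have hcov := contDiff_cover N a
  have hO : IsOpen (cover N a ⁻¹' c.chart.target) :=
    c.chart.open_target.preimage hcov.continuous
  have hzO : z ∈ cover N a ⁻¹' c.chart.target := by
    have : cover N a z = z := by
      rw [cover, hza, zero_pow hN, ← hza, Function.update_eq_self]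
    rw [mem_preimage, this]
    exact c.chart.map_source hp
  obtain ⟨ρ, hρ, hb⟩ := Metric.nhds_basis_closedBall.mem_iff.1 (hO.mem_nhds hzO)
  have hHt : ∀ w ∈ cover N a ⁻¹' c.chart.target, MSmoothAt Ht w := fun w hw i j =>
    (hsm i j).contDiffAt (hO.mem_nhds hw)
  have hA : Continuous fun w => (fderiv ℂ (cover N a) w).restrictScalars ℝ :=
    (ContinuousLinearMap.continuous_restrictScalars (𝕜 := ℂ) ℝ).comp
      (hcov.continuous_fderiv (by simp))
  obtain ⟨B, hB⟩ := exists_supDensity_bound (G := Ht)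
    (((hf.formContinuousOn c.isHolChart).comp hcov.continuous.continuousOn fun w hw => hw).pullForm
      hA.continuousOn) hHt (fun w hw => (hext w hw).1) (isCompact_closedBall z ρ) hb
  have key : ∀ w ∈ rootSector N a z ρ,
      ENNReal.ofReal |((fderiv ℂ (cover N a) w).restrictScalars ℝ).det| *
        formSupDensity H f c (cover N a w) ≤ B := by
    intro w hw
    have hwO := hb hw.1
    have hwD : c.chart.symm (cover N a w) ∈ Dᶜ := by
      rw [mem_compl_iff, hDa _ (c.chart.map_target hwO), c.chart.right_inv hwO, cover_apply_self]
      exact pow_ne_zero _ hw.2.1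
    -- The change from the adapted frame to the frame of the equivariant bundle, holomorphic and
    -- invertible only where `w_a ≠ 0`.
    have hg : MHolAt (fun v : Fin n → ℂ => Matrix.diagonal fun i => v a ^ (-P.exponent i)) w := by
      intro i j
      simp only [Matrix.diagonal_apply]
      split_ifs
      · exact ((ContinuousLinearMap.proj (R := ℂ) (φ := fun _ : Fin n => ℂ) a).analyticAt w).zpow
          hw.2.1
      · exact analyticAt_const
    refine le_of_eq_of_le (supDensity_transform
      (gram_mSmoothAt hD.isOpen_compl hH.isHermitianMetricOn c hwO hwD)
      (gram_posDef hH.isHermitianMetricOn c hwO hwD).det_pos.ne' hg ?_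
      hcov.contDiffAt.analyticAt ?_ rfl) (hB w hw.1)
    · rw [Matrix.det_diagonal]
      exact Finset.prod_ne_zero_iff.2 fun i _ => zpow_ne_zero _ hw.2.1
    · filter_upwards [hO.mem_nhds hwO,
        (continuous_apply a).continuousAt.eventually_ne hw.2.1] with v hv hva
      ext i j
      rw [(hext v hv).2 hva i j, Matrix.diagonal_conjTranspose, Matrix.mul_diagonal,
        Matrix.diagonal_mul]
      simp
  refine ⟨c, c.chart.source ∩ c.chart ⁻¹' (Metric.ball z ρ ∩ {ζ | ‖ζ a‖ < ρ ^ N}),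
    c.chart.isOpen_inter_preimage (Metric.isOpen_ball.inter
      (isOpen_lt (continuous_apply a).norm continuous_const)),
    ⟨hp, Metric.mem_ball_self hρ, ?_⟩, inter_subset_left, ?_⟩
  · rw [mem_ofPred_eq, ← hz, hza, norm_zero]
    positivity
  -- The part of the neighbourhood off `D` is covered by the image of a single sector, a subset of a
  -- compact polydisc.
  refine (lintegral_mono_set (t := cover N a '' rootSector N a z ρ) ?_).trans_lt ?_
  · rintro _ ⟨x, ⟨hx, hxD⟩, rfl⟩
    exact mem_cover_image_rootSector hN hza hρ hx.2.1 hx.2.2 fun h => hxD ((hDa x hx.1).2 h)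
  · rw [lintegral_image_eq_lintegral_abs_det_fderiv_mul volume (measurableSet_rootSector N a z ρ)
      (fun w _ => ((hcov.differentiable (by simp) w).hasFDerivAt.restrictScalars
        ℝ).hasFDerivWithinAt) (injOn_cover_rootSector N a z ρ)]
    refine setLIntegral_lt_top_of_le_nnreal ?_ ⟨B, key⟩
    exact ((measure_mono fun w hw => hw.1).trans_lt
      (isCompact_closedBall z ρ).measure_lt_top).ne

variable [IsManifold 𝓘(ℂ, Fin n → ℂ) ω X] [VectorBundle ℂ (Fin (s + 1) → ℂ) E]
  [ContMDiffVectorBundle ω (Fin (s + 1) → ℂ) E 𝓘(ℂ, Fin n → ℂ)]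

theorem exists_lintegral_lt_top {D : Set X} (hD : IsClosed D)
    {P : ParabolicStructure n s E D} (hH : IsAdmissible P H) {f : X → Form (Fin n)}
    (hf : IsSmoothForm f) (p : X) :
    ∃ (c : FrameChart n s E) (V : Set X), IsOpen V ∧ p ∈ V ∧ V ⊆ c.chart.source ∧
      ∫⁻ u in c.chart '' (V ∩ Dᶜ), formSupDensity H f c u < ⊤ := by
  by_cases hpD : p ∈ D
  · exact exists_lintegral_lt_top_of_mem_divisor hD hH hf hpD
  · obtain ⟨c, hc⟩ := exists_frameChart (n := n) (s := s) E p
    exact ⟨c, exists_lintegral_lt_top_of_mem hD.isOpen_compl hH.isHermitianMetricOn hf c hc hpD⟩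

/-- The densities of a form with compact support are integrable over the complement of the
divisor. -/
theorem tsum_lintegral_formSupDensity_lt_top {D : Set X} (hD : IsClosed D)
    {P : ParabolicStructure n s E D} (hH : IsAdmissible P H) {f : X → Form (Fin n)}
    (hf : IsSmoothForm f) (hfc : HasCompactSupport f) (A : Dissection n s E Dᶜ) :
    ∑' i, ∫⁻ u in A.coordPiece i, formSupDensity H f (A.frameChart i) u < ⊤ := by
  choose c V hVo hpV hVs hfin using exists_lintegral_lt_top hD hH hf
  obtain ⟨t, ht⟩ := hfc.isCompact.elim_finite_subcover V hVo
    fun p _ => mem_iUnion.2 ⟨p, hpV p⟩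
  have hsubD : ∀ i, A.piece i ⊆ Dᶜ := fun i =>
    (subset_iUnion A.piece i).trans A.iUnion_piece.subset
  have hVm : ∀ p, MeasurableSet[borel X] (V p) := fun p => by
    borelize X
    exact (hVo p).measurableSet
  have hpm : ∀ i p, MeasurableSet[borel X] (A.piece i ∩ V p) := fun i p => by
    borelize X
    exact (A.measurableSet_piece i).inter (hVm p)
  have hTm : MeasurableSet[borel X] (tsupport f)ᶜ := by
    borelize X
    exact (isClosed_tsupport f).isOpen_compl.measurableSet
  have hpT : ∀ i, MeasurableSet[borel X] (A.piece i ∩ (tsupport f)ᶜ) := fun i => by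
    borelize X
    exact (A.measurableSet_piece i).inter hTm
  have h1 : ∀ i, ∫⁻ u in A.coordPiece i, formSupDensity H f (A.frameChart i) u ≤
      ∑ p : t, ∫⁻ u in (c p).chart '' (A.piece i ∩ V p), formSupDensity H f (c p) u := by
    intro i
    -- Off the support the density vanishes; on it, finitely many neighbourhoods with finite
    -- integral suffice.
    have hs1 : A.coordPiece i ⊆ (A.frameChart i).chart '' (A.piece i ∩ (tsupport f)ᶜ) ∪
        ⋃ p : t, (A.frameChart i).chart '' (A.piece i ∩ V p) := by
      rintro _ ⟨x, hx, rfl⟩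
      by_cases hxf : x ∈ tsupport f
      · obtain ⟨p, hp, hxp⟩ := mem_iUnion₂.1 (ht hxf)
        exact Or.inr (mem_iUnion.2 ⟨⟨p, hp⟩, x, ⟨hx, hxp⟩, rfl⟩)
      · exact Or.inl ⟨x, ⟨hx, hxf⟩, rfl⟩
    refine (lintegral_mono_set hs1).trans ((lintegral_union_le _ _ _).trans ?_)
    have h0 : ∫⁻ u in (A.frameChart i).chart '' (A.piece i ∩ (tsupport f)ᶜ),
        formSupDensity H f (A.frameChart i) u = 0 := by
      rw [setLIntegral_congr_fun (g := fun _ => 0) (measurableSet_chart_image (hpT i)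
        (inter_subset_left.trans (A.piece_subset i))), lintegral_zero]
      rintro _ ⟨x, hx, rfl⟩
      refine formSupDensity_eq_zero ?_
      rw [(A.frameChart i).chart.left_inv (A.piece_subset i hx.1)]
      exact image_eq_zero_of_notMem_tsupport hx.2
    rw [h0, zero_add]
    refine (lintegral_iUnion_le _ _).trans ?_
    rw [tsum_fintype]
    refine Finset.sum_le_sum fun p _ => le_of_eq ?_
    exact lintegral_formSupDensity_image hD.isOpen_compl hH.isHermitianMetricOn f (c p)
      (A.frameChart i) (hpm i p) (inter_subset_right.trans (hVs p))
      (inter_subset_left.trans (A.piece_subset i)) (inter_subset_left.trans (hsubD i))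
  refine (ENNReal.tsum_le_tsum h1).trans_lt ?_
  -- With the finite sum outside, for each fixed neighbourhood the disjoint pieces together
  -- integrate to at most the finite integral over that neighbourhood minus `D`.
  rw [Summable.tsum_finsetSum fun _ _ => ENNReal.summable]
  refine ENNReal.sum_lt_top.2 fun p _ => ?_
  rw [← lintegral_iUnion (fun i => measurableSet_chart_image (hpm i p)
    (inter_subset_right.trans (hVs p)))]
  · refine (lintegral_mono_set (iUnion_subset fun i => image_mono ?_)).trans_lt (hfin p)
    exact fun x hx => ⟨hx.2, hsubD i hx.1⟩
  · intro i j hij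
    exact ((A.disjoint hij).mono inter_subset_left inter_subset_left).image (c p).chart.injOn
      (inter_subset_right.trans (hVs p)) (inter_subset_right.trans (hVs p))

end localIntegrability

/-! ### Integrals over the projectivization -/

section fubini

variable {n s : ℕ} {X : Type*} [TopologicalSpace X] [ChartedSpace (Fin n → ℂ) X]
  {E : X → Type*} [TopologicalSpace (TotalSpace (Fin (s + 1) → ℂ) E)]
  [∀ x, AddCommGroup (E x)] [∀ x, Module ℂ (E x)] [∀ x, TopologicalSpace (E x)]
  [FiberBundle (Fin (s + 1) → ℂ) E] {H : ∀ x, E x →ₗ⋆[ℂ] E x →ₗ[ℂ] ℂ} {U : Set X}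

theorem projDensity_elim (hU : IsOpen U) (hH : IsHermitianMetricOn (n := n) (s := s) H U)
    (f : X → Form (Fin n)) (c : FrameChart n s E) {u : Fin n → ℂ} (hu : u ∈ c.chart.target)
    (hx : c.chart.symm u ∈ U) (w : Fin s → ℂ) :
    projDensity H f c (Sum.elim u w) = (-1) ^ s * ((fsDensity (gram H c u)⁻¹ w : ℂ) *
      segreDensity (localForm f c.chart u) (gram H c u) (chernCurv (gram H c) u)
        (Fin.cons 1 w)) :=
  evalVec_segreForm_lineGram (y := Sum.elim u w) hU hH c hu hx (realFrame n)
    (localForm f c.chart u)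

theorem integral_projDensity_elim (hU : IsOpen U)
    (hH : IsHermitianMetricOn (n := n) (s := s) H U)
    (f : X → Form (Fin n)) (c : FrameChart n s E) {u : Fin n → ℂ} (hu : u ∈ c.chart.target)
    (hx : c.chart.symm u ∈ U) :
    ∫ w : Fin s → ℂ, projDensity H f c (Sum.elim u w) = (-1) ^ s * baseDensity H f c u := by
  simp only [projDensity_elim hU hH f c hu hx, integral_const_mul]
  congr 1
  exact (integral_segreIntegrand (gram_posDef hH c hu hx).inv (gram H c) u (realFrame n)
    (localForm f c.chart u)).2

/-- The Fubini–Study density is a probability density, so a fibre integral is at most the supremum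
of the remaining factor. -/
theorem lintegral_enorm_projDensity_elim_le (hU : IsOpen U)
    (hH : IsHermitianMetricOn (n := n) (s := s) H U)
    (f : X → Form (Fin n)) (c : FrameChart n s E) {u : Fin n → ℂ} (hu : u ∈ c.chart.target)
    (hx : c.chart.symm u ∈ U) :
    ∫⁻ w : Fin s → ℂ, ‖projDensity H f c (Sum.elim u w)‖ₑ ≤ formSupDensity H f c u := by
  have hK := (gram_posDef hH c hu hx).inv
  calc ∫⁻ w : Fin s → ℂ, ‖projDensity H f c (Sum.elim u w)‖ₑ
      ≤ ∫⁻ w : Fin s → ℂ, ENNReal.ofReal (fsDensity (gram H c u)⁻¹ w) *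
          formSupDensity H f c u := by
        refine lintegral_mono fun w => ?_
        rw [projDensity_elim hU hH f c hu hx, enorm_mul, enorm_mul, enorm_pow, enorm_neg,
          enorm_one, one_pow, one_mul, ← ofReal_norm (fsDensity _ _ : ℂ), Complex.norm_real,
          Real.norm_of_nonneg (fsDensity_nonneg hK w)]
        gcongr
        exact le_iSup₂_of_le (Fin.cons 1 w) (cons_one_ne_zero w) le_rfl
    _ = formSupDensity H f c u := by
        rw [lintegral_mul_const _ (continuous_fsDensity hK).measurable.ennreal_ofReal,
          ← ofReal_integral_eq_lintegral_ofReal (integrable_fsDensity hK)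
            (Filter.Eventually.of_forall (fsDensity_nonneg hK)), integral_fsDensity hK,
          ENNReal.ofReal_one, one_mul]

theorem continuousOn_projDensity_elim (hU : IsOpen U)
    (hH : IsHermitianMetricOn (n := n) (s := s) H U)
    {f : X → Form (Fin n)} (hf : IsSmoothForm f) (c : FrameChart n s E) :
    ContinuousOn (fun q : (Fin n → ℂ) × (Fin s → ℂ) => projDensity H f c (Sum.elim q.1 q.2))
      ((c.chart.target ∩ c.chart.symm ⁻¹' U) ×ˢ univ) := by
  have hG : ∀ u ∈ c.chart.target ∩ c.chart.symm ⁻¹' U, MSmoothAt (gram H c) u := fun u hu =>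
    gram_mSmoothAt hU hH c hu.1 hu.2
  have hp : ∀ u ∈ c.chart.target ∩ c.chart.symm ⁻¹' U, (gram H c u).PosDef := fun u hu =>
    gram_posDef hH c hu.1 hu.2
  have h1 := ContinuousOn.comp_cons_one (continuousOn_segreDensity
    ((hf.formContinuousOn c.isHolChart).mono inter_subset_left) hG hp) subset_rfl
  have h2 := Complex.continuous_ofReal.comp_continuousOn (continuousOn_fsDensity hG hp)
  refine ContinuousOn.congr ((continuousOn_const (c := (-1 : ℂ) ^ s)).mul (h2.mul h1)) fun q hq => ?_
  exact projDensity_elim hU hH f c hq.1.1 hq.1.2 q.2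

/-- Integration of `π^* f ∧ s(𝒪(1), h)` over the part of the projectivization over a Borel set
over which the densities are integrable. -/
theorem integrableOn_projDensity (hU : IsOpen U)
    (hH : IsHermitianMetricOn (n := n) (s := s) H U)
    {f : X → Form (Fin n)} (hf : IsSmoothForm f) (c : FrameChart n s E) {S : Set (Fin n → ℂ)}
    (hS : MeasurableSet S) (hSU : S ⊆ c.chart.target ∩ c.chart.symm ⁻¹' U)
    (hfin : ∫⁻ u in S, formSupDensity H f c u < ⊤) :
    IntegrableOn (projDensity H f c) (baseProj n s ⁻¹' S) ∧
    ∫⁻ y in baseProj n s ⁻¹' S, ‖projDensity H f c y‖ₑ ≤ ∫⁻ u in S, formSupDensity H f c u ∧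
    IntegrableOn (baseDensity H f c) S ∧
    ∫⁻ u in S, ‖baseDensity H f c u‖ₑ ≤ ∫⁻ u in S, formSupDensity H f c u ∧
    ∫ y in baseProj n s ⁻¹' S, projDensity H f c y = (-1) ^ s * ∫ u in S, baseDensity H f c u := by
  set g : (Fin n → ℂ) × (Fin s → ℂ) → ℂ := fun q => projDensity H f c (Sum.elim q.1 q.2) with hg
  set e := MeasurableEquiv.sumPiEquivProdPi fun _ : Fin n ⊕ Fin s => ℂ with he
  have hmp : MeasurePreserving e volume volume :=
    volume_measurePreserving_sumPiEquivProdPi fun _ : Fin n ⊕ Fin s => ℂ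
  have hge : g ∘ e = projDensity H f c := by
    ext1 y
    have : Sum.elim (e y).1 (e y).2 = y := by
      ext i
      cases i <;> rfl
    rw [Function.comp_apply, hg]
    exact congrArg _ this
  have hpre : e ⁻¹' (S ×ˢ univ) = baseProj n s ⁻¹' S := by
    ext y
    simp only [mem_preimage, mem_prod, mem_univ, and_true]
    rfl
  have hvol : (volume : Measure ((Fin n → ℂ) × (Fin s → ℂ))).restrict (S ×ˢ univ) =
      (volume.restrict S).prod volume := by
    rw [Measure.volume_eq_prod, ← Measure.prod_restrict, Measure.restrict_univ]
  have hmeas : AEStronglyMeasurable g ((volume.restrict S).prod volume) := by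
    rw [← hvol]
    exact ((continuousOn_projDensity_elim hU hH hf c).mono
      (prod_mono_left hSU)).aestronglyMeasurable (hS.prod MeasurableSet.univ)
  -- Tonelli and the fibrewise bound give integrability on the product.
  have hle : ∫⁻ q, ‖g q‖ₑ ∂((volume.restrict S).prod volume) ≤
      ∫⁻ u in S, formSupDensity H f c u := by
    rw [lintegral_prod _ hmeas.enorm]
    exact setLIntegral_mono' hS fun u hu =>
      lintegral_enorm_projDensity_elim_le hU hH f c (hSU hu).1 (hSU hu).2
  have hint : Integrable g ((volume.restrict S).prod volume) := ⟨hmeas, hle.trans_lt hfin⟩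
  have hbase : EqOn (fun u => ∫ w : Fin s → ℂ, g (u, w))
      (fun u => (-1) ^ s * baseDensity H f c u) S := fun u hu =>
    integral_projDensity_elim hU hH f c (hSU hu).1 (hSU hu).2
  have hsq : ((-1 : ℂ) ^ s) * (-1) ^ s = 1 := by rw [← mul_pow]; simp
  refine ⟨?_, ?_, ?_, ?_, ?_⟩
  · rw [← hge, ← hpre, hmp.integrableOn_comp_preimage e.measurableEmbedding, IntegrableOn, hvol]
    exact hint
  · have := hmp.setLIntegral_comp_preimage_emb e.measurableEmbedding (fun q => ‖g q‖ₑ) (S ×ˢ univ)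
    rw [hpre, hvol] at this
    rw [← hge]
    exact this.trans_le hle
  -- Integrability on the base is read off from Fubini: the base density is, up to sign, the fibre
  -- integral.
  · have h1 : IntegrableOn (fun u => (-1) ^ s * baseDensity H f c u) S :=
      (integrableOn_congr_fun hbase hS).1 hint.integral_prod_left
    refine (h1.const_mul ((-1) ^ s)).congr (Filter.Eventually.of_forall fun u => ?_)
    dsimp only
    rw [← mul_assoc, hsq, one_mul]
  · refine setLIntegral_mono' hS fun u hu => ?_
    have h2 : ‖baseDensity H f c u‖ₑ = ‖∫ w : Fin s → ℂ, projDensity H f c (Sum.elim u w)‖ₑ := by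
      rw [integral_projDensity_elim hU hH f c (hSU hu).1 (hSU hu).2]
      simp [enorm_mul, enorm_pow]
    rw [h2]
    exact (enorm_integral_le_lintegral_enorm _).trans
      (lintegral_enorm_projDensity_elim_le hU hH f c (hSU hu).1 (hSU hu).2)
  · have := hmp.setIntegral_preimage_emb e.measurableEmbedding g (S ×ˢ univ)
    rw [hpre, hvol, integral_prod _ hint, setIntegral_congr_fun hS hbase,
      integral_const_mul] at this
    rw [← hge]
    exact this

end fubini

/-! ### Independence of the dissection and the global integral formula. -/

section dissections

variable {n s : ℕ} {X : Type*} [TopologicalSpace X] [ChartedSpace (Fin n → ℂ) X]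
  {E : X → Type*} [TopologicalSpace (TotalSpace (Fin (s + 1) → ℂ) E)]
  [∀ x, AddCommGroup (E x)] [∀ x, Module ℂ (E x)] [∀ x, TopologicalSpace (E x)]
  [FiberBundle (Fin (s + 1) → ℂ) E] {H : ∀ x, E x →ₗ⋆[ℂ] E x →ₗ[ℂ] ℂ} {U : Set X}

theorem densityIntegrable_of_le {V : Type*} [MeasureSpace V] {S : ℕ → Set V} {β : ℕ → V → ℂ}
    (hint : ∀ i, IntegrableOn (β i) (S i)) {b : ℕ → ENNReal}
    (hle : ∀ i, ∫⁻ y in S i, ‖β i y‖ₑ ≤ b i) (hb : ∑' i, b i < ⊤) : DensityIntegrable S β := by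
  refine ⟨hint, ?_⟩
  have : (fun i => ∫ y in S i, ‖β i y‖) = fun i => (∫⁻ y in S i, ‖β i y‖ₑ).toReal := by
    ext1 i
    exact integral_norm_eq_lintegral_enorm (hint i).1
  rw [this]
  exact ENNReal.summable_toReal ((ENNReal.tsum_le_tsum hle).trans_lt hb).ne

theorem Dissection.piece_subset_of (A : Dissection n s E U) (i : ℕ) : A.piece i ⊆ U :=
  (subset_iUnion A.piece i).trans A.iUnion_piece.subset

theorem Dissection.coordPiece_subset (A : Dissection n s E U) (i : ℕ) :
    A.coordPiece i ⊆ (A.frameChart i).chart.target ∩ (A.frameChart i).chart.symm ⁻¹' U := by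
  rintro _ ⟨x, hx, rfl⟩
  refine ⟨(A.frameChart i).chart.map_source (A.piece_subset i hx), ?_⟩
  rw [mem_preimage, (A.frameChart i).chart.left_inv (A.piece_subset i hx)]
  exact A.piece_subset_of i hx

theorem Dissection.measurableSet_coordPiece (A : Dissection n s E U) (i : ℕ) :
    MeasurableSet (A.coordPiece i) :=
  measurableSet_chart_image (A.measurableSet_piece i) (A.piece_subset i)

theorem Dissection.measurableSet_inter (A B : Dissection n s E U) (i j : ℕ) :
    MeasurableSet[borel X] (A.piece i ∩ B.piece j) := by
  borelize X
  exact (A.measurableSet_piece i).inter (B.measurableSet_piece j)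

theorem Dissection.coordPiece_eq_iUnion (A B : Dissection n s E U) (i : ℕ) :
    A.coordPiece i = ⋃ j, (A.frameChart i).chart '' (A.piece i ∩ B.piece j) := by
  rw [← image_iUnion, ← inter_iUnion, B.iUnion_piece, inter_eq_left.2 (A.piece_subset_of i)]
  rfl

theorem Dissection.measurableSet_image_inter (A B : Dissection n s E U) (i j : ℕ) :
    MeasurableSet ((A.frameChart i).chart '' (A.piece i ∩ B.piece j)) :=
  measurableSet_chart_image (A.measurableSet_inter B i j)
    (inter_subset_left.trans (A.piece_subset i))

theorem Dissection.disjoint_image_inter (A B : Dissection n s E U) (i : ℕ) :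
    Pairwise (Function.onFun Disjoint fun j =>
      (A.frameChart i).chart '' (A.piece i ∩ B.piece j)) := fun _ _ hjk =>
  ((B.disjoint hjk).mono inter_subset_right inter_subset_right).image
    (A.frameChart i).chart.injOn (inter_subset_left.trans (A.piece_subset i))
    (inter_subset_left.trans (A.piece_subset i))

theorem Dissection.setIntegral_coordPiece (A B : Dissection n s E U) (i : ℕ)
    {β : (Fin n → ℂ) → ℂ} (hβ : IntegrableOn β (A.coordPiece i)) :
    ∫ u in A.coordPiece i, β u =
      ∑' j, ∫ u in (A.frameChart i).chart '' (A.piece i ∩ B.piece j), β u := by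
  rw [A.coordPiece_eq_iUnion B i] at hβ ⊢
  exact integral_iUnion (A.measurableSet_image_inter B i) (A.disjoint_image_inter B i) hβ

theorem Dissection.tsum_setLIntegral_inter (A B : Dissection n s E U) (i : ℕ)
    (β : (Fin n → ℂ) → ENNReal) :
    ∑' j, ∫⁻ u in (A.frameChart i).chart '' (A.piece i ∩ B.piece j), β u =
      ∫⁻ u in A.coordPiece i, β u := by
  rw [A.coordPiece_eq_iUnion B i]
  exact (lintegral_iUnion (A.measurableSet_image_inter B i) (A.disjoint_image_inter B i) β).symm

variable [IsManifold 𝓘(ℂ, Fin n → ℂ) ω X] [VectorBundle ℂ (Fin (s + 1) → ℂ) E]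
  [ContMDiffVectorBundle ω (Fin (s + 1) → ℂ) E 𝓘(ℂ, Fin n → ℂ)]

/-- The integral over the base does not depend on the dissection. -/
theorem densityIntegral_baseDensity_eq (hU : IsOpen U)
    (hH : IsHermitianMetricOn (n := n) (s := s) H U) (f : X → Form (Fin n))
    (A B : Dissection n s E U)
    (hA : DensityIntegrable A.coordPiece fun i => baseDensity H f (A.frameChart i))
    (hB : DensityIntegrable B.coordPiece fun i => baseDensity H f (B.frameChart i))
    (hfin : ∑' i, ∫⁻ u in A.coordPiece i, ‖baseDensity H f (A.frameChart i) u‖ₑ < ⊤) :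
    densityIntegral A.coordPiece (fun i => baseDensity H f (A.frameChart i)) =
      densityIntegral B.coordPiece (fun i => baseDensity H f (B.frameChart i)) := by
  -- Integrals over the common refinement; each may be computed in the chart of either dissection.
  set q : ℕ → ℕ → ℂ := fun i j => ∫ u in (A.frameChart i).chart '' (A.piece i ∩ B.piece j),
    baseDensity H f (A.frameChart i) u with hq
  have hq' : ∀ i j, q i j = ∫ u in (B.frameChart j).chart '' (B.piece j ∩ A.piece i),
      baseDensity H f (B.frameChart j) u := fun i j => by
    rw [inter_comm]
    exact (integral_baseDensity_image hU hH f (A.frameChart i) (B.frameChart j)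
      (A.measurableSet_inter B i j) (inter_subset_left.trans (A.piece_subset i))
      (inter_subset_right.trans (B.piece_subset j))
      (inter_subset_left.trans (A.piece_subset_of i))).symm
  -- Absolute summability over pairs licenses exchanging the two sums.
  have hsum : Summable (Function.uncurry q) := by
    refine Summable.of_norm ?_
    have e : (fun p => ‖Function.uncurry q p‖) = fun p => (‖Function.uncurry q p‖ₑ).toReal := by
      ext1 p
      exact (toReal_enorm _).symm
    rw [e]
    refine ENNReal.summable_toReal (ne_of_lt ?_)
    rw [ENNReal.tsum_prod']
    refine lt_of_le_of_lt (ENNReal.tsum_le_tsum fun i => ?_) hfin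
    rw [← A.tsum_setLIntegral_inter B i]
    exact ENNReal.tsum_le_tsum fun j => enorm_integral_le_lintegral_enorm _
  calc densityIntegral A.coordPiece (fun i => baseDensity H f (A.frameChart i))
      = ∑' i, ∑' j, q i j := tsum_congr fun i => A.setIntegral_coordPiece B i (hA.1 i)
    _ = ∑' j, ∑' i, q i j := hsum.tsum_comm.symm
    _ = densityIntegral B.coordPiece (fun i => baseDensity H f (B.frameChart i)) := by
        refine tsum_congr fun j => ?_
        rw [B.setIntegral_coordPiece A j (hB.1 j)]
        exact tsum_congr fun i => hq' i j

/-- For a single dissection the formula holds piece by piece by Fubini; the base integral is moved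
from `A` to `B` by independence of the dissection. -/
theorem integral_segreForm {D : Set X} (hD : IsClosed D)
    {P : ParabolicStructure n s E D} (hH : IsAdmissible P H) {f : X → Form (Fin n)}
    (hf : IsSmoothForm f) (hfc : HasCompactSupport f) (A B : Dissection n s E Dᶜ) :
    DensityIntegrable A.coordPiece (fun i => baseDensity H f (A.frameChart i)) ∧
    DensityIntegrable B.projPiece (fun i => projDensity H f (B.frameChart i)) ∧
    densityIntegral B.projPiece (fun i => projDensity H f (B.frameChart i)) =
      (-1 : ℂ) ^ s *
        densityIntegral A.coordPiece (fun i => baseDensity H f (A.frameChart i)) := by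
  have hfin := tsum_lintegral_formSupDensity_lt_top hD hH hf hfc
  have key := fun (C : Dissection n s E Dᶜ) (i : ℕ) =>
    integrableOn_projDensity hD.isOpen_compl hH.isHermitianMetricOn hf (C.frameChart i)
      (C.measurableSet_coordPiece i) (C.coordPiece_subset i)
      ((ENNReal.le_tsum i).trans_lt (hfin C))
  have hbase := fun C : Dissection n s E Dᶜ =>
    densityIntegrable_of_le (fun i => (key C i).2.2.1) (fun i => (key C i).2.2.2.1) (hfin C)
  refine ⟨hbase A, densityIntegrable_of_le (fun i => (key B i).1) (fun i => (key B i).2.1)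
    (hfin B), ?_⟩
  rw [densityIntegral_baseDensity_eq hD.isOpen_compl hH.isHermitianMetricOn f A B (hbase A)
    (hbase B) ((ENNReal.tsum_le_tsum fun i => (key A i).2.2.2.1).trans_lt (hfin A)),
    densityIntegral, densityIntegral, ← tsum_mul_left]
  exact tsum_congr fun i => (key B i).2.2.2.2

end dissections

end ParabolicSegre

end

theorem mainTheorem2 (n s : ℕ) {X : Type*} [TopologicalSpace X] [T2Space X]
    [SecondCountableTopology X] [ChartedSpace (Fin n → ℂ) X]
    [IsManifold 𝓘(ℂ, Fin n → ℂ) ω X]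
    (E : X → Type*) [TopologicalSpace (TotalSpace (Fin (s + 1) → ℂ) E)]
    [∀ x, AddCommGroup (E x)] [∀ x, Module ℂ (E x)] [∀ x, TopologicalSpace (E x)]
    [FiberBundle (Fin (s + 1) → ℂ) E] [VectorBundle ℂ (Fin (s + 1) → ℂ) E]
    [ContMDiffVectorBundle ω (Fin (s + 1) → ℂ) E 𝓘(ℂ, Fin n → ℂ)]
    (D : Set X) (hD : IsSmoothDivisor n D) (P : ParabolicStructure n s E D)
    (H : ∀ x, E x →ₗ⋆[ℂ] E x →ₗ[ℂ] ℂ) (hH : IsAdmissible P H) :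
    (∀ (c : FrameChart n s E), ∀ u ∈ c.chart.target, c.chart.symm u ∉ D →
      IsFiberIntegral (segreForm (lineGram H c)) u ((-1 : ℂ) ^ s • segreForm (gram H c) u)) ∧
    ∀ f : X → Form (Fin n), IsSmoothForm f → HasCompactSupport f →
      ∀ A B : Dissection n s E Dᶜ,
        DensityIntegrable A.coordPiece (fun i => baseDensity H f (A.frameChart i)) ∧
        DensityIntegrable B.projPiece (fun i => projDensity H f (B.frameChart i)) ∧
        densityIntegral B.projPiece (fun i => projDensity H f (B.frameChart i)) =
          (-1 : ℂ) ^ s *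
            densityIntegral A.coordPiece (fun i => baseDensity H f (A.frameChart i)) := by
  exact ⟨fun c u hu hx => isFiberIntegral_segreForm hD.isClosed.isOpen_compl
    hH.isHermitianMetricOn c hu hx,
    fun _ hf hfc A B => integral_segreForm hD.isClosed hH hf hfc A B⟩
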